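/- Let $d\in\{1,2\}$ and let $0\le N\le M$ be integers, with $M>d/2$ if $d=2$ (so $M=N$ is allowed if $d=1$ or $N\ge 2$). For $\gamma>0$ write $\nabla^\gamma=\partial_x$ if $d=1$, $\nabla^\gamma=(\partial_x,\gamma\partial_y)$ if $d=2$, and let $\nabla^\gamma\cdot$ be the corresponding divergence; all derivatives are in the sense of distributions on $\mathbb R^d$. For $\mu>0$ let $X^N=\{V\in H^N(\mathbb R^d)^d:\ \nabla^\gamma\cdot V\in H^N(\mathbb R^d)\}$ with $$|V|_{X^N}^2=|V|_{H^N}^2+\mu\,|\nabla^\gamma\cdot V|_{H^N}^2 .$$ For every $\mu_{\max}$ and $\gamma_{\max}$ there is a function $C(\cdot,\cdot)$, nondecreasing in each argument and depending only on $d,N,M,\mu_{\max},\gamma_{\max}$, such that the following holds for all $0<\mu\le\mu_{\max}$, all $0<\gamma\le\gamma_{\max}$, all $h_{\min}>0$ and all functions $h_b:\mathbb R^d\to\mathbb R$ with $h_b-1\in H^{M+1}(\mathbb R^d)$ and $h_b(X)\ge h_{\min}$ for all $X\in\mathbb R^d$. Let $$h_b\mathcal A V=h_b\Big(V-\mu\nabla^\gamma\big(\tfrac1{h_b}\nabla^\gamma\cdot(h_bV)\big)\Big),\qquad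 V\in X^0,$$ which is a distribution, the product of $h_b$ and $\nabla^\gamma q$ with $q\in L^2(\mathbb R^d)$ being defined by $\langle h_b\nabla^\gamma q,\varphi\rangle=-\int q\,\nabla^\gamma\cdot(h_b\varphi)$ for $\varphi\in C_c^\infty(\mathbb R^d)^d$. (1) For every $f\in H^N(\mathbb R^d)^d$ there is exactly one $V\in X^0$ with $h_b\mathcal A V=f$; this $V=(h_b\mathcal A)^{-1}f$ belongs to $X^N$, and $$|(h_b\mathcal A)^{-1}f|_{X^N}\le C\big(\tfrac1{h_{\min}},|h_b-1|_{H^{M+1}}\big)\,|f|_{H^N}.$$ (2) For every $g\in H^N(\mathbb R^d)$ there is exactly one $V\in X^0$ with $h_b\mathcal A V=\nabla^\gamma g$; this $V=(h_b\mathcal A)^{-1}\nabla^\gamma g$ belongs to $X^N$, and $$\sqrt\mu\,|(h_b\mathcal A)^{-1}\nabla^\gamma g|_{X^N}\le C\big(\tfrac1{h_{\min}},|h_b-1|_{H^{M+1}}\big)\,|g|_{H^N}.$$ -/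

import Mathlib

open MeasureTheory

noncomputable section

namespace Boussinesq

/-- The horizontal space `ℝ^d` with its Euclidean structure. -/
abbrev Space (d : ℕ) : Type := EuclideanSpace ℝ (Fin d)

/-- A vector field on `ℝ^d`, given by its `d` scalar components. -/
abbrev Field (d : ℕ) : Type := Fin d → Space d → ℝ

variable {d : ℕ}

/-- The classical partial derivative `∂_i φ`. -/
def partialDeriv (i : Fin d) (φ : Space d → ℝ) (x : Space d) : ℝ :=
  fderiv ℝ φ x (EuclideanSpace.single i 1)

/-- Test functions: elements of `C_c^∞(ℝ^d)`. -/
structure IsTest (φ : Space d → ℝ) : Prop where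
  smooth : ContDiff ℝ (⊤ : ℕ∞) φ
  compact : HasCompactSupport φ

/-- Test vector fields: elements of `C_c^∞(ℝ^d)^d`. -/
def IsTestField (φ : Field d) : Prop := ∀ i, IsTest (φ i)

/-! ### Weak derivatives and the Sobolev spaces `H^k(ℝ^d)` -/

/-- `v` is the weak partial derivative `∂_i u`. -/
structure HasWeakPartial (i : Fin d) (u v : Space d → ℝ) : Prop where
  locInt : LocallyIntegrable u
  locInt_deriv : LocallyIntegrable v
  integral_eq : ∀ φ : Space d → ℝ, IsTest φ →
    ∫ x, u x * partialDeriv i φ x = -∫ x, v x * φ x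

open Classical in
/-- The weak partial derivative `∂_i u` (unique up to null sets; `0` if there is none). -/
def weakPartial (i : Fin d) (u : Space d → ℝ) : Space d → ℝ :=
  if h : ∃ v, HasWeakPartial i u v then h.choose else 0

/-- `u ∈ H^k(ℝ^d)`: all weak derivatives of `u` of order at most `k` are in `L^2`. -/
def MemH : ℕ → (Space d → ℝ) → Prop
  | 0, u => MemLp u 2
  | k + 1, u => MemH k u ∧ ∀ i, ∃ v, HasWeakPartial i u v ∧ MemH k v

/-- The square of the standard norm of `H^k(ℝ^d)`. The recursion
`|u|_{H^{k+1}}^2 = |u|_{H^k}^2 + ∑ i, |∂_i u|_{H^k}^2` corresponds to the identity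
`(1 + |ξ|^2)^{k+1} = (1 + |ξ|^2)^k + ∑ i, ξ_i^2 (1 + |ξ|^2)^k` on the Fourier side, so that this
is exactly `|(1 - Δ)^{k/2} u|_{L^2}^2`. -/
def normHSq : ℕ → (Space d → ℝ) → ℝ
  | 0, u => ∫ x, u x ^ 2
  | k + 1, u => normHSq k u + ∑ i, normHSq k (weakPartial i u)

/-- The norm of `H^k(ℝ^d)`. -/
def normH (k : ℕ) (u : Space d → ℝ) : ℝ := Real.sqrt (normHSq k u)

/-- `V ∈ H^k(ℝ^d)^d`. -/
def MemHVec (k : ℕ) (V : Field d) : Prop := ∀ i, MemH k (V i)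

/-- The norm of `H^k(ℝ^d)^d`. -/
def normHVec (k : ℕ) (V : Field d) : ℝ := Real.sqrt (∑ i, normHSq k (V i))

/-! ### The twisted operators `∇^γ` and `∇^γ·` -/

/-- The coefficients of `∇^γ = (∂_x, γ ∂_y)` (of `∇^γ = ∂_x` if `d = 1`). -/
def gammaCoeff (γ : ℝ) (i : Fin d) : ℝ := if (i : ℕ) = 0 then 1 else γ

/-- The classical twisted divergence `∇^γ·φ = ∑ i, γ_i ∂_i φ_i`. -/
def divGamma (γ : ℝ) (φ : Field d) (x : Space d) : ℝ :=
  ∑ i, gammaCoeff γ i * partialDeriv i (φ i) x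

/-- `p` is the twisted divergence `∇^γ·V` of `V` in the sense of distributions. -/
structure HasWeakDiv (γ : ℝ) (V : Field d) (p : Space d → ℝ) : Prop where
  locInt : ∀ i, LocallyIntegrable (V i)
  locInt_div : LocallyIntegrable p
  integral_eq : ∀ φ : Space d → ℝ, IsTest φ →
    ∑ i, gammaCoeff γ i * ∫ x, V i x * partialDeriv i φ x = -∫ x, p x * φ x

open Classical in
/-- The weak twisted divergence `∇^γ·V` (unique up to null sets; `0` if there is none). -/
def weakDiv (γ : ℝ) (V : Field d) : Space d → ℝ :=
  if h : ∃ p, HasWeakDiv γ V p then h.choose else 0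

/-- `V ∈ X^N`: `V ∈ H^N(ℝ^d)^d` and `∇^γ·V ∈ H^N(ℝ^d)`. -/
def MemX (γ : ℝ) (N : ℕ) (V : Field d) : Prop :=
  MemHVec N V ∧ ∃ p, HasWeakDiv γ V p ∧ MemH N p

/-- The norm of `X^N`: `|V|_{X^N}^2 = |V|_{H^N}^2 + μ |∇^γ·V|_{H^N}^2`. -/
def normX (γ μ : ℝ) (N : ℕ) (V : Field d) : ℝ :=
  Real.sqrt (normHVec N V ^ 2 + μ * normH N (weakDiv γ V) ^ 2)

/-! ### Vector-valued distributions and the operator `h_b 𝒜` -/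

/-- Functionals on vector fields, to be tested on `C_c^∞(ℝ^d)^d`. -/
abbrev Functional (d : ℕ) : Type := Field d → ℝ

/-- Equality of functionals as (vector-valued) distributions. -/
def DistribEq (S T : Functional d) : Prop := ∀ φ : Field d, IsTestField φ → S φ = T φ

/-- The distribution defined by a vector field `f`: `⟨f, φ⟩ = ∫ f · φ`. -/
def ofField (f : Field d) : Functional d := fun φ => ∫ x, ∑ i, f i x * φ i x

/-- The distribution `∇^γ g`: `⟨∇^γ g, φ⟩ = -∫ g ∇^γ·φ`. -/
def gradGamma (γ : ℝ) (g : Space d → ℝ) : Functional d := fun φ => -∫ x, g x * divGamma γ φ x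

/-- The product of the scalar function `h` and the vector field `V`. -/
def mulField (h : Space d → ℝ) (V : Field d) : Field d := fun i x => h x * V i x

/-- The distribution `h ∇^γ q`, for `h` with weak derivatives: the product is defined by duality,
`⟨h ∇^γ q, φ⟩ = ⟨∇^γ q, h φ⟩ = -∫ q ∇^γ·(h φ)`. -/
def mulGradGamma (γ : ℝ) (h q : Space d → ℝ) : Functional d :=
  fun φ => -∫ x, q x * weakDiv γ (mulField h φ) x

/-- The distribution `h 𝒜 V`, where `𝒜 V = V - μ ∇^γ (h⁻¹ ∇^γ·(h V))`. -/
def hA (γ μ : ℝ) (h : Space d → ℝ) (V : Field d) : Functional d :=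
  fun φ => ofField (mulField h V) φ
    - μ * mulGradGamma γ h (fun x => (h x)⁻¹ * weakDiv γ (mulField h V) x) φ

/-- `V` is the only element of `X^0`, up to null sets, with `h 𝒜 V = F`; that is,
`V = (h 𝒜)⁻¹ F`. The field `memX_mul` records that `∇^γ·(h V)` exists in `L^2`, so that
`h 𝒜 V` is a genuine distribution. -/
structure IsInverse (γ μ : ℝ) (h : Space d → ℝ) (F : Functional d) (V : Field d) : Prop where
  memX : MemX γ 0 V
  memX_mul : MemX γ 0 (mulField h V)
  eq : DistribEq (hA γ μ h V) F
  unique : ∀ W : Field d, MemX γ 0 W → DistribEq (hA γ μ h W) F → ∀ i, W i =ᵐ[volume] V i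

end Boussinesq

end

/-!
The equation `h 𝒜 V = F` is reduced to a scalar elliptic equation for `q = h⁻¹ ∇^γ·(h V)`. Since
`h 𝒜 V = h V - μ h ∇^γ q`, the equation `h 𝒜 V = f` says `V = μ ∇^γ q + h⁻¹ f`, and multiplying by
`h` and taking the divergence gives `h q - μ ∇^γ·(h ∇^γ q) = ∇^γ·f`. For `F = ∇^γ g` the function
`p = μ q + h⁻¹ g` satisfies `h p - μ ∇^γ·(h ∇^γ p) = g + μ ∇^γ·(h⁻¹ g ∇^γ h)`, and
`V = ∇^γ p + h⁻² g ∇^γ h`; no derivative of `g` appears. If `d = 1` and `M = 0`, the product `h' g`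
is not in `L²`; then `N = 0`, and the Lax–Milgram theorem is applied to `U = h V` directly
(`exists_hA_eq_gradGamma_one`).

The equation `h p - μ ∇^γ·(h ∇^γ p) = r + ∇^γ·F` is solved in `H^1` by the Lax–Milgram theorem
(`exists_ellipticForm_eq`). Its solutions gain derivatives (`IsEllipticSolution.memH_succ`): divided
by `h` it has constant coefficients and data with only first derivatives of `p`, and for constant
coefficients `∂_j p` agrees with the solution of the differentiated equation by uniqueness of very
weak solutions (`ae_eq_zero_of_very_weak`), which follows by mollification. The estimates
(`exists_solSize_le`) come from the energy estimate for the derivatives of the equation. In the norm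
`|p|_{H^n} + √μ |∇^γ p|_{H^n}`, with data measured by `|r|_{H^n} + |F|_{H^n} / √μ`, they are uniform
in `μ` and `γ`. Finally `∇^γ·V = q - ∑ i, γ_i h⁻¹ ∂_i h V_i` is in `H^N`
(`exists_normH_weakDiv_le`).

Uniqueness (`ae_eq_zero_of_hA`): if `h 𝒜 U = 0`, testing with `h⁻¹ ψ` gives `μ ∇^γ q = U`, hence
`q ∈ H^1`, and testing `∇^γ·(h U) = h q` with `q` gives `∫ h |U|² = -μ ∫ h q²`.

All of this rests on the fact that `H^{M+1}` functions are multipliers of `H^j` for `j ≤ M + 1`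
(`exists_normH_mul_le`), and on the stability of `H^j` under division by `h`
(`exists_depth_inv_mul_le`). Sobolev spaces are treated without the Fourier transform: test
functions are dense (`MemH.exists_test_seq`), and in dimensions one and two the embeddings follow
from the fundamental theorem of calculus (`IsTest.abs_le_normH`) and the Gagliardo–Nirenberg–Sobolev
inequality (`exists_normH_zero_mul_le`).
-/

open MeasureTheory Filter Topology

namespace Boussinesq

variable {d : ℕ}

/-! ### Test functions -/

theorem IsTest.continuous {φ : Space d → ℝ} (h : IsTest φ) : Continuous φ := h.smooth.continuous

theorem IsTest.memLp {φ : Space d → ℝ} (h : IsTest φ) (p : ENNReal) : MemLp φ p :=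
  h.continuous.memLp_of_hasCompactSupport h.compact

protected theorem IsTest.partialDeriv {φ : Space d → ℝ} (h : IsTest φ) (i : Fin d) :
    IsTest (partialDeriv i φ) where
  smooth := (h.smooth.fderiv_right (m := (⊤ : ℕ∞)) (by norm_cast)).clm_apply contDiff_const
  compact := by
    have := h.compact.fderiv (𝕜 := ℝ)
    exact this.comp_left (g := fun L : Space d →L[ℝ] ℝ => L (EuclideanSpace.single i 1)) (by simp)

theorem IsTest.differentiable {φ : Space d → ℝ} (h : IsTest φ) : Differentiable ℝ φ :=
  h.smooth.differentiable (by simp)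

theorem IsTest.const_mul {φ : Space d → ℝ} (h : IsTest φ) (c : ℝ) : IsTest (fun x => c * φ x) :=
  ⟨contDiff_const.mul h.smooth, h.compact.mul_left⟩

theorem IsTest.smooth_mul {φ ψ : Space d → ℝ} (h : ContDiff ℝ (⊤ : ℕ∞) φ) (h' : IsTest ψ) :
    IsTest (fun x => φ x * ψ x) := ⟨h.mul h'.smooth, h'.compact.mul_left⟩

theorem IsTest.zero : IsTest (fun _ : Space d => (0 : ℝ)) :=
  ⟨contDiff_const, HasCompactSupport.zero⟩

theorem partialDeriv_mul {φ ψ : Space d → ℝ} (h : Differentiable ℝ φ) (h' : Differentiable ℝ ψ)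
    (i : Fin d) (x : Space d) :
    partialDeriv i (fun x => φ x * ψ x) x =
      partialDeriv i φ x * ψ x + φ x * partialDeriv i ψ x := by
  unfold partialDeriv
  rw [fderiv_fun_mul (h x) (h' x)]
  simp
  ring

theorem partialDeriv_comm {φ : Space d → ℝ} (h : IsTest φ) (i j : Fin d) :
    partialDeriv i (partialDeriv j φ) = partialDeriv j (partialDeriv i φ) := by
  have h1 : Differentiable ℝ (fderiv ℝ φ) :=
    (h.smooth.fderiv_right (m := (⊤ : ℕ∞)) (by norm_cast)).differentiable (by simp)
  have key : ∀ (i j : Fin d) (x : Space d), partialDeriv i (partialDeriv j φ) x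
      = fderiv ℝ (fderiv ℝ φ) x (EuclideanSpace.single i 1) (EuclideanSpace.single j 1) := by
    intro i j x
    unfold partialDeriv
    rw [fderiv_clm_apply (h1 x) (differentiableAt_const _)]
    simp
  funext x
  rw [key, key]
  have h2 : (2 : WithTop ℕ∞) ≤ ((⊤ : ℕ∞) : WithTop ℕ∞) :=
    WithTop.coe_le_coe.2 (le_top : (2 : ℕ∞) ≤ ⊤)
  exact ((h.smooth.contDiffAt).isSymmSndFDerivAt (by simpa using h2)).eq _ _

/-! ### Square integrable functions -/

theorem MemLp.locallyIntegrable_two {u : Space d → ℝ} (hu : MemLp u 2) : LocallyIntegrable u :=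
  hu.locallyIntegrable (by norm_num)

theorem MemLp.integrable_mul_two {u v : Space d → ℝ} (hu : MemLp u 2) (hv : MemLp v 2) :
    Integrable (fun x => u x * v x) := hu.integrable_mul hv

theorem LocallyIntegrable.integrable_mul_test {u φ : Space d → ℝ} (hu : LocallyIntegrable u)
    (hφ : IsTest φ) : Integrable (fun x => u x * φ x) := by
  simpa [mul_comm] using hu.integrable_smul_left_of_hasCompactSupport hφ.continuous hφ.compact

/-- The Cauchy–Schwarz inequality in `L²`. -/
theorem integral_mul_sq_le {u v : Space d → ℝ} (hu : MemLp u 2) (hv : MemLp v 2) :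
    (∫ x, u x * v x) ^ 2 ≤ (∫ x, u x ^ 2) * ∫ x, v x ^ 2 := by
  have huu := hu.integrable_sq
  have hvv := hv.integrable_sq
  have huv := MemLp.integrable_mul_two hu hv
  have key : ∀ t : ℝ, 0 ≤ (∫ x, v x ^ 2) * (t * t) + (2 * ∫ x, u x * v x) * t + ∫ x, u x ^ 2 := by
    intro t
    have : (∫ x, v x ^ 2) * (t * t) + (2 * ∫ x, u x * v x) * t + ∫ x, u x ^ 2
        = ∫ x, (t * v x + u x) ^ 2 := by
      have : ∀ x, (t * v x + u x) ^ 2 = (t * t) * v x ^ 2 + (2 * t) * (u x * v x) + u x ^ 2 := by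
        intro x; ring
      simp_rw [this]
      rw [integral_add, integral_add, integral_const_mul, integral_const_mul]
      · ring
      · exact hvv.const_mul _
      · exact huv.const_mul _
      · exact (hvv.const_mul _).add (huv.const_mul _)
      · exact huu
    rw [this]
    exact integral_nonneg fun x => sq_nonneg _
  have := discrim_le_zero key
  unfold discrim at this
  nlinarith

theorem abs_integral_mul_le {u v : Space d → ℝ} (hu : MemLp u 2) (hv : MemLp v 2) :
    |∫ x, u x * v x| ≤ √(∫ x, u x ^ 2) * √(∫ x, v x ^ 2) := by
  rw [← Real.sqrt_mul (integral_nonneg fun x => sq_nonneg _)]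
  exact Real.abs_le_sqrt (integral_mul_sq_le hu hv)

/-- The square of the triangle inequality, with a free parameter. -/
theorem integral_sq_add_le {u v : Space d → ℝ} (hu : MemLp u 2) (hv : MemLp v 2) {t : ℝ}
    (ht : 0 < t) :
    ∫ x, (u x + v x) ^ 2 ≤ (1 + t) * (∫ x, u x ^ 2) + (1 + t⁻¹) * ∫ x, v x ^ 2 := by
  rw [← integral_const_mul, ← integral_const_mul,
    ← integral_add (hu.integrable_sq.const_mul _) (hv.integrable_sq.const_mul _)]
  refine integral_mono (hu.add hv).integrable_sq
    ((hu.integrable_sq.const_mul _).add (hv.integrable_sq.const_mul _)) fun x => ?_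
  have : 0 ≤ t⁻¹ * (t * u x - v x) ^ 2 := by positivity
  have e : t⁻¹ * (t * u x - v x) ^ 2 = t * u x ^ 2 - 2 * u x * v x + t⁻¹ * v x ^ 2 := by
    field_simp
    ring
  simp only
  nlinarith

theorem ae_eq_zero_of_integral_sq_nonpos {u : Space d → ℝ} (hu : MemLp u 2)
    (h : ∫ x, u x ^ 2 ≤ 0) : u =ᵐ[volume] 0 := by
  have h0 : ∫ x, u x ^ 2 = 0 := le_antisymm h (integral_nonneg fun x => sq_nonneg _)
  rw [integral_eq_zero_iff_of_nonneg (fun x => sq_nonneg _) hu.integrable_sq] at h0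
  filter_upwards [h0] with x hx
  simpa using hx

/-- Multiplication by a bounded function preserves `L²`. -/
theorem MemLp.bdd_mul_two {a u : Space d → ℝ} (hu : MemLp u 2) (ha : AEStronglyMeasurable a)
    {B : ℝ} (hB : ∀ᵐ x, |a x| ≤ B) : MemLp (fun x => a x * u x) 2 := by
  refine MemLp.of_le_mul (c := B) hu (ha.mul hu.1) ?_
  filter_upwards [hB] with x hx
  simp only [norm_mul, Real.norm_eq_abs]
  gcongr

theorem integral_sq_bdd_mul_le {a u : Space d → ℝ} (hu : MemLp u 2) (ha : AEStronglyMeasurable a)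
    {B : ℝ} (hB : ∀ᵐ x, |a x| ≤ B) : ∫ x, (a x * u x) ^ 2 ≤ B ^ 2 * ∫ x, u x ^ 2 := by
  rw [← integral_const_mul]
  refine integral_mono_ae (MemLp.bdd_mul_two hu ha hB).integrable_sq
    (hu.integrable_sq.const_mul _) ?_
  filter_upwards [hB] with x hx
  rw [mul_pow]
  gcongr ?_ * _
  rw [← sq_abs]
  gcongr

/-! ### Weak partial derivatives -/

theorem HasWeakPartial.unique {i : Fin d} {u v w : Space d → ℝ} (h : HasWeakPartial i u v)
    (h' : HasWeakPartial i u w) : v =ᵐ[volume] w := by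
  refine ae_eq_of_integral_contDiff_smul_eq h.locInt_deriv h'.locInt_deriv fun g hg hc => ?_
  have h1 := h.integral_eq g ⟨hg, hc⟩
  have h2 := h'.integral_eq g ⟨hg, hc⟩
  simp only [smul_eq_mul, mul_comm (g _)]
  linarith

theorem LocallyIntegrable.congr_ae {u v : Space d → ℝ} (h : LocallyIntegrable u)
    (huv : u =ᵐ[volume] v) : LocallyIntegrable v := by
  intro x
  obtain ⟨s, hs, hi⟩ := h x
  exact ⟨s, hs, hi.congr_fun_ae (ae_restrict_of_ae huv)⟩

theorem HasWeakPartial.congr {i : Fin d} {u v u' v' : Space d → ℝ} (h : HasWeakPartial i u v)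
    (hu : u =ᵐ[volume] u') (hv : v =ᵐ[volume] v') : HasWeakPartial i u' v' where
  locInt := LocallyIntegrable.congr_ae h.locInt hu
  locInt_deriv := LocallyIntegrable.congr_ae h.locInt_deriv hv
  integral_eq φ hφ := by
    have h1 : ∫ x, u' x * partialDeriv i φ x = ∫ x, u x * partialDeriv i φ x :=
      integral_congr_ae (hu.symm.mul (ae_eq_refl (partialDeriv i φ)))
    have h2 : ∫ x, v' x * φ x = ∫ x, v x * φ x := integral_congr_ae (hv.symm.mul (ae_eq_refl φ))
    rw [h1, h2]
    exact h.integral_eq φ hφ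

theorem HasWeakPartial.add {i : Fin d} {u v u' v' : Space d → ℝ} (h : HasWeakPartial i u v)
    (h' : HasWeakPartial i u' v') :
    HasWeakPartial i (fun x => u x + u' x) (fun x => v x + v' x) where
  locInt := h.locInt.add h'.locInt
  locInt_deriv := h.locInt_deriv.add h'.locInt_deriv
  integral_eq φ hφ := by
    simp only [add_mul]
    rw [integral_add (LocallyIntegrable.integrable_mul_test h.locInt (hφ.partialDeriv i))
      (LocallyIntegrable.integrable_mul_test h'.locInt (hφ.partialDeriv i)),
      integral_add (LocallyIntegrable.integrable_mul_test h.locInt_deriv hφ)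
      (LocallyIntegrable.integrable_mul_test h'.locInt_deriv hφ), h.integral_eq φ hφ,
      h'.integral_eq φ hφ]
    ring

theorem HasWeakPartial.const_mul {i : Fin d} {u v : Space d → ℝ} (h : HasWeakPartial i u v)
    (c : ℝ) : HasWeakPartial i (fun x => c * u x) (fun x => c * v x) where
  locInt := h.locInt.smul c
  locInt_deriv := h.locInt_deriv.smul c
  integral_eq φ hφ := by
    simp only [mul_assoc, integral_const_mul]
    rw [h.integral_eq φ hφ]
    ring

theorem HasWeakPartial.sub {i : Fin d} {u v u' v' : Space d → ℝ} (h : HasWeakPartial i u v)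
    (h' : HasWeakPartial i u' v') :
    HasWeakPartial i (fun x => u x - u' x) (fun x => v x - v' x) := by
  simpa [sub_eq_add_neg] using h.add (h'.const_mul (-1))

theorem integral_partialDeriv (i : Fin d) {u φ : Space d → ℝ} (hu : ContDiff ℝ 1 u)
    (hφ : IsTest φ) : ∫ x, u x * partialDeriv i φ x = -∫ x, partialDeriv i u x * φ x := by
  have hu' : Continuous (partialDeriv i u) :=
    (hu.continuous_fderiv (by simp)).clm_apply continuous_const
  exact integral_mul_fderiv_eq_neg_fderiv_mul_of_integrable
    ((LocallyIntegrable.integrable_mul_test hu'.locallyIntegrable hφ))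
    (LocallyIntegrable.integrable_mul_test hu.continuous.locallyIntegrable (hφ.partialDeriv i))
    (LocallyIntegrable.integrable_mul_test hu.continuous.locallyIntegrable hφ)
    (fun x _ => hu.differentiable (by simp) x) (fun x _ => hφ.differentiable x)

theorem hasWeakPartial_of_contDiff (i : Fin d) {u : Space d → ℝ} (hu : ContDiff ℝ 1 u) :
    HasWeakPartial i u (partialDeriv i u) where
  locInt := hu.continuous.locallyIntegrable
  locInt_deriv := ((hu.continuous_fderiv (by simp)).clm_apply continuous_const).locallyIntegrable
  integral_eq _ hφ := integral_partialDeriv i hu hφ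

theorem IsTest.hasWeakPartial {φ : Space d → ℝ} (h : IsTest φ) (i : Fin d) :
    HasWeakPartial i φ (partialDeriv i φ) :=
  hasWeakPartial_of_contDiff i (h.smooth.of_le (by norm_cast))

protected theorem HasWeakPartial.weakPartial {i : Fin d} {u v : Space d → ℝ}
    (h : HasWeakPartial i u v) :
    HasWeakPartial i u (weakPartial i u) := by
  have he : ∃ v, HasWeakPartial i u v := ⟨v, h⟩
  unfold weakPartial
  rw [dif_pos he]
  exact he.choose_spec

theorem HasWeakPartial.weakPartial_ae {i : Fin d} {u v : Space d → ℝ}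
    (h : HasWeakPartial i u v) : weakPartial i u =ᵐ[volume] v := h.weakPartial.unique h

theorem weakPartial_congr {i : Fin d} {u u' : Space d → ℝ} (h : u =ᵐ[volume] u') :
    weakPartial i u =ᵐ[volume] weakPartial i u' := by
  by_cases he : ∃ v, HasWeakPartial i u v
  · obtain ⟨v, hv⟩ := he
    exact hv.weakPartial_ae.trans (hv.congr h (ae_eq_refl _)).weakPartial_ae.symm
  · have he' : ¬ ∃ v, HasWeakPartial i u' v := fun ⟨v, hv⟩ =>
      he ⟨v, hv.congr h.symm (ae_eq_refl _)⟩
    unfold weakPartial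
    rw [dif_neg he, dif_neg he']

/-- Mixed weak derivatives commute. -/
theorem HasWeakPartial.comm {i j : Fin d} {u ui uj uij : Space d → ℝ}
    (hi : HasWeakPartial i u ui) (hj : HasWeakPartial j u uj) (hij : HasWeakPartial i uj uij) :
    HasWeakPartial j ui uij where
  locInt := hi.locInt_deriv
  locInt_deriv := hij.locInt_deriv
  integral_eq φ hφ := by
    have h1 := hi.integral_eq _ (hφ.partialDeriv j)
    have h2 := hj.integral_eq _ (hφ.partialDeriv i)
    have h3 := hij.integral_eq _ hφ
    rw [partialDeriv_comm hφ] at h1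
    linarith

/-! ### The spaces `H^k` -/

theorem MemH.of_succ {k : ℕ} {u : Space d → ℝ} (h : MemH (k + 1) u) : MemH k u := h.1

theorem MemH.memLp {k : ℕ} {u : Space d → ℝ} (h : MemH k u) : MemLp u 2 := by
  induction k with
  | zero => exact h
  | succ k ih => exact ih h.1

theorem MemH.mono {k l : ℕ} (hkl : k ≤ l) {u : Space d → ℝ} (h : MemH l u) : MemH k u := by
  induction l, hkl using Nat.le_induction with
  | base => exact h
  | succ l _ ih => exact ih h.1

theorem MemH.congr {k : ℕ} {u v : Space d → ℝ} (h : MemH k u) (huv : u =ᵐ[volume] v) :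
    MemH k v := by
  induction k with
  | zero => exact (memLp_congr_ae huv).1 h
  | succ k ih =>
    refine ⟨ih h.1, fun i => ?_⟩
    obtain ⟨w, hw, hwk⟩ := h.2 i
    exact ⟨w, hw.congr huv (ae_eq_refl _), hwk⟩

theorem MemH.hasWeakPartial {k : ℕ} {u : Space d → ℝ} (h : MemH (k + 1) u) (i : Fin d) :
    HasWeakPartial i u (weakPartial i u) := by
  obtain ⟨w, hw, _⟩ := h.2 i
  exact hw.weakPartial

protected theorem MemH.weakPartial {k : ℕ} {u : Space d → ℝ} (h : MemH (k + 1) u) (i : Fin d) :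
    MemH k (weakPartial i u) := by
  obtain ⟨w, hw, hwk⟩ := h.2 i
  exact hwk.congr hw.weakPartial_ae.symm

/-- The recursive definition of `H^{k+1}` also asks for membership in `H^k`, which is redundant. -/
theorem memH_succ {k : ℕ} {u : Space d → ℝ} (h0 : MemLp u 2)
    (h : ∀ i, ∃ v, HasWeakPartial i u v ∧ MemH k v) : MemH (k + 1) u := by
  induction k with
  | zero => exact ⟨h0, h⟩
  | succ k ih =>
    refine ⟨ih fun i => ?_, h⟩
    obtain ⟨v, hv, hk⟩ := h i
    exact ⟨v, hv, hk.1⟩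

theorem IsTest.memH {φ : Space d → ℝ} (h : IsTest φ) (k : ℕ) : MemH k φ := by
  induction k generalizing φ with
  | zero => exact h.memLp 2
  | succ k ih =>
    exact memH_succ (h.memLp 2) fun i => ⟨_, h.hasWeakPartial i, ih (h.partialDeriv i)⟩

theorem MemH.add {k : ℕ} {u v : Space d → ℝ} (hu : MemH k u) (hv : MemH k v) :
    MemH k (fun x => u x + v x) := by
  induction k generalizing u v with
  | zero => exact MemLp.add hu hv
  | succ k ih => exact ⟨ih hu.1 hv.1, fun i =>
      ⟨_, (hu.hasWeakPartial i).add (hv.hasWeakPartial i),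
        ih (hu.weakPartial i) (hv.weakPartial i)⟩⟩

theorem MemH.const_mul {k : ℕ} {u : Space d → ℝ} (hu : MemH k u) (c : ℝ) :
    MemH k (fun x => c * u x) := by
  induction k generalizing u with
  | zero => exact MemLp.const_mul hu c
  | succ k ih => exact ⟨ih hu.1, fun i =>
      ⟨_, (hu.hasWeakPartial i).const_mul c, ih (hu.weakPartial i)⟩⟩

theorem MemH.sub {k : ℕ} {u v : Space d → ℝ} (hu : MemH k u) (hv : MemH k v) :
    MemH k (fun x => u x - v x) := by
  simpa [sub_eq_add_neg] using hu.add (hv.const_mul (-1))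

theorem MemH.zero {k : ℕ} : MemH k (fun _ : Space d => (0 : ℝ)) := IsTest.zero.memH k

theorem MemH.sum {ι : Type*} (s : Finset ι) {k : ℕ} {u : ι → Space d → ℝ}
    (hu : ∀ j ∈ s, MemH k (u j)) : MemH k (fun x => ∑ j ∈ s, u j x) := by
  classical
  induction s using Finset.induction_on with
  | empty => simpa using MemH.zero
  | insert a s ha ih =>
    simp only [Finset.sum_insert ha]
    exact (hu a (Finset.mem_insert_self _ _)).add
      (ih fun j hj => hu j (Finset.mem_insert_of_mem hj))

theorem weakPartial_add_ae {k : ℕ} {u v : Space d → ℝ} (hu : MemH (k + 1) u)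
    (hv : MemH (k + 1) v) (i : Fin d) : weakPartial i (fun x => u x + v x) =ᵐ[volume]
      fun x => weakPartial i u x + weakPartial i v x :=
  ((hu.hasWeakPartial i).add (hv.hasWeakPartial i)).weakPartial_ae

theorem weakPartial_sub_ae {k : ℕ} {u v : Space d → ℝ} (hu : MemH (k + 1) u)
    (hv : MemH (k + 1) v) (i : Fin d) : weakPartial i (fun x => u x - v x) =ᵐ[volume]
      fun x => weakPartial i u x - weakPartial i v x :=
  ((hu.hasWeakPartial i).sub (hv.hasWeakPartial i)).weakPartial_ae

theorem weakPartial_const_mul_ae {k : ℕ} {u : Space d → ℝ} (hu : MemH (k + 1) u) (c : ℝ)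
    (i : Fin d) : weakPartial i (fun x => c * u x) =ᵐ[volume] fun x => c * weakPartial i u x :=
  ((hu.hasWeakPartial i).const_mul c).weakPartial_ae

theorem weakPartial_comm_ae {k : ℕ} {u : Space d → ℝ} (hu : MemH (k + 2) u) (i j : Fin d) :
    weakPartial i (weakPartial j u) =ᵐ[volume] weakPartial j (weakPartial i u) :=
  ((hu.hasWeakPartial i).comm (hu.hasWeakPartial j)
    ((hu.weakPartial j).hasWeakPartial i)).weakPartial_ae.symm

theorem IsTest.weakPartial_ae {φ : Space d → ℝ} (h : IsTest φ) (i : Fin d) :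
    weakPartial i φ =ᵐ[volume] partialDeriv i φ := (h.hasWeakPartial i).weakPartial_ae

/-! ### The norm of `H^k` -/

theorem normHSq_congr {k : ℕ} {u v : Space d → ℝ} (h : u =ᵐ[volume] v) :
    normHSq k u = normHSq k v := by
  induction k generalizing u v with
  | zero =>
    refine integral_congr_ae ?_
    filter_upwards [h] with x hx
    rw [hx]
  | succ k ih =>
    simp only [normHSq]
    rw [ih h]
    congr 1
    exact Finset.sum_congr rfl fun i _ => ih (weakPartial_congr h)

theorem normHSq_nonneg (k : ℕ) (u : Space d → ℝ) : 0 ≤ normHSq k u := by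
  induction k generalizing u with
  | zero => exact integral_nonneg fun x => sq_nonneg _
  | succ k ih => exact add_nonneg (ih u) (Finset.sum_nonneg fun i _ => ih _)

theorem normHSq_add_le {k : ℕ} {u v : Space d → ℝ} (hu : MemH k u) (hv : MemH k v) {t : ℝ}
    (ht : 0 < t) :
    normHSq k (fun x => u x + v x) ≤ (1 + t) * normHSq k u + (1 + t⁻¹) * normHSq k v := by
  induction k generalizing u v with
  | zero => exact integral_sq_add_le hu hv ht
  | succ k ih =>
    simp only [normHSq, mul_add, Finset.mul_sum]
    have h1 := ih hu.1 hv.1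
    have h2 : ∑ i, normHSq k (weakPartial i fun x => u x + v x)
        ≤ ∑ i, (1 + t) * normHSq k (weakPartial i u)
          + ∑ i, (1 + t⁻¹) * normHSq k (weakPartial i v) := by
      rw [← Finset.sum_add_distrib]
      refine Finset.sum_le_sum fun i _ => ?_
      rw [normHSq_congr (weakPartial_add_ae hu hv i)]
      exact ih (hu.weakPartial i) (hv.weakPartial i)
    linarith

theorem normHSq_const_mul {k : ℕ} {u : Space d → ℝ} (hu : MemH k u) (c : ℝ) :
    normHSq k (fun x => c * u x) = c ^ 2 * normHSq k u := by
  induction k generalizing u with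
  | zero =>
    simp only [normHSq, mul_pow]
    exact integral_const_mul _ _
  | succ k ih =>
    simp only [normHSq, mul_add, Finset.mul_sum]
    rw [ih hu.1]
    congr 1
    refine Finset.sum_congr rfl fun i _ => ?_
    rw [normHSq_congr (weakPartial_const_mul_ae hu c i)]
    exact ih (hu.weakPartial i)

theorem normH_nonneg (k : ℕ) (u : Space d → ℝ) : 0 ≤ normH k u := Real.sqrt_nonneg _

theorem normH_sq (k : ℕ) (u : Space d → ℝ) : normH k u ^ 2 = normHSq k u :=
  Real.sq_sqrt (normHSq_nonneg k u)

theorem normH_congr {k : ℕ} {u v : Space d → ℝ} (h : u =ᵐ[volume] v) : normH k u = normH k v := by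
  unfold normH
  rw [normHSq_congr h]

theorem normH_const_mul {k : ℕ} {u : Space d → ℝ} (hu : MemH k u) (c : ℝ) :
    normH k (fun x => c * u x) = |c| * normH k u := by
  unfold normH
  rw [normHSq_const_mul hu, Real.sqrt_mul (sq_nonneg c), Real.sqrt_sq_eq_abs]

/-- The triangle inequality, obtained from `|u + v|² ≤ (1 + t)|u|² + (1 + t⁻¹)|v|²` by optimizing
in `t`. -/
theorem normH_add_le {k : ℕ} {u v : Space d → ℝ} (hu : MemH k u) (hv : MemH k v) :
    normH k (fun x => u x + v x) ≤ normH k u + normH k v := by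
  have ha := normH_nonneg k u
  have hb := normH_nonneg k v
  refine le_of_forall_pos_le_add fun ε hε => ?_
  set a := normH k u + ε / 2 with hadef
  set b := normH k v + ε / 2 with hbdef
  have ha' : 0 < a := by positivity
  have hb' : 0 < b := by positivity
  have h := normHSq_add_le hu hv (t := b / a) (by positivity)
  have h1 : normHSq k u ≤ a ^ 2 := by rw [← normH_sq]; gcongr; linarith
  have h2 : normHSq k v ≤ b ^ 2 := by rw [← normH_sq]; gcongr; linarith
  have h3 : (1 + b / a) * normHSq k u + (1 + (b / a)⁻¹) * normHSq k v ≤ (a + b) ^ 2 := by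
    calc _ ≤ (1 + b / a) * a ^ 2 + (1 + (b / a)⁻¹) * b ^ 2 := by gcongr
      _ = (a + b) ^ 2 := by field_simp; ring
  calc normH k (fun x => u x + v x) ≤ a + b :=
        Real.sqrt_le_iff.2 ⟨by positivity, h.trans h3⟩
    _ = _ := by rw [hadef, hbdef]; ring

theorem normH_sub_le {k : ℕ} {u v : Space d → ℝ} (hu : MemH k u) (hv : MemH k v) :
    normH k (fun x => u x - v x) ≤ normH k u + normH k v := by
  have := normH_add_le hu (hv.const_mul (-1))
  rw [normH_const_mul hv] at this
  simpa [sub_eq_add_neg] using this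

theorem normH_zero (k : ℕ) : normH k (fun _ : Space d => (0 : ℝ)) = 0 := by
  simpa using normH_const_mul (MemH.zero (d := d) (k := k)) 0

theorem normH_sum_le {ι : Type*} (s : Finset ι) {k : ℕ} {u : ι → Space d → ℝ}
    (hu : ∀ j ∈ s, MemH k (u j)) :
    normH k (fun x => ∑ j ∈ s, u j x) ≤ ∑ j ∈ s, normH k (u j) := by
  classical
  induction s using Finset.induction_on with
  | empty => simp [normH_zero]
  | insert a s ha ih =>
    simp only [Finset.sum_insert ha]
    have h1 := hu a (Finset.mem_insert_self _ _)
    have h2 : ∀ j ∈ s, MemH k (u j) := fun j hj => hu j (Finset.mem_insert_of_mem hj)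
    exact (normH_add_le h1 (MemH.sum s h2)).trans (by gcongr; exact ih h2)

theorem normH_le_succ (k : ℕ) (u : Space d → ℝ) : normH k u ≤ normH (k + 1) u :=
  Real.sqrt_le_sqrt (le_add_of_nonneg_right (Finset.sum_nonneg fun _ _ => normHSq_nonneg _ _))

theorem normH_mono {k l : ℕ} (hkl : k ≤ l) (u : Space d → ℝ) : normH k u ≤ normH l u := by
  induction l, hkl using Nat.le_induction with
  | base => exact le_rfl
  | succ l _ ih => exact ih.trans (normH_le_succ l u)

theorem normH_weakPartial_le (k : ℕ) (u : Space d → ℝ) (i : Fin d) :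
    normH k (weakPartial i u) ≤ normH (k + 1) u := by
  refine Real.sqrt_le_sqrt ?_
  have := Finset.single_le_sum (f := fun i => normHSq k (weakPartial i u))
    (fun i _ => normHSq_nonneg _ _) (Finset.mem_univ i)
  simp only [normHSq]
  linarith [normHSq_nonneg k u]

theorem HasWeakPartial.normH_le {i : Fin d} {u v : Space d → ℝ} (h : HasWeakPartial i u v)
    (k : ℕ) : normH k v ≤ normH (k + 1) u := by
  rw [← normH_congr h.weakPartial_ae]
  exact normH_weakPartial_le k u i

theorem normH_succ_le (k : ℕ) (u : Space d → ℝ) :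
    normH (k + 1) u ≤ normH k u + ∑ i, normH k (weakPartial i u) := by
  refine Real.sqrt_le_iff.2 ⟨add_nonneg (normH_nonneg _ _)
    (Finset.sum_nonneg fun _ _ => normH_nonneg _ _), ?_⟩
  have h := Finset.sum_sq_le_sq_sum_of_nonneg (s := Finset.univ)
    (f := fun i => normH k (weakPartial i u)) (fun i _ => normH_nonneg _ _)
  have h0 : 0 ≤ ∑ i, normH k (weakPartial i u) := Finset.sum_nonneg fun _ _ => normH_nonneg _ _
  simp only [normHSq, normH_sq] at h ⊢
  rw [← normH_sq k u]
  nlinarith [normH_nonneg k u]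

theorem normH_zero_sq (u : Space d → ℝ) : normH 0 u ^ 2 = ∫ x, u x ^ 2 := normH_sq 0 u

theorem abs_integral_mul_le_normH {u v : Space d → ℝ} (hu : MemLp u 2) (hv : MemLp v 2) :
    |∫ x, u x * v x| ≤ normH 0 u * normH 0 v := abs_integral_mul_le hu hv

/-! ### Mollification -/

/-- The convolution `ρ * u`. -/
noncomputable def mollify (ρ u : Space d → ℝ) (x : Space d) : ℝ := ∫ t, ρ t * u (x - t)

theorem mollify_eq_convolution (ρ u : Space d → ℝ) :
    mollify ρ u = convolution ρ u (ContinuousLinearMap.lsmul ℝ ℝ) volume := rfl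

theorem IsTest.comp_neg {φ : Space d → ℝ} (h : IsTest φ) : IsTest (fun x => φ (-x)) where
  smooth := h.smooth.comp contDiff_neg
  compact := h.compact.comp_homeomorph (Homeomorph.neg (Space d))

theorem IsTest.contDiff_mollify {ρ u : Space d → ℝ} (hρ : IsTest ρ) (hu : LocallyIntegrable u) :
    ContDiff ℝ (⊤ : ℕ∞) (mollify ρ u) := by
  rw [mollify_eq_convolution]
  exact hρ.compact.contDiff_convolution_left _ hρ.smooth hu

theorem IsTest.mollify_of_compact {ρ u : Space d → ℝ} (hρ : IsTest ρ) (hu : LocallyIntegrable u)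
    (hc : HasCompactSupport u) : IsTest (mollify ρ u) := by
  refine ⟨hρ.contDiff_mollify hu, ?_⟩
  rw [mollify_eq_convolution]
  exact hρ.compact.convolution _ hc

theorem IsTest.locallyIntegrable {φ : Space d → ℝ} (h : IsTest φ) : LocallyIntegrable φ :=
  h.continuous.locallyIntegrable

theorem IsTest.contDiff_one {φ : Space d → ℝ} (h : IsTest φ) : ContDiff ℝ 1 φ :=
  h.smooth.of_le (by norm_cast)

theorem partialDeriv_mollify_right {ρ φ : Space d → ℝ} (hρ : IsTest ρ) (hφ : IsTest φ) (i : Fin d) :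
    partialDeriv i (mollify ρ φ) = mollify ρ (partialDeriv i φ) := by
  funext x
  have h := hφ.compact.hasFDerivAt_convolution_right (ContinuousLinearMap.lsmul ℝ ℝ)
    (μ := volume) hρ.locallyIntegrable hφ.contDiff_one x
  unfold partialDeriv
  rw [mollify_eq_convolution, h.fderiv]
  rw [convolution_precompR_apply (ContinuousLinearMap.lsmul ℝ ℝ) hρ.locallyIntegrable
    (hφ.compact.fderiv (𝕜 := ℝ)) (hφ.contDiff_one.continuous_fderiv (by simp))]
  rfl

theorem mollify_comm (ρ u : Space d → ℝ) : mollify ρ u = mollify u ρ := by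
  funext x
  unfold mollify
  rw [← integral_sub_left_eq_self _ volume x]
  simp [mul_comm]

theorem partialDeriv_mollify_left {ρ u : Space d → ℝ} (hρ : IsTest ρ) (hu : LocallyIntegrable u)
    (i : Fin d) : partialDeriv i (mollify ρ u) = mollify (partialDeriv i ρ) u := by
  rw [mollify_comm, mollify_comm (partialDeriv i ρ)]
  funext x
  have h := hρ.compact.hasFDerivAt_convolution_right (ContinuousLinearMap.lsmul ℝ ℝ)
    (μ := volume) hu hρ.contDiff_one x
  unfold partialDeriv
  rw [mollify_eq_convolution, h.fderiv]
  rw [convolution_precompR_apply (ContinuousLinearMap.lsmul ℝ ℝ) hu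
    (hρ.compact.fderiv (𝕜 := ℝ)) (hρ.contDiff_one.continuous_fderiv (by simp))]
  rfl

/-- Convolution with `ρ` is dual to convolution with the reflection of `ρ`. -/
theorem integral_mollify_mul {ρ u φ : Space d → ℝ} (hρ : IsTest ρ) (hu : LocallyIntegrable u)
    (hφ : IsTest φ) :
    ∫ x, mollify ρ u x * φ x = ∫ y, u y * mollify (fun t => ρ (-t)) φ y := by
  -- only the values of `u` on the compact set `K = supp φ - supp ρ` matter, so Fubini applies
  set K : Set (Space d) := (fun p : Space d × Space d => p.1 - p.2) '' (tsupport φ ×ˢ tsupport ρ)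
    with hKdef
  have hK : IsCompact K := (hφ.compact.isCompact.prod hρ.compact.isCompact).image (by fun_prop)
  have hKi : Integrable (K.indicator u) :=
    (integrable_indicator_iff hK.measurableSet).2 (hu.integrableOn_isCompact hK)
  have h1 : Integrable (fun p : Space d × Space d => φ p.1 * K.indicator u p.2)
      (volume.prod volume) :=
    (hφ.continuous.integrable_of_hasCompactSupport hφ.compact).mul_prod hKi
  obtain ⟨B, hB⟩ := hρ.continuous.bounded_above_of_compact_support hρ.compact
  have h2 : Integrable (fun p : Space d × Space d => ρ (p.1 - p.2) * (φ p.1 * K.indicator u p.2))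
      (volume.prod volume) := by
    refine h1.bdd_mul (c := B) ?_ ?_
    · exact (hρ.continuous.comp (continuous_fst.sub continuous_snd)).aestronglyMeasurable
    · exact Filter.Eventually.of_forall fun p => hB _
  have h3 : ∀ x y, ρ (x - y) * (φ x * K.indicator u y) = ρ (x - y) * u y * φ x := by
    intro x y
    by_cases hy : y ∈ K
    · rw [Set.indicator_of_mem hy]; ring
    · rw [Set.indicator_of_notMem hy]
      by_cases hx : φ x = 0
      · simp [hx]
      · by_cases hxy : ρ (x - y) = 0
        · simp [hxy]
        · exact absurd ⟨(x, x - y), ⟨subset_tsupport _ hx, subset_tsupport _ hxy⟩, by simp⟩ hy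
  have h4 : ∀ x, mollify ρ u x * φ x = ∫ y, ρ (x - y) * (φ x * K.indicator u y) := by
    intro x
    simp_rw [h3, integral_mul_const]
    congr 1
    unfold mollify
    rw [← integral_sub_left_eq_self _ volume x]
    simp
  have h5 : ∀ y, u y * mollify (fun t => ρ (-t)) φ y
      = ∫ x, ρ (x - y) * (φ x * K.indicator u y) := by
    intro y
    simp_rw [h3]
    unfold mollify
    rw [← integral_sub_left_eq_self _ volume y, ← integral_const_mul]
    congr 1
    funext x
    simp
    ring
  simp_rw [h4, h5]
  exact integral_integral_swap h2

/-- Convolution commutes with weak derivatives. -/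
protected theorem HasWeakPartial.mollify {i : Fin d} {ρ u v : Space d → ℝ}
    (h : HasWeakPartial i u v)
    (hρ : IsTest ρ) : HasWeakPartial i (mollify ρ u) (mollify ρ v) where
  locInt := (hρ.contDiff_mollify h.locInt).continuous.locallyIntegrable
  locInt_deriv := (hρ.contDiff_mollify h.locInt_deriv).continuous.locallyIntegrable
  integral_eq φ hφ := by
    rw [integral_mollify_mul hρ h.locInt (hφ.partialDeriv i),
      integral_mollify_mul hρ h.locInt_deriv hφ, ← partialDeriv_mollify_right hρ.comp_neg hφ]
    exact h.integral_eq _ (hρ.comp_neg.mollify_of_compact hφ.locallyIntegrable hφ.compact)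

theorem hasWeakPartial_mollify_left (i : Fin d) {ρ u : Space d → ℝ} (hρ : IsTest ρ)
    (hu : LocallyIntegrable u) : HasWeakPartial i (mollify ρ u) (mollify (partialDeriv i ρ) u) := by
  rw [← partialDeriv_mollify_left hρ hu]
  exact hasWeakPartial_of_contDiff i ((hρ.contDiff_mollify hu).of_le (by norm_cast))

/-- Jensen's inequality for averages against a kernel. -/
theorem lintegral_sq_lintegral_le {ρ : Space d → ℝ} (hρ : AEStronglyMeasurable ρ)
    {w : Space d × Space d → ℝ} (hw : AEStronglyMeasurable w (volume.prod volume)) :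
    ∫⁻ x, (∫⁻ t, ‖ρ t‖ₑ * ‖w (x, t)‖ₑ) ^ 2 ≤
      (∫⁻ t, ‖ρ t‖ₑ) * ∫⁻ t, ‖ρ t‖ₑ * ∫⁻ x, ‖w (x, t)‖ₑ ^ 2 := by
  have hcs : ∀ᵐ x : Space d, (∫⁻ t, ‖ρ t‖ₑ * ‖w (x, t)‖ₑ) ^ 2 ≤
      (∫⁻ t, ‖ρ t‖ₑ) * ∫⁻ t, ‖ρ t‖ₑ * ‖w (x, t)‖ₑ ^ 2 := by
    filter_upwards [hw.prodMk_left] with x hx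
    have h := ENNReal.lintegral_mul_le_Lp_mul_Lq (volume : Measure (Space d))
      (p := 2) (q := 2) (f := fun t => ‖ρ t‖ₑ ^ (1 / 2 : ℝ))
      (g := fun t => ‖ρ t‖ₑ ^ (1 / 2 : ℝ) * ‖w (x, t)‖ₑ) (by constructor <;> norm_num)
      (hρ.enorm.pow_const _) ((hρ.enorm.pow_const _).mul hx.enorm)
    have e1 : ∀ a b : ENNReal, a ^ (1 / 2 : ℝ) * (a ^ (1 / 2 : ℝ) * b) = a * b := by
      intro a b
      rw [← mul_assoc, ← ENNReal.rpow_add_of_nonneg _ _ (by norm_num) (by norm_num)]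
      norm_num
    have e2 : ∀ a : ENNReal, (a ^ (1 / 2 : ℝ)) ^ (2 : ℝ) = a := by
      intro a
      rw [← ENNReal.rpow_mul]; norm_num
    have e3 : ∀ a b : ENNReal, (a ^ (1 / 2 : ℝ) * b) ^ (2 : ℝ) = a * b ^ 2 := by
      intro a b
      rw [ENNReal.mul_rpow_of_nonneg _ _ (by norm_num), e2]
      norm_num
    simp only [Pi.mul_apply, e1, e2, e3] at h
    calc _ ≤ _ := pow_le_pow_left' h 2
      _ = _ := by
        rw [mul_pow]
        have e4 : ∀ a : ENNReal, (a ^ (1 / 2 : ℝ)) ^ 2 = a := by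
          intro a
          rw [← ENNReal.rpow_natCast, ← ENNReal.rpow_mul]; norm_num
        rw [e4, e4]
  calc _ ≤ ∫⁻ x, (∫⁻ t, ‖ρ t‖ₑ) * ∫⁻ t, ‖ρ t‖ₑ * ‖w (x, t)‖ₑ ^ 2 := lintegral_mono_ae hcs
    _ ≤ (∫⁻ t, ‖ρ t‖ₑ) * ∫⁻ x, ∫⁻ t, ‖ρ t‖ₑ * ‖w (x, t)‖ₑ ^ 2 := by
        rw [lintegral_const_mul'']
        exact ((hρ.enorm.comp_quasiMeasurePreserving
          Measure.quasiMeasurePreserving_snd).mul (hw.enorm.pow_const 2)).lintegral_prod_right'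
    _ = (∫⁻ t, ‖ρ t‖ₑ) * ∫⁻ t, ∫⁻ x, ‖ρ t‖ₑ * ‖w (x, t)‖ₑ ^ 2 := by
        rw [lintegral_lintegral_swap]
        exact (hρ.enorm.comp_quasiMeasurePreserving
          Measure.quasiMeasurePreserving_snd).mul (hw.enorm.pow_const 2)
    _ ≤ _ := by
        gcongr with t
        rw [lintegral_const_mul' _ _ (by simp)]

theorem aestronglyMeasurable_translate {u : Space d → ℝ} (hu : AEStronglyMeasurable u) :
    AEStronglyMeasurable (fun p : Space d × Space d => u (p.1 - p.2)) (volume.prod volume) :=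
  hu.comp_quasiMeasurePreserving (quasiMeasurePreserving_sub volume volume)

theorem MemLp.lintegral_sq_lt_top {u : Space d → ℝ} (hu : MemLp u 2) :
    ∫⁻ x, ‖u x‖ₑ ^ 2 < ⊤ := by
  have := lintegral_rpow_enorm_lt_top_of_eLpNorm_lt_top (by norm_num) (by norm_num) hu.2
  simpa using this

theorem memLp_two_of_lintegral_sq {u : Space d → ℝ} (hu : AEStronglyMeasurable u)
    (h : ∫⁻ x, ‖u x‖ₑ ^ 2 < ⊤) : MemLp u 2 := by
  refine ⟨hu, ?_⟩
  rw [eLpNorm_lt_top_iff_lintegral_rpow_enorm_lt_top (by norm_num) (by norm_num)]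
  simpa using h

theorem ofReal_integral_sq {u : Space d → ℝ} (hu : MemLp u 2) :
    ENNReal.ofReal (∫ x, u x ^ 2) = ∫⁻ x, ‖u x‖ₑ ^ 2 := by
  rw [ofReal_integral_eq_lintegral_ofReal hu.integrable_sq
    (Filter.Eventually.of_forall fun x => sq_nonneg _)]
  refine lintegral_congr fun x => ?_
  rw [← sq_abs, ENNReal.ofReal_pow (abs_nonneg _), ← Real.norm_eq_abs, ofReal_norm]

/-- Young's inequality, in its qualitative form: convolution with a test function preserves
`L²`. -/
theorem IsTest.memLp_mollify {ρ u : Space d → ℝ} (hρ : IsTest ρ) (hu : MemLp u 2) :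
    MemLp (mollify ρ u) 2 := by
  refine memLp_two_of_lintegral_sq
    (hρ.contDiff_mollify (MemLp.locallyIntegrable_two hu)).continuous.aestronglyMeasurable ?_
  have hle : ∀ x, ‖mollify ρ u x‖ₑ ≤ ∫⁻ t, ‖ρ t‖ₑ * ‖u (x - t)‖ₑ := by
    intro x
    refine (enorm_integral_le_lintegral_enorm _).trans (le_of_eq ?_)
    simp [enorm_mul]
  have hρ1 : ∫⁻ t, ‖ρ t‖ₑ < ⊤ := (hρ.continuous.integrable_of_hasCompactSupport hρ.compact).2
  calc _ ≤ ∫⁻ x, (∫⁻ t, ‖ρ t‖ₑ * ‖u (x - t)‖ₑ) ^ 2 := by gcongr with x; exact hle x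
    _ ≤ _ := lintegral_sq_lintegral_le hρ.continuous.aestronglyMeasurable
        (aestronglyMeasurable_translate hu.1)
    _ = (∫⁻ t, ‖ρ t‖ₑ) * ((∫⁻ t, ‖ρ t‖ₑ) * ∫⁻ x, ‖u x‖ₑ ^ 2) := by
        simp only
        rw [← lintegral_mul_const' _ _ (MemLp.lintegral_sq_lt_top hu).ne]
        congr 2
        funext t
        rw [lintegral_sub_right_eq_self (fun x => ‖u x‖ₑ ^ 2) t]
    _ < ⊤ := by
        exact ENNReal.mul_lt_top hρ1 (ENNReal.mul_lt_top hρ1 (MemLp.lintegral_sq_lt_top hu))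

/-- Mollifiers supported in the ball of radius `δ`. -/
structure IsMollifier (δ : ℝ) (ρ : Space d → ℝ) : Prop where
  test : IsTest ρ
  nonneg : ∀ x, 0 ≤ ρ x
  integral_eq : ∫ x, ρ x = 1
  support : ∀ x, δ ≤ ‖x‖ → ρ x = 0

theorem IsMollifier.mono {δ δ' : ℝ} {ρ : Space d → ℝ} (h : IsMollifier δ ρ) (hδ : δ ≤ δ') :
    IsMollifier δ' ρ := { h with support := fun x hx => h.support x (hδ.trans hx) }

theorem exists_isMollifier {δ : ℝ} (hδ : 0 < δ) : ∃ ρ : Space d → ℝ, IsMollifier δ ρ := by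
  let f : ContDiffBump (0 : Space d) := ⟨δ / 2, δ, by positivity, by linarith⟩
  refine ⟨f.normed volume, ⟨f.contDiff_normed, f.hasCompactSupport_normed⟩, f.nonneg_normed,
    f.integral_normed, fun x hx => ?_⟩
  have : x ∉ Function.support (f.normed volume) := by
    rw [f.support_normed_eq]
    simpa using hx
  simpa using this

/-- Translation is continuous in `L²`. -/
theorem translate_continuous {u : Space d → ℝ} (hu : MemLp u 2) {ε : ENNReal} (hε : 0 < ε) :
    ∃ δ > 0, ∀ t : Space d, ‖t‖ < δ → ∫⁻ x, ‖u (x - t) - u x‖ₑ ^ 2 ≤ ε := by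
  have hmp : ∀ t : Space d, MeasurePreserving (fun x : Space d => x - t) volume volume :=
    fun t => measurePreserving_sub_right volume t
  let g : Space d → C(Space d, Space d) := fun t => ⟨fun x => x - t, by fun_prop⟩
  have hg : Continuous g :=
    ContinuousMap.continuous_of_continuous_uncurry _ (continuous_snd.sub continuous_fst)
  have hc : Continuous fun t => Lp.compMeasurePreserving (g t) (hmp t) hu.toLp :=
    continuous_const.compMeasurePreservingLp hg hmp (by norm_num)
  have hc' := hc.tendsto 0
  rw [EMetric.tendsto_nhds] at hc'
  have hε' : 0 < min 1 ε := lt_min one_pos hε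
  obtain ⟨δ, hδ, h⟩ := Metric.eventually_nhds_iff.1 (hc' (min 1 ε) hε')
  refine ⟨δ, hδ, fun t ht => ?_⟩
  have h' := h (y := t) (by simpa using ht)
  rw [Lp.edist_def] at h'
  have e : eLpNorm (fun x => u (x - t) - u x) 2 volume ≤ min 1 ε := by
    refine le_trans (le_of_eq (eLpNorm_congr_ae ?_)) h'.le
    have h1 := Lp.coeFn_compMeasurePreserving hu.toLp (hmp t)
    have h0 := Lp.coeFn_compMeasurePreserving hu.toLp (hmp 0)
    have h2 := (hmp t).quasiMeasurePreserving.ae_eq_comp hu.coeFn_toLp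
    have h3 := (hmp 0).quasiMeasurePreserving.ae_eq_comp hu.coeFn_toLp
    filter_upwards [h1, h0, h2, h3] with x h1 h0 h2 h3
    simp only [Pi.sub_apply]
    change _ = (Lp.compMeasurePreserving (fun x => x - t) (hmp t) hu.toLp) x
      - (Lp.compMeasurePreserving (fun x => x - 0) (hmp 0) hu.toLp) x
    rw [h1, h0, h2, h3]
    simp
  have e2 : ∫⁻ x, ‖u (x - t) - u x‖ₑ ^ 2 = eLpNorm (fun x => u (x - t) - u x) 2 volume ^ 2 := by
    rw [eLpNorm_eq_lintegral_rpow_enorm_toReal (by norm_num) (by norm_num)]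
    simp only [ENNReal.toReal_ofNat, ENNReal.rpow_ofNat]
    rw [← ENNReal.rpow_natCast, ← ENNReal.rpow_mul]
    norm_num
  rw [e2, sq]
  calc _ ≤ 1 * min 1 ε := by gcongr; exact e.trans (min_le_left _ _)
    _ ≤ ε := by rw [one_mul]; exact min_le_right _ _

/-- Mollifications converge in `L²`: by Jensen's inequality the error is an average of
`|u(· - t) - u|²` over small translations `t`. -/
theorem exists_integral_sq_mollify_sub_le {u : Space d → ℝ} (hu : MemLp u 2) {ε : ℝ} (hε : 0 < ε) :
    ∃ δ > 0, ∀ ρ : Space d → ℝ, IsMollifier δ ρ → ∫ x, (mollify ρ u x - u x) ^ 2 ≤ ε := by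
  obtain ⟨δ, hδ, h⟩ := translate_continuous hu (ENNReal.ofReal_pos.2 hε)
  refine ⟨δ, hδ, fun ρ hρ => ?_⟩
  have hui := MemLp.locallyIntegrable_two hu
  have hm : MemLp (fun x => mollify ρ u x - u x) 2 := (hρ.test.memLp_mollify hu).sub hu
  have hρi : Integrable ρ := hρ.test.continuous.integrable_of_hasCompactSupport hρ.test.compact
  rw [← ENNReal.ofReal_le_ofReal_iff hε.le, ofReal_integral_sq hm]
  have hle : ∀ x, ‖mollify ρ u x - u x‖ₑ ≤ ∫⁻ t, ‖ρ t‖ₑ * ‖u (x - t) - u x‖ₑ := by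
    intro x
    have hi : Integrable (fun t => ρ t * u (x - t)) :=
      hρ.test.compact.convolutionExists_left (ContinuousLinearMap.lsmul ℝ ℝ)
        hρ.test.continuous hui x
    have e : mollify ρ u x - u x = ∫ t, ρ t * (u (x - t) - u x) := by
      simp only [mul_sub]
      rw [integral_sub hi (hρi.mul_const _), integral_mul_const, hρ.integral_eq, one_mul]
      rfl
    rw [e]
    refine (enorm_integral_le_lintegral_enorm _).trans (le_of_eq ?_)
    simp [enorm_mul]
  have hρ1 : ∫⁻ t, ‖ρ t‖ₑ = 1 := by
    have := ofReal_integral_eq_lintegral_ofReal hρi (Filter.Eventually.of_forall hρ.nonneg)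
    rw [hρ.integral_eq] at this
    rw [← ENNReal.ofReal_one, this]
    refine lintegral_congr fun t => ?_
    rw [Real.enorm_eq_ofReal (hρ.nonneg t)]
  have hmeas : AEStronglyMeasurable (fun p : Space d × Space d => u (p.1 - p.2) - u p.1)
      (volume.prod volume) := (aestronglyMeasurable_translate hu.1).sub
    (hu.1.comp_quasiMeasurePreserving Measure.quasiMeasurePreserving_fst)
  calc _ ≤ ∫⁻ x, (∫⁻ t, ‖ρ t‖ₑ * ‖u (x - t) - u x‖ₑ) ^ 2 := by gcongr with x; exact hle x
    _ ≤ _ := lintegral_sq_lintegral_le hρ.test.continuous.aestronglyMeasurable hmeas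
    _ ≤ 1 * ∫⁻ t, ‖ρ t‖ₑ * ENNReal.ofReal ε := by
        rw [hρ1]
        gcongr 1 * ?_
        refine lintegral_mono fun t => ?_
        simp only
        by_cases ht : ‖t‖ < δ
        · gcongr
          exact h t ht
        · simp [hρ.support t (not_lt.1 ht)]
    _ = ENNReal.ofReal ε := by
        rw [lintegral_mul_const' _ _ ENNReal.ofReal_ne_top, hρ1]
        simp

protected theorem MemH.mollify {k : ℕ} {ρ u : Space d → ℝ} (hρ : IsTest ρ) (hu : MemH k u) :
    MemH k (mollify ρ u) := by
  induction k generalizing u with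
  | zero => exact hρ.memLp_mollify hu
  | succ k ih => exact ⟨ih hu.1, fun i => ⟨_, (hu.hasWeakPartial i).mollify hρ,
      ih (hu.weakPartial i)⟩⟩

theorem exists_normHSq_mollify_sub_le {k : ℕ} {u : Space d → ℝ} (hu : MemH k u) {ε : ℝ}
    (hε : 0 < ε) :
    ∃ δ > 0, ∀ ρ : Space d → ℝ, IsMollifier δ ρ → normHSq k (fun x => mollify ρ u x - u x) ≤ ε := by
  induction k generalizing u ε with
  | zero => exact exists_integral_sq_mollify_sub_le hu hε
  | succ k ih =>
    obtain ⟨δ, hδ, h⟩ := ih hu.1 (half_pos hε)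
    have hε' : 0 < ε / 2 / (d + 1) := by positivity
    choose δ' hδ' h' using fun i => ih (hu.weakPartial i) hε'
    obtain ⟨δ₀, hδ₀, hle⟩ : ∃ δ₀ > 0, ∀ i, δ₀ ≤ δ' i := by
      rcases isEmpty_or_nonempty (Fin d) with he | he
      · exact ⟨1, one_pos, fun i => (he.false i).elim⟩
      · obtain ⟨i, hi⟩ := Finite.exists_min δ'
        exact ⟨δ' i, hδ' i, hi⟩
    refine ⟨min δ δ₀, lt_min hδ hδ₀, fun ρ hρ => ?_⟩
    simp only [normHSq]
    have h1 := h ρ (hρ.mono (min_le_left _ _))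
    have h2 : ∑ i, normHSq k (weakPartial i fun x => mollify ρ u x - u x)
        ≤ ∑ _i : Fin d, ε / 2 / (d + 1) := by
      refine Finset.sum_le_sum fun i _ => ?_
      have e := (((hu.hasWeakPartial i).mollify hρ.test).sub (hu.hasWeakPartial i)).weakPartial_ae
      rw [normHSq_congr e]
      exact h' i ρ (hρ.mono ((min_le_right _ _).trans (hle i)))
    have h3 : ∑ _i : Fin d, ε / 2 / ((d : ℝ) + 1) ≤ ε / 2 := by
      rw [Finset.sum_const, Finset.card_univ, Fintype.card_fin, nsmul_eq_mul, mul_div_assoc',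
        div_le_iff₀ (by positivity)]
      nlinarith
    linarith

/-! ### Density of test functions -/

theorem IsTest.mul_hasWeakPartial {i : Fin d} {η u v : Space d → ℝ} (hη : IsTest η)
    (h : HasWeakPartial i u v) :
    HasWeakPartial i (fun x => η x * u x) (fun x => η x * v x + partialDeriv i η x * u x) := by
  have h1 : Integrable (fun x => η x * u x) := by
    simpa [mul_comm] using LocallyIntegrable.integrable_mul_test h.locInt hη
  have h2 : Integrable (fun x => η x * v x) := by
    simpa [mul_comm] using LocallyIntegrable.integrable_mul_test h.locInt_deriv hη
  have h3 : Integrable (fun x => partialDeriv i η x * u x) := by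
    simpa [mul_comm] using LocallyIntegrable.integrable_mul_test h.locInt (hη.partialDeriv i)
  refine ⟨h1.locallyIntegrable, (h2.add h3).locallyIntegrable, fun φ hφ => ?_⟩
  have hηφ := IsTest.smooth_mul hη.smooth hφ
  have key := h.integral_eq _ hηφ
  have e1 : ∀ x, u x * partialDeriv i (fun x => η x * φ x) x
      = partialDeriv i η x * u x * φ x + η x * u x * partialDeriv i φ x := by
    intro x
    rw [partialDeriv_mul hη.differentiable hφ.differentiable]
    ring
  simp_rw [e1] at key
  rw [integral_add (LocallyIntegrable.integrable_mul_test h3.locallyIntegrable hφ)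
    (LocallyIntegrable.integrable_mul_test h1.locallyIntegrable (hφ.partialDeriv i))] at key
  simp only [add_mul]
  rw [integral_add (LocallyIntegrable.integrable_mul_test h2.locallyIntegrable hφ)
    (LocallyIntegrable.integrable_mul_test h3.locallyIntegrable hφ)]
  have e2 : ∫ x, η x * v x * φ x = ∫ x, v x * (η x * φ x) := by
    congr 1; funext x; ring
  rw [e2]
  linarith

theorem IsTest.comp_const_smul {η : Space d → ℝ} (hη : IsTest η) {c : ℝ} (hc : 0 < c) :
    IsTest (fun x => η (c • x)) where
  smooth := hη.smooth.comp (contDiff_const_smul c)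
  compact := hη.compact.comp_homeomorph (Homeomorph.smulOfNeZero c hc.ne')

theorem partialDeriv_comp_const_smul {η : Space d → ℝ} (hη : IsTest η) (c : ℝ) (i : Fin d)
    (x : Space d) : partialDeriv i (fun x => η (c • x)) x = c * partialDeriv i η (c • x) := by
  unfold partialDeriv
  have h : HasFDerivAt (fun x : Space d => c • x) (c • ContinuousLinearMap.id ℝ (Space d)) x :=
    (hasFDerivAt_id x).const_smul c
  have := ((hη.differentiable (c • x)).hasFDerivAt).comp x h
  have e : fderiv ℝ (fun x => η (c • x)) x = _ := this.fderiv
  rw [e]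
  simp

theorem IsTest.hasWeakPartial_dilate_mul {i : Fin d} {η u v : Space d → ℝ} (hη : IsTest η)
    {c : ℝ} (hc : 0 < c) (h : HasWeakPartial i u v) :
    HasWeakPartial i (fun x => η (c • x) * u x)
      (fun x => η (c • x) * v x + c * (partialDeriv i η (c • x) * u x)) := by
  have := (hη.comp_const_smul hc).mul_hasWeakPartial h
  simpa only [partialDeriv_comp_const_smul hη, mul_assoc] using this

/-- Multiplication by the dilates of a test function is uniformly bounded on `H^k`. -/
theorem IsTest.exists_normH_dilate_mul_le {η : Space d → ℝ} (hη : IsTest η) (k : ℕ) :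
    ∃ C, 0 ≤ C ∧ ∀ c : ℝ, 0 < c → c ≤ 1 → ∀ u : Space d → ℝ, MemH k u →
      MemH k (fun x => η (c • x) * u x) ∧
      normH k (fun x => η (c • x) * u x) ≤ C * normH k u := by
  induction k generalizing η with
  | zero =>
    obtain ⟨B, hB⟩ := hη.continuous.bounded_above_of_compact_support hη.compact
    have hB0 : 0 ≤ B := (norm_nonneg _).trans (hB 0)
    refine ⟨B, hB0, fun c hc _ u hu => ?_⟩
    have hm := (hη.comp_const_smul hc).continuous.aestronglyMeasurable (μ := volume)
    have hb : ∀ᵐ x : Space d, |η (c • x)| ≤ B := Filter.Eventually.of_forall fun x => hB _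
    refine ⟨MemLp.bdd_mul_two hu hm hb, ?_⟩
    refine Real.sqrt_le_iff.2 ⟨mul_nonneg hB0 (normH_nonneg _ _), ?_⟩
    rw [mul_pow, normH_zero_sq]
    exact integral_sq_bdd_mul_le hu hm hb
  | succ k ih =>
    obtain ⟨C, hC0, hC⟩ := ih hη
    choose C' hC0' hC' using fun i => ih (hη.partialDeriv i)
    refine ⟨C + ∑ i, (C + C' i), add_nonneg hC0 (Finset.sum_nonneg fun i _ =>
      add_nonneg hC0 (hC0' i)), fun c hc hc1 u hu => ?_⟩
    have hw := fun i => hη.hasWeakPartial_dilate_mul hc (hu.hasWeakPartial i)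
    have h1 := fun i => hC c hc hc1 _ (hu.weakPartial i)
    have h2 := fun i => hC' i c hc hc1 _ hu.of_succ
    refine ⟨⟨(hC c hc hc1 u hu.1).1, fun i => ⟨_, hw i, (h1 i).1.add ((h2 i).1.const_mul c)⟩⟩, ?_⟩
    refine (normH_succ_le _ _).trans ?_
    rw [add_mul, Finset.sum_mul]
    refine add_le_add ((hC c hc hc1 u hu.1).2.trans
      (mul_le_mul_of_nonneg_left (normH_le_succ k u) hC0)) (Finset.sum_le_sum fun i _ => ?_)
    rw [normH_congr (hw i).weakPartial_ae, add_mul]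
    refine (normH_add_le (h1 i).1 ((h2 i).1.const_mul c)).trans ?_
    rw [normH_const_mul (h2 i).1, abs_of_pos hc]
    refine add_le_add ((h1 i).2.trans
      (mul_le_mul_of_nonneg_left (normH_weakPartial_le k u i) hC0)) ?_
    calc c * _ ≤ 1 * normH k (fun x => partialDeriv i η (c • x) * u x) :=
          mul_le_mul_of_nonneg_right hc1 (normH_nonneg _ _)
      _ ≤ C' i * normH (k + 1) u := by
          rw [one_mul]
          exact (h2 i).2.trans (mul_le_mul_of_nonneg_left (normH_le_succ k u) (hC0' i))

theorem tendsto_normH_zero {u : ℕ → Space d → ℝ}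
    (h : Tendsto (fun n => ∫ x, u n x ^ 2) atTop (𝓝 0)) :
    Tendsto (fun n => normH 0 (u n)) atTop (𝓝 0) := by
  have := h.sqrt
  rwa [Real.sqrt_zero] at this

/-- Cutoff by the dilates of `χ` converges in `H^k`: in the Leibniz rule the derivative of the
cutoff carries the small factor `1 / (n + 1)`. -/
theorem tendsto_normH_cutoff {χ : Space d → ℝ} (hχ : IsTest χ) (h0 : χ 0 = 1)
    (hb : ∀ x, |χ x| ≤ 1) {k : ℕ} {u : Space d → ℝ} (hu : MemH k u) :
    Tendsto (fun n : ℕ => normH k (fun x => χ ((1 / ((n : ℝ) + 1)) • x) * u x - u x)) atTop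
      (𝓝 0) := by
  have hcpos : ∀ n : ℕ, 0 < 1 / ((n : ℝ) + 1) := fun n => Nat.one_div_pos_of_nat
  have hcle : ∀ n : ℕ, 1 / ((n : ℝ) + 1) ≤ 1 := fun n => by
    rw [div_le_one (by positivity)]
    linarith [Nat.cast_nonneg (α := ℝ) n]
  have hclim := tendsto_one_div_add_atTop_nhds_zero_nat (𝕜 := ℝ)
  induction k generalizing u with
  | zero =>
    have hu' : MemLp u 2 := hu
    refine tendsto_normH_zero ?_
    have hlim := tendsto_integral_of_dominated_convergence
      (F := fun (n : ℕ) x => (χ ((1 / ((n : ℝ) + 1)) • x) * u x - u x) ^ 2) (f := fun _ => (0 : ℝ))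
      (μ := volume) (fun x => 4 * u x ^ 2) ?_ (hu'.integrable_sq.const_mul 4) ?_ ?_
    · simpa using hlim
    · intro n
      have hm := (hχ.comp_const_smul (hcpos n)).continuous.aestronglyMeasurable (μ := volume)
      exact ((hm.mul hu'.1).sub hu'.1).pow 2
    · refine fun n => Eventually.of_forall fun x => ?_
      have := abs_le.1 (hb ((1 / ((n : ℝ) + 1)) • x))
      rw [Real.norm_eq_abs, abs_of_nonneg (sq_nonneg _)]
      have e : (χ ((1 / ((n : ℝ) + 1)) • x) * u x - u x) ^ 2
          = (χ ((1 / ((n : ℝ) + 1)) • x) - 1) ^ 2 * u x ^ 2 := by ring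
      rw [e]
      have : (χ ((1 / ((n : ℝ) + 1)) • x) - 1) ^ 2 ≤ 4 := by nlinarith
      exact mul_le_mul_of_nonneg_right this (sq_nonneg _)
    · refine Eventually.of_forall fun x => ?_
      have h1 : Tendsto (fun n : ℕ => χ ((1 / ((n : ℝ) + 1)) • x)) atTop (𝓝 1) := by
        have h2 : Tendsto (fun n : ℕ => (1 / ((n : ℝ) + 1)) • x) atTop (𝓝 0) := by
          simpa using hclim.smul_const x
        have h3 := (hχ.continuous.tendsto 0).comp h2
        rwa [h0] at h3
      have := (((h1.mul_const (u x)).sub_const (u x)).pow 2)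
      simpa using this
  | succ k ih =>
    choose C hC0 hC using fun i => (hχ.partialDeriv i).exists_normH_dilate_mul_le k
    obtain ⟨C₁, hC₁, hCC⟩ := hχ.exists_normH_dilate_mul_le k
    have hlim : Tendsto (fun n : ℕ => normH k (fun x => χ ((1 / ((n : ℝ) + 1)) • x) * u x - u x)
        + ∑ i, (normH k (fun x => χ ((1 / ((n : ℝ) + 1)) • x) * weakPartial i u x
          - weakPartial i u x) + 1 / ((n : ℝ) + 1) * (C i * normH k u))) atTop
        (𝓝 (0 + ∑ i : Fin d, (0 + 0 * (C i * normH k u)))) :=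
      (ih hu.1).add (tendsto_finsetSum _ fun i _ =>
        (ih (hu.weakPartial i)).add (hclim.mul_const _))
    simp only [zero_mul, add_zero, Finset.sum_const_zero] at hlim
    refine squeeze_zero (fun n => normH_nonneg _ _) (fun n => ?_) hlim
    refine (normH_succ_le _ _).trans (add_le_add le_rfl (Finset.sum_le_sum fun i _ => ?_))
    set c := 1 / ((n : ℝ) + 1)
    have e := ((hχ.hasWeakPartial_dilate_mul (hcpos n) (hu.hasWeakPartial i)).sub
      (hu.hasWeakPartial i)).weakPartial_ae
    rw [normH_congr e]
    have h1 := hC i c (hcpos n) (hcle n) u hu.1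
    have h2 := (hCC c (hcpos n) (hcle n) _ (hu.weakPartial i)).1.sub (hu.weakPartial i)
    have e2 : (fun x => χ (c • x) * weakPartial i u x +
        c * (partialDeriv i χ (c • x) * u x) - weakPartial i u x)
        = fun x => (χ (c • x) * weakPartial i u x - weakPartial i u x) +
          c * (partialDeriv i χ (c • x) * u x) := by funext x; ring
    rw [e2]
    refine (normH_add_le h2 (h1.1.const_mul c)).trans (add_le_add le_rfl ?_)
    rw [normH_const_mul h1.1, abs_of_pos (hcpos n)]
    exact mul_le_mul_of_nonneg_left h1.2 (hcpos n).le

theorem eLpNorm_two_eq {u : Space d → ℝ} (hu : MemLp u 2) :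
    eLpNorm u 2 volume = ENNReal.ofReal (normH 0 u) := by
  rw [eLpNorm_eq_lintegral_rpow_enorm_toReal (by norm_num) (by norm_num)]
  simp only [ENNReal.toReal_ofNat, ENNReal.rpow_ofNat]
  rw [← ofReal_integral_sq hu, ENNReal.ofReal_rpow_of_nonneg
    (integral_nonneg fun x => sq_nonneg _) (by norm_num), ← Real.sqrt_eq_rpow]
  rfl

/-- `L²` convergence implies almost everywhere convergence of a subsequence. -/
theorem exists_subseq_tendsto_ae {u : ℕ → Space d → ℝ} {v : Space d → ℝ}
    (hu : ∀ n, MemLp (u n) 2) (hv : MemLp v 2)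
    (h : Tendsto (fun n => normH 0 (fun x => u n x - v x)) atTop (𝓝 0)) :
    ∃ s : ℕ → ℕ, StrictMono s ∧ ∀ᵐ x, Tendsto (fun n => u (s n) x) atTop (𝓝 (v x)) := by
  refine TendstoInMeasure.exists_seq_tendsto_ae (μ := volume) ?_
  refine tendstoInMeasure_of_tendsto_eLpNorm (p := 2) (by norm_num) (fun n => (hu n).1) hv.1 ?_
  have e : ∀ n, eLpNorm (u n - v) 2 volume = ENNReal.ofReal (normH 0 (fun x => u n x - v x)) :=
    fun n => eLpNorm_two_eq ((hu n).sub hv)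
  simp_rw [e]
  simpa using ENNReal.tendsto_ofReal h

theorem IsMollifier.le_mollify {δ : ℝ} {ρ u : Space d → ℝ} (hρ : IsMollifier δ ρ)
    (hu : LocallyIntegrable u) {c : ℝ} (hc : ∀ x, c ≤ u x) (x : Space d) : c ≤ mollify ρ u x := by
  have hi : Integrable (fun t => ρ t * u (x - t)) :=
    hρ.test.compact.convolutionExists_left (ContinuousLinearMap.lsmul ℝ ℝ)
      hρ.test.continuous hu x
  have hρi : Integrable ρ := hρ.test.continuous.integrable_of_hasCompactSupport hρ.test.compact
  calc c = ∫ t, ρ t * c := by rw [integral_mul_const, hρ.integral_eq, one_mul]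
    _ ≤ _ := integral_mono (hρi.mul_const c) hi fun t =>
      mul_le_mul_of_nonneg_left (hc _) (hρ.nonneg t)

/-- Test functions are dense in `H^k`; the approximation preserves nonpositive lower bounds. -/
theorem MemH.exists_test_seq {k : ℕ} {u : Space d → ℝ} (hu : MemH k u) :
    ∃ φ : ℕ → Space d → ℝ, (∀ n, IsTest (φ n)) ∧
      Tendsto (fun n => normH k (fun x => φ n x - u x)) atTop (𝓝 0) ∧
      (∀ᵐ x, Tendsto (fun n => φ n x) atTop (𝓝 (u x))) ∧
      ∀ c ≤ 0, (∀ x, c ≤ u x) → ∀ n x, c ≤ φ n x := by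
  suffices H : ∃ φ : ℕ → Space d → ℝ, (∀ n, IsTest (φ n)) ∧
      Tendsto (fun n => normH k (fun x => φ n x - u x)) atTop (𝓝 0) ∧
      ∀ c ≤ 0, (∀ x, c ≤ u x) → ∀ n x, c ≤ φ n x by
    obtain ⟨φ, h1, h2, h3⟩ := H
    obtain ⟨s, hs, hae⟩ := exists_subseq_tendsto_ae (fun n => (h1 n).memLp 2) hu.memLp
      (squeeze_zero (fun n => normH_nonneg _ _) (fun n => normH_mono (Nat.zero_le k) _) h2)
    exact ⟨fun n => φ (s n), fun n => h1 _, h2.comp hs.tendsto_atTop, hae,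
      fun c hc hcu n => h3 c hc hcu _⟩
  -- cut off with a dilated bump function, then mollify
  let f : ContDiffBump (0 : Space d) := ⟨1, 2, by norm_num, by norm_num⟩
  have hf : IsTest f := ⟨f.contDiff, f.hasCompactSupport⟩
  have hcut := tendsto_normH_cutoff hf
    (f.one_of_mem_closedBall (Metric.mem_closedBall_self f.rIn_pos.le))
    (fun x => by rw [abs_of_nonneg f.nonneg]; exact f.le_one) hu
  have hcpos : ∀ n : ℕ, 0 < 1 / ((n : ℝ) + 1) := fun n => Nat.one_div_pos_of_nat
  obtain ⟨C, hC0, hC⟩ := hf.exists_normH_dilate_mul_le k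
  set v : ℕ → Space d → ℝ := fun n x => f ((1 / ((n : ℝ) + 1)) • x) * u x
  have hv : ∀ n, MemH k (v n) := fun n => (hC _ (hcpos n) (by
    rw [div_le_one (by positivity)]
    linarith [Nat.cast_nonneg (α := ℝ) n]) u hu).1
  have hvc : ∀ n, HasCompactSupport (v n) := fun n =>
    (hf.comp_const_smul (hcpos n)).compact.mul_right
  have hsq : ∀ n : ℕ, 0 < (1 / ((n : ℝ) + 1)) ^ 2 := fun n => by have := hcpos n; positivity
  choose δ hδ hδm using fun n => exists_normHSq_mollify_sub_le (hv n) (hsq n)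
  choose ρ hρ using fun n => exists_isMollifier (d := d) (hδ n)
  have hli : ∀ n, LocallyIntegrable (v n) := fun n => MemLp.locallyIntegrable_two (hv n).memLp
  refine ⟨fun n => mollify (ρ n) (v n), fun n => (hρ n).test.mollify_of_compact (hli n) (hvc n),
    ?_, fun c hc hcu n x => (hρ n).le_mollify (hli n) (fun y => ?_) x⟩
  · have hlim := tendsto_one_div_add_atTop_nhds_zero_nat (𝕜 := ℝ).add hcut
    rw [add_zero] at hlim
    refine squeeze_zero (fun n => normH_nonneg _ _) (fun n => ?_) hlim
    have e : (fun x => mollify (ρ n) (v n) x - u x)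
        = fun x => (mollify (ρ n) (v n) x - v n x) + (v n x - u x) := by funext x; ring
    rw [e]
    refine (normH_add_le (((hv n).mollify (hρ n).test).sub (hv n)) ((hv n).sub hu)).trans
      (add_le_add ?_ le_rfl)
    exact Real.sqrt_le_iff.2 ⟨(hcpos n).le, hδm n _ (hρ n)⟩
  · have h1 : 0 ≤ f ((1 / ((n : ℝ) + 1)) • y) := f.nonneg
    have h2 : f ((1 / ((n : ℝ) + 1)) • y) ≤ 1 := f.le_one
    have h3 := hcu y
    change c ≤ f ((1 / ((n : ℝ) + 1)) • y) * u y
    nlinarith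

/-! ### Limits of integrals and extension of weak identities -/

theorem tendsto_integral_mul {u : ℕ → Space d → ℝ} {v w : Space d → ℝ}
    (hu : ∀ n, MemLp (u n) 2) (hv : MemLp v 2) (hw : MemLp w 2)
    (h : Tendsto (fun n => normH 0 (fun x => u n x - v x)) atTop (𝓝 0)) :
    Tendsto (fun n => ∫ x, w x * u n x) atTop (𝓝 (∫ x, w x * v x)) := by
  rw [tendsto_iff_norm_sub_tendsto_zero]
  have hlim := h.const_mul (normH 0 w)
  rw [mul_zero] at hlim
  refine squeeze_zero (fun n => norm_nonneg _) (fun n => ?_) hlim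
  rw [← integral_sub (MemLp.integrable_mul_two hw (hu n)) (MemLp.integrable_mul_two hw hv)]
  simp only [← mul_sub]
  exact abs_integral_mul_le_normH hw ((hu n).sub hv)

theorem tendsto_normH_weakPartial {k : ℕ} {u : ℕ → Space d → ℝ} {v : Space d → ℝ}
    (hu : ∀ n, MemH (k + 1) (u n)) (hv : MemH (k + 1) v)
    (h : Tendsto (fun n => normH (k + 1) (fun x => u n x - v x)) atTop (𝓝 0)) (i : Fin d) :
    Tendsto (fun n => normH k (fun x => weakPartial i (u n) x - weakPartial i v x)) atTop
      (𝓝 0) := by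
  refine squeeze_zero (fun n => normH_nonneg _ _) (fun n => ?_) h
  rw [← normH_congr (weakPartial_sub_ae (hu n) hv i)]
  exact normH_weakPartial_le _ _ _

theorem tendsto_normH_of_le {k l : ℕ} (hkl : k ≤ l) {u : ℕ → Space d → ℝ}
    (h : Tendsto (fun n => normH l (u n)) atTop (𝓝 0)) :
    Tendsto (fun n => normH k (u n)) atTop (𝓝 0) :=
  squeeze_zero (fun _ => normH_nonneg _ _) (fun _ => normH_mono hkl _) h

/-- A first-order identity with `L²` coefficients which holds for test functions holds for all
functions in `H^1`. -/
theorem integral_add_sum_eq_zero_of_test {A : Space d → ℝ} {B : Field d} (hA : MemLp A 2)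
    (hB : ∀ i, MemLp (B i) 2)
    (h : ∀ φ : Space d → ℝ, IsTest φ →
      (∫ x, A x * φ x) + ∑ i, ∫ x, B i x * partialDeriv i φ x = 0)
    {z : Space d → ℝ} (hz : MemH 1 z) :
    (∫ x, A x * z x) + ∑ i, ∫ x, B i x * weakPartial i z x = 0 := by
  obtain ⟨φ, hφ, hlim, _, _⟩ := hz.exists_test_seq
  have h1 := tendsto_integral_mul (fun n => (hφ n).memLp 2) hz.memLp hA
    (tendsto_normH_of_le (Nat.zero_le 1) hlim)
  have h2 := fun i => tendsto_integral_mul (fun n => (((hφ n).memH 1).weakPartial i).memLp)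
    (hz.weakPartial i).memLp (hB i)
    (tendsto_normH_weakPartial (fun n => (hφ n).memH 1) hz hlim i)
  have h3 := h1.add (tendsto_finsetSum Finset.univ fun i _ => h2 i)
  refine tendsto_nhds_unique h3 ?_
  have e : ∀ n, (∫ x, A x * φ n x) + ∑ i, ∫ x, B i x * weakPartial i (φ n) x = 0 := by
    intro n
    rw [← h (φ n) (hφ n)]
    congr 1
    refine Finset.sum_congr rfl fun i _ => integral_congr_ae ?_
    filter_upwards [(hφ n).weakPartial_ae i] with x hx
    rw [hx]
  simp_rw [e]
  exact tendsto_const_nhds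

/-- Integration by parts against a function in `H^1`. -/
theorem HasWeakPartial.integral_mul_weakPartial {i : Fin d} {u v z : Space d → ℝ}
    (h : HasWeakPartial i u v) (hu : MemLp u 2) (hv : MemLp v 2) (hz : MemH 1 z) :
    ∫ x, u x * weakPartial i z x = -∫ x, v x * z x := by
  have key := integral_add_sum_eq_zero_of_test (A := v) (B := fun j => if j = i then u else 0) hv
    (fun j => by split_ifs; exacts [hu, MemLp.zero]) (fun φ hφ => ?_) hz
  · rw [Finset.sum_eq_single i (fun j _ hj => by simp [hj]) (by simp)] at key
    simp only [if_true] at key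
    linarith
  · rw [Finset.sum_eq_single i (fun j _ hj => by simp [hj]) (by simp)]
    simp only [if_true]
    linarith [h.integral_eq φ hφ]

theorem MemLp.mul_test {u φ : Space d → ℝ} (hu : MemLp u 2) (hφ : IsTest φ) :
    MemLp (fun x => u x * φ x) 2 := by
  obtain ⟨B, hB⟩ := hφ.continuous.bounded_above_of_compact_support hφ.compact
  simpa only [mul_comm] using MemLp.bdd_mul_two hu hφ.continuous.aestronglyMeasurable
    (Eventually.of_forall fun x => (hB x : |φ x| ≤ B))

/-- The Leibniz rule for the product of a function in `H^1` and a function in `L²` with a weak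
derivative in `L²`. For a test function in place of `u` it is the definition of the weak derivative
tested with a product; in general it follows by density. -/
theorem HasWeakPartial.mul {i : Fin d} {u v v' : Space d → ℝ} (hu : MemH 1 u)
    (h : HasWeakPartial i v v') (hv : MemLp v 2) (hv' : MemLp v' 2) :
    HasWeakPartial i (fun x => u x * v x)
      (fun x => u x * v' x + weakPartial i u x * v x) := by
  refine ⟨(MemLp.integrable_mul_two hu.memLp hv).locallyIntegrable,
    ((MemLp.integrable_mul_two hu.memLp hv').add
      (MemLp.integrable_mul_two (hu.weakPartial i).memLp hv)).locallyIntegrable, fun ψ hψ => ?_⟩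
  have hA1 := MemLp.mul_test hv (hψ.partialDeriv i)
  have hA2 := MemLp.mul_test hv' hψ
  have hB := MemLp.mul_test hv hψ
  have key := integral_add_sum_eq_zero_of_test
    (A := fun x => v x * partialDeriv i ψ x + v' x * ψ x)
    (B := fun j => if j = i then (fun x => v x * ψ x) else 0) (hA1.add hA2)
    (fun j => by split_ifs; exacts [hB, MemLp.zero]) (fun φ hφ => ?_) hu
  · rw [Finset.sum_eq_single i (fun j _ hj => by simp [hj]) (by simp)] at key
    simp only [if_true, add_mul] at key ⊢
    rw [integral_add (MemLp.integrable_mul_two hA1 hu.memLp)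
      (MemLp.integrable_mul_two hA2 hu.memLp)] at key
    have i1 := MemLp.integrable_mul_two hA2 hu.memLp
    have i2 := MemLp.integrable_mul_two hB (hu.weakPartial i).memLp
    have e1 : ∀ x, v' x * ψ x * u x = u x * v' x * ψ x := fun x => by ring
    have e2 : ∀ x, v x * ψ x * weakPartial i u x
        = weakPartial i u x * v x * ψ x := fun x => by ring
    have e3 : ∀ x, v x * partialDeriv i ψ x * u x = u x * v x * partialDeriv i ψ x :=
      fun x => by ring
    simp only [e1, e2] at i1 i2
    rw [integral_add i1 i2]
    simp only [e1, e2, e3] at key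
    linarith
  · rw [Finset.sum_eq_single i (fun j _ hj => by simp [hj]) (by simp)]
    simp only [if_true, add_mul]
    rw [integral_add (MemLp.integrable_mul_two hA1 (hφ.memLp 2))
      (MemLp.integrable_mul_two hA2 (hφ.memLp 2))]
    have h1 := h.integral_eq _ (IsTest.smooth_mul hψ.smooth hφ)
    have e1 : ∀ x, v x * partialDeriv i (fun x => ψ x * φ x) x
        = v x * partialDeriv i ψ x * φ x + v x * ψ x * partialDeriv i φ x := by
      intro x
      rw [partialDeriv_mul hψ.differentiable hφ.differentiable]
      ring
    simp_rw [e1] at h1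
    rw [integral_add (MemLp.integrable_mul_two hA1 (hφ.memLp 2))
      (MemLp.integrable_mul_two hB ((hφ.partialDeriv i).memLp 2))] at h1
    simp only [← mul_assoc] at h1
    linarith

/-! ### Sobolev inequalities in dimensions one and two -/

/-- The fundamental theorem of calculus along the line through `x` in direction `i`. -/
theorem IsTest.enorm_le_lintegral_line {φ : Space d → ℝ} (hφ : IsTest φ) (i : Fin d) (x : Space d) :
    ‖φ x‖ₑ ≤ ∫⁻ s : ℝ, ‖partialDeriv i φ (x + s • EuclideanSpace.single i (1 : ℝ))‖ₑ := by
  set e : Space d := EuclideanSpace.single i (1 : ℝ)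
  have he : e ≠ 0 := by
    intro h
    have := congrArg (fun v : Space d => v i) h
    simp [e] at this
  have hcl : Topology.IsClosedEmbedding (fun s : ℝ => x + s • e) :=
    (Homeomorph.addLeft x).isClosedEmbedding.comp (isClosedEmbedding_smul_left he)
  have hd : ∀ s : ℝ, deriv (fun s : ℝ => φ (x + s • e)) s = partialDeriv i φ (x + s • e) := by
    intro s
    have h1 : HasDerivAt (fun s : ℝ => x + s • e) e s := by
      simpa using ((hasDerivAt_id s).smul_const e).const_add x
    exact ((hφ.differentiable _).hasFDerivAt.comp_hasDerivAt s h1).deriv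
  have hsm : ContDiff ℝ 1 (fun s : ℝ => φ (x + s • e)) :=
    hφ.contDiff_one.comp (contDiff_const.add (contDiff_id.smul contDiff_const))
  have key := HasCompactSupport.enorm_le_lintegral_Ici_deriv hsm
    (hφ.compact.comp_isClosedEmbedding hcl) 0
  simp only [zero_smul, add_zero, hd] at key
  exact key.trans (setLIntegral_le_lintegral _ _)

/-- `|φ| ≤ ∫ |∂_x φ|` in dimension one. -/
theorem IsTest.enorm_le_lintegral_of_one {φ : Space 1 → ℝ} (hφ : IsTest φ) (x : Space 1) :
    ‖φ x‖ₑ ≤ ∫⁻ y, ‖partialDeriv 0 φ y‖ₑ := by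
  have hmeas : Measurable fun y => ‖partialDeriv 0 φ y‖ₑ :=
    (hφ.partialDeriv 0).continuous.measurable.enorm
  refine (hφ.enorm_le_lintegral_line 0 x).trans (le_of_eq ?_)
  have hmp : MeasurePreserving (fun s : ℝ => x + s • EuclideanSpace.single (0 : Fin 1) (1 : ℝ))
      volume volume := by
    have h1 := (PiLp.volume_preserving_toLp (Fin 1)).comp
      (volume_preserving_funUnique (Fin 1) ℝ).symm
    have h2 := (measurePreserving_add_left volume x).comp h1
    convert h2 using 1
    funext s
    ext j
    simp [Subsingleton.elim j 0]
  exact hmp.lintegral_comp hmeas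

/-- `|φ| ≤ ∫ |∂_x ∂_y φ|` in dimension two. -/
theorem IsTest.enorm_le_lintegral_of_two {φ : Space 2 → ℝ} (hφ : IsTest φ) (x : Space 2) :
    ‖φ x‖ₑ ≤ ∫⁻ y, ‖partialDeriv 1 (partialDeriv 0 φ) y‖ₑ := by
  have hmeas : Measurable fun y => ‖partialDeriv 1 (partialDeriv 0 φ) y‖ₑ :=
    ((hφ.partialDeriv 0).partialDeriv 1).continuous.measurable.enorm
  have hmp : MeasurePreserving (fun p : ℝ × ℝ => x + p.1 • EuclideanSpace.single (0 : Fin 2) (1 : ℝ)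
      + p.2 • EuclideanSpace.single (1 : Fin 2) (1 : ℝ)) volume volume := by
    have h1 := (PiLp.volume_preserving_toLp (Fin 2)).comp
      (volume_preserving_finTwoArrow ℝ).symm
    have h2 := (measurePreserving_add_left volume x).comp h1
    convert h2 using 1
    funext p
    ext j
    fin_cases j <;> simp
  calc ‖φ x‖ₑ ≤ ∫⁻ s : ℝ, ‖partialDeriv 0 φ (x + s • EuclideanSpace.single 0 (1 : ℝ))‖ₑ :=
        hφ.enorm_le_lintegral_line 0 x
    _ ≤ ∫⁻ s : ℝ, ∫⁻ t : ℝ, ‖partialDeriv 1 (partialDeriv 0 φ)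
          (x + s • EuclideanSpace.single 0 (1 : ℝ) + t • EuclideanSpace.single 1 (1 : ℝ))‖ₑ :=
        lintegral_mono fun s => (hφ.partialDeriv 0).enorm_le_lintegral_line 1 _
    _ = ∫⁻ p : ℝ × ℝ, ‖partialDeriv 1 (partialDeriv 0 φ)
          (x + p.1 • EuclideanSpace.single 0 (1 : ℝ)
            + p.2 • EuclideanSpace.single 1 (1 : ℝ))‖ₑ := by
        rw [Measure.volume_eq_prod, lintegral_prod]
        exact (hmeas.comp hmp.measurable).aemeasurable
    _ = _ := hmp.lintegral_comp hmeas

theorem lintegral_enorm_mul_le {u v : Space d → ℝ} (hu : MemLp u 2) (hv : MemLp v 2) :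
    ∫⁻ x, ‖u x * v x‖ₑ ≤ ENNReal.ofReal (normH 0 u * normH 0 v) := by
  rw [← ofReal_integral_norm_eq_lintegral_enorm (MemLp.integrable_mul_two hu hv)]
  refine ENNReal.ofReal_le_ofReal ?_
  have h := abs_integral_mul_le_normH (u := fun x => |u x|) (v := fun x => |v x|) hu.abs hv.abs
  have e : ∀ w : Space d → ℝ, normH 0 (fun x => |w x|) = normH 0 w := fun w => by
    simp [normH, normHSq]
  rw [e, e] at h
  simp only [norm_mul, Real.norm_eq_abs]
  exact (le_abs_self _).trans h

theorem IsTest.normH_partialDeriv_le {φ : Space d → ℝ} (hφ : IsTest φ) (k : ℕ) (i : Fin d) :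
    normH k (partialDeriv i φ) ≤ normH (k + 1) φ := (hφ.hasWeakPartial i).normH_le k

theorem le_of_enorm_le_ofReal {a b : ℝ} (hb : 0 ≤ b) (h : ‖a‖ₑ ≤ ENNReal.ofReal b) : |a| ≤ b := by
  rw [← ofReal_norm, ENNReal.ofReal_le_ofReal_iff hb] at h
  exact h

/-- The Sobolev inequality for test functions: apply the fundamental theorem of calculus in each
variable to `φ²`, and the Cauchy–Schwarz inequality. -/
theorem IsTest.abs_le_normH (hd : d = 1 ∨ d = 2) {φ : Space d → ℝ} (hφ : IsTest φ) (x : Space d) :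
    |φ x| ≤ 2 * normH d φ := by
  have hφφ := IsTest.smooth_mul hφ.smooth hφ
  rcases hd with rfl | rfl
  · have h := hφφ.enorm_le_lintegral_of_one x
    have e : ∀ y, partialDeriv 0 (fun x => φ x * φ x) y
        = (2 * φ y) * partialDeriv 0 φ y := by
      intro y
      rw [partialDeriv_mul hφ.differentiable hφ.differentiable]
      ring
    simp_rw [e] at h
    have h2 := h.trans (lintegral_enorm_mul_le ((hφ.const_mul 2).memLp 2)
      ((hφ.partialDeriv 0).memLp 2))
    have h3 := le_of_enorm_le_ofReal (mul_nonneg (normH_nonneg _ _) (normH_nonneg _ _)) h2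
    rw [normH_const_mul (hφ.memH 0), abs_mul, abs_two] at h3
    have h4 := hφ.normH_partialDeriv_le 0 0
    have h5 := normH_le_succ 0 φ
    refine abs_le_of_sq_le_sq ?_ (by have := normH_nonneg 1 φ; positivity)
    have h6 := mul_le_mul h5 h4 (normH_nonneg _ _) (normH_nonneg _ _)
    simp only [zero_add] at h6
    -- `|φ|² ≤ 2 |φ|_{L²} |∂φ|_{L²}`
    nlinarith [abs_mul_abs_self (φ x)]
  · have h := hφφ.enorm_le_lintegral_of_two x
    have e0 : partialDeriv 0 (fun x => φ x * φ x)
        = fun y => (2 * φ y) * partialDeriv 0 φ y := by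
      funext y
      rw [partialDeriv_mul hφ.differentiable hφ.differentiable]
      ring
    have e1 : partialDeriv 1 (fun x => 2 * φ x)
        = fun y => 2 * partialDeriv 1 φ y := by
      funext y
      unfold partialDeriv
      rw [fderiv_const_mul (hφ.differentiable y)]
      simp
    have e : ∀ y, partialDeriv 1 (partialDeriv 0 (fun x => φ x * φ x)) y
        = (2 * partialDeriv 1 φ y) * partialDeriv 0 φ y
          + (2 * φ y) * partialDeriv 1 (partialDeriv 0 φ) y := by
      intro y
      rw [e0, partialDeriv_mul (hφ.const_mul 2).differentiable (hφ.partialDeriv 0).differentiable,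
        e1]
    have h2 : ‖φ x * φ x‖ₑ ≤ ENNReal.ofReal
        (normH 0 (fun x => 2 * partialDeriv 1 φ x)
          * normH 0 (partialDeriv 0 φ)
        + normH 0 (fun x => 2 * φ x)
          * normH 0 (partialDeriv 1 (partialDeriv 0 φ))) := by
      refine h.trans ?_
      simp_rw [e]
      rw [ENNReal.ofReal_add (mul_nonneg (normH_nonneg _ _) (normH_nonneg _ _))
        (mul_nonneg (normH_nonneg _ _) (normH_nonneg _ _))]
      refine (lintegral_mono fun y => enorm_add_le _ _).trans ?_
      rw [lintegral_add_left]
      · exact add_le_add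
          (lintegral_enorm_mul_le (((hφ.partialDeriv 1).const_mul 2).memLp 2)
            ((hφ.partialDeriv 0).memLp 2))
          (lintegral_enorm_mul_le ((hφ.const_mul 2).memLp 2)
            (((hφ.partialDeriv 0).partialDeriv 1).memLp 2))
      · exact (((hφ.partialDeriv 1).const_mul 2).continuous.mul
          (hφ.partialDeriv 0).continuous).measurable.enorm
    have hn := fun k u => normH_nonneg (d := 2) k u
    have h3 := le_of_enorm_le_ofReal (add_nonneg (mul_nonneg (hn _ _) (hn _ _))
      (mul_nonneg (hn _ _) (hn _ _))) h2
    rw [normH_const_mul (hφ.memH 0), normH_const_mul ((hφ.partialDeriv 1).memH 0), abs_mul,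
      abs_two] at h3
    have a1 := (hφ.normH_partialDeriv_le 0 0).trans (normH_le_succ 1 φ)
    have a2 := (hφ.normH_partialDeriv_le 0 1).trans (normH_le_succ 1 φ)
    have a3 := normH_mono (Nat.zero_le 2) φ
    have a4 := ((hφ.partialDeriv 0).normH_partialDeriv_le 0 1).trans
      (hφ.normH_partialDeriv_le 1 0)
    have b1 := mul_le_mul a2 a1 (hn _ _) (hn _ _)
    have b2 := mul_le_mul a3 a4 (hn _ _) (hn _ _)
    refine abs_le_of_sq_le_sq ?_ (by have := hn 2 φ; positivity)
    simp only [Nat.reduceAdd] at b1 b2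
    nlinarith [abs_mul_abs_self (φ x)]

theorem tendsto_normH_of_sub {k : ℕ} {u : ℕ → Space d → ℝ} {v : Space d → ℝ}
    (hu : ∀ n, MemH k (u n)) (hv : MemH k v)
    (h : Tendsto (fun n => normH k (fun x => u n x - v x)) atTop (𝓝 0)) :
    Tendsto (fun n => normH k (u n)) atTop (𝓝 (normH k v)) := by
  rw [tendsto_iff_norm_sub_tendsto_zero]
  refine squeeze_zero (fun n => norm_nonneg _) (fun n => ?_) h
  have h1 := normH_add_le ((hu n).sub hv) hv
  have h2 := normH_sub_le (hu n) ((hu n).sub hv)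
  simp only [sub_add_cancel, sub_sub_cancel] at h1 h2
  rw [Real.norm_eq_abs, abs_le]
  constructor <;> linarith

/-- The Sobolev embedding of `H^m` into `L^∞` for `m > d / 2`, that is `m ≥ d`. -/
theorem MemH.ae_abs_le (hd : d = 1 ∨ d = 2) {m : ℕ} (hm : d ≤ m) {u : Space d → ℝ}
    (hu : MemH m u) : ∀ᵐ x, |u x| ≤ 2 * normH m u := by
  obtain ⟨φ, hφ, hlim, hae, _⟩ := hu.exists_test_seq
  filter_upwards [hae] with x hx
  refine le_of_tendsto_of_tendsto' hx.abs
    ((tendsto_normH_of_sub (fun n => (hφ n).memH m) hu hlim).const_mul 2) fun n => ?_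
  exact ((hφ n).abs_le_normH hd x).trans (by gcongr; exact normH_mono hm _)

theorem enorm_fderiv_le (u : Space d → ℝ) (x : Space d) :
    ‖fderiv ℝ u x‖ₑ ≤ ∑ i, ‖partialDeriv i u x‖ₑ := by
  have h : ‖fderiv ℝ u x‖ ≤ ∑ i, ‖partialDeriv i u x‖ := by
    refine ContinuousLinearMap.opNorm_le_bound _ (Finset.sum_nonneg fun _ _ => norm_nonneg _)
      fun v => ?_
    have hv : v = ∑ i, v i • EuclideanSpace.single i (1 : ℝ) := by
      ext j
      simp [Finset.sum_apply, Pi.single_apply]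
    conv_lhs => rw [hv]
    rw [map_sum, Finset.sum_mul]
    refine (norm_sum_le _ _).trans (Finset.sum_le_sum fun i _ => ?_)
    rw [map_smul, norm_smul, mul_comm]
    gcongr
    · exact le_rfl
    · exact PiLp.norm_apply_le v i
  rw [← ofReal_norm]
  refine (ENNReal.ofReal_le_ofReal h).trans ?_
  rw [ENNReal.ofReal_sum_of_nonneg fun _ _ => norm_nonneg _]
  simp only [ofReal_norm, le_refl]

/-- In dimension two the product of two `H^1` functions is in `L²`, by the
Gagliardo–Nirenberg–Sobolev inequality for the product. -/
theorem exists_normH_zero_mul_le :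
    ∃ C, 0 ≤ C ∧ ∀ u v : Space 2 → ℝ, MemH 1 u → MemH 1 v →
      MemH 0 (fun x => u x * v x) ∧ normH 0 (fun x => u x * v x) ≤ C * (normH 1 u * normH 1 v) := by
  have hconj : NNReal.HolderConjugate (Module.finrank ℝ (Space 2)) 2 := by
    rw [finrank_euclideanSpace_fin, NNReal.holderConjugate_iff]
    constructor
    · norm_num
    · norm_num
  obtain ⟨K, hK⟩ : ∃ K : NNReal, ∀ u : Space 2 → ℝ, ContDiff ℝ 1 u → HasCompactSupport u →
      eLpNorm u 2 volume ≤ K * eLpNorm (fderiv ℝ u) 1 volume :=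
    ⟨_, fun u h1 h2 => eLpNorm_le_eLpNorm_fderiv_one (volume : Measure (Space 2)) h1 h2 hconj⟩
  have htest : ∀ φ ψ : Space 2 → ℝ, IsTest φ → IsTest ψ →
      eLpNorm (fun x => φ x * ψ x) 2 volume ≤
        ENNReal.ofReal (K * 4 * (normH 1 φ * normH 1 ψ)) := by
    intro φ ψ hφ hψ
    have hφψ := IsTest.smooth_mul hφ.smooth hψ
    have h := hK _ hφψ.contDiff_one hφψ.compact
    have hn := fun k u => normH_nonneg (d := 2) k u
    have h1 : ∀ i, ∫⁻ x, ‖partialDeriv i (fun x => φ x * ψ x) x‖ₑ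
        ≤ ENNReal.ofReal (2 * (normH 1 φ * normH 1 ψ)) := by
      intro i
      simp_rw [partialDeriv_mul hφ.differentiable hψ.differentiable]
      refine (lintegral_mono fun y => enorm_add_le _ _).trans ?_
      have hmeas : Measurable fun y => ‖partialDeriv i φ y * ψ y‖ₑ :=
        ((hφ.partialDeriv i).continuous.mul hψ.continuous).measurable.enorm
      rw [lintegral_add_left hmeas, two_mul,
        ENNReal.ofReal_add (mul_nonneg (hn _ _) (hn _ _)) (mul_nonneg (hn _ _) (hn _ _))]
      refine add_le_add
        ((lintegral_enorm_mul_le ((hφ.partialDeriv i).memLp 2) (hψ.memLp 2)).trans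
          (ENNReal.ofReal_le_ofReal (mul_le_mul (hφ.normH_partialDeriv_le 0 i)
            (normH_le_succ 0 ψ) (hn _ _) (hn _ _))))
        ((lintegral_enorm_mul_le (hφ.memLp 2) ((hψ.partialDeriv i).memLp 2)).trans
          (ENNReal.ofReal_le_ofReal (mul_le_mul (normH_le_succ 0 φ)
            (hψ.normH_partialDeriv_le 0 i) (hn _ _) (hn _ _))))
    have h2 : eLpNorm (fderiv ℝ fun x => φ x * ψ x) 1 volume
        ≤ ENNReal.ofReal (4 * (normH 1 φ * normH 1 ψ)) := by
      rw [eLpNorm_one_eq_lintegral_enorm]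
      refine (lintegral_mono fun x => enorm_fderiv_le _ x).trans ?_
      simp only [Fin.sum_univ_two]
      rw [lintegral_add_left (hφψ.partialDeriv 0).continuous.measurable.enorm]
      refine (add_le_add (h1 0) (h1 1)).trans (le_of_eq ?_)
      have := mul_nonneg (hn 1 φ) (hn 1 ψ)
      rw [← ENNReal.ofReal_add (by positivity) (by positivity)]
      congr 1; ring
    refine (h.trans (mul_le_mul_right h2 _)).trans (le_of_eq ?_)
    rw [mul_assoc, ENNReal.ofReal_mul K.coe_nonneg, ENNReal.ofReal_coe_nnreal]
  refine ⟨K * 4, by positivity, fun u v hu hv => ?_⟩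
  obtain ⟨φ, hφ, hlim, hae, _⟩ := hu.exists_test_seq
  obtain ⟨ψ, hψ, hlim', hae', _⟩ := hv.exists_test_seq
  have hle : eLpNorm (fun x => u x * v x) 2 volume
      ≤ ENNReal.ofReal (K * 4 * (normH 1 u * normH 1 v)) := by
    refine (Lp.eLpNorm_lim_le_liminf_eLpNorm (f := fun n x => φ n x * ψ n x)
      (fun n => ((hφ n).continuous.mul (hψ n).continuous).aestronglyMeasurable) _ ?_).trans ?_
    · filter_upwards [hae, hae'] with x h1 h2 using h1.mul h2
    · have h3 : Tendsto (fun n => ENNReal.ofReal (K * 4 * (normH 1 (φ n) * normH 1 (ψ n)))) atTop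
          (𝓝 (ENNReal.ofReal (K * 4 * (normH 1 u * normH 1 v)))) :=
        ENNReal.tendsto_ofReal (((tendsto_normH_of_sub (fun n => (hφ n).memH 1) hu hlim).mul
          (tendsto_normH_of_sub (fun n => (hψ n).memH 1) hv hlim')).const_mul _)
      rw [← h3.liminf_eq]
      exact liminf_le_liminf (Eventually.of_forall fun n => htest _ _ (hφ n) (hψ n))
  have hm : MemLp (fun x => u x * v x) 2 :=
    ⟨hu.memLp.1.mul hv.memLp.1, hle.trans_lt ENNReal.ofReal_lt_top⟩
  refine ⟨hm, ?_⟩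
  rw [eLpNorm_two_eq hm] at hle
  refine (ENNReal.ofReal_le_ofReal_iff ?_).1 hle
  have := mul_nonneg (normH_nonneg 1 u) (normH_nonneg 1 v)
  positivity

/-- Functions in `H^m`, `m ≥ d`, are multipliers of `H^k` for `k ≤ m`. In the Leibniz rule the
term `∂u v` is estimated in `H^{k-1}` with `v` as the multiplier, which needs `d ≤ k`; the remaining
case is `k = 1`, `d = 2`, where both factors are in `H^1`. -/
theorem exists_normH_mul_le (hd : d = 1 ∨ d = 2) {m k : ℕ} (hm : d ≤ m) (hk : k ≤ m) :
    ∃ C, 0 ≤ C ∧ ∀ u v : Space d → ℝ, MemH m u → MemH k v →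
      MemH k (fun x => u x * v x) ∧ normH k (fun x => u x * v x) ≤ C * (normH m u * normH k v) := by
  induction k generalizing m with
  | zero =>
    refine ⟨2, by norm_num, fun u v hu hv => ?_⟩
    have hb := hu.ae_abs_le hd hm
    refine ⟨MemLp.bdd_mul_two hv hu.memLp.1 hb, ?_⟩
    rw [← mul_assoc]
    have := normH_nonneg m u
    refine Real.sqrt_le_iff.2 ⟨mul_nonneg (by positivity) (normH_nonneg _ _), ?_⟩
    rw [mul_pow, normH_zero_sq]
    exact integral_sq_bdd_mul_le hv hu.memLp.1 hb
  | succ k ih =>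
    obtain ⟨C, hC0, hC⟩ := ih hm (Nat.le_of_succ_le hk)
    have hstep : ∃ C', 0 ≤ C' ∧ ∀ u v : Space d → ℝ, MemH m u → MemH (k + 1) v → ∀ i,
        MemH k (fun x => weakPartial i u x * v x) ∧
        normH k (fun x => weakPartial i u x * v x) ≤ C' * (normH m u * normH (k + 1) v) := by
      obtain ⟨m', rfl⟩ : ∃ m', m = m' + 1 := ⟨m - 1, by omega⟩
      have hkm : k ≤ m' := by omega
      by_cases hdk : d ≤ k + 1
      · obtain ⟨C', hC0', hC'⟩ := ih hdk (Nat.le_succ k)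
        refine ⟨C', hC0', fun u v hu hv i => ?_⟩
        have h := hC' v (weakPartial i u) hv ((hu.weakPartial i).mono hkm)
        simp only [mul_comm (v _)] at h
        refine ⟨h.1, h.2.trans ?_⟩
        rw [mul_comm (normH (m' + 1) u)]
        exact mul_le_mul_of_nonneg_left (mul_le_mul_of_nonneg_left
          ((normH_mono hkm _).trans (normH_weakPartial_le _ _ _)) (normH_nonneg _ _)) hC0'
      · obtain rfl : k = 0 := by omega
        obtain rfl : d = 2 := by omega
        obtain ⟨C', hC0', hC'⟩ := exists_normH_zero_mul_le
        refine ⟨C', hC0', fun u v hu hv i => ?_⟩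
        have h := hC' (weakPartial i u) v ((hu.weakPartial i).mono (by omega)) hv
        refine ⟨h.1, h.2.trans ?_⟩
        exact mul_le_mul_of_nonneg_left (mul_le_mul_of_nonneg_right
          ((normH_mono (by omega) _).trans (normH_weakPartial_le _ _ _)) (normH_nonneg _ _)) hC0'
    obtain ⟨C', hC0', hC'⟩ := hstep
    refine ⟨C + ∑ _i : Fin d, (C + C'), add_nonneg hC0 (Finset.sum_nonneg fun _ _ =>
      add_nonneg hC0 hC0'), fun u v hu hv => ?_⟩
    have hu1 : MemH 1 u := hu.mono (by omega)
    have hw : ∀ i, HasWeakPartial i (fun x => u x * v x)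
        (fun x => u x * weakPartial i v x + weakPartial i u x * v x) := fun i =>
      HasWeakPartial.mul hu1 (hv.hasWeakPartial i) hv.memLp (hv.weakPartial i).memLp
    have h0 := hC u v hu hv.of_succ
    have h1 := fun i => hC u _ hu (hv.weakPartial i)
    have h2 := fun i => hC' u v hu hv i
    refine ⟨⟨h0.1, fun i => ⟨_, hw i, (h1 i).1.add (h2 i).1⟩⟩, ?_⟩
    refine (normH_succ_le _ _).trans ?_
    rw [add_mul, Finset.sum_mul]
    have hn := normH_nonneg m u
    refine add_le_add (h0.2.trans ?_) (Finset.sum_le_sum fun i _ => ?_)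
    · gcongr
      exact normH_le_succ k v
    · rw [normH_congr (hw i).weakPartial_ae, add_mul]
      refine (normH_add_le (h1 i).1 (h2 i).1).trans (add_le_add ((h1 i).2.trans ?_) (h2 i).2)
      gcongr
      exact normH_weakPartial_le k v i

/-! ### Multiplication and division by the depth -/

/-- `h` is a depth profile with `h - 1 ∈ H^{M+1}`, of norm at most `b`, and `h ≥ 1 / a`. All
estimates are uniform in `h` for fixed `a` and `b`. -/
structure IsDepth (M : ℕ) (a b : ℝ) (h : Space d → ℝ) : Prop where
  pos : 0 < a
  memH : MemH (M + 1) (fun x => h x - 1)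
  norm_le : normH (M + 1) (fun x => h x - 1) ≤ b
  le : ∀ x, a⁻¹ ≤ h x

/-- The weak derivative `∂_i h` of a depth profile, taken as that of `h - 1 ∈ H^{M+1}`. -/
noncomputable def depthPartial (h : Space d → ℝ) (i : Fin d) : Space d → ℝ :=
  weakPartial i (fun x => h x - 1)

namespace IsDepth

variable {M : ℕ} {a b : ℝ} {h : Space d → ℝ}

theorem h_pos (H : IsDepth M a b h) (x : Space d) : 0 < h x :=
  (inv_pos.2 H.pos).trans_le (H.le x)

theorem inv_le (H : IsDepth M a b h) (x : Space d) : (h x)⁻¹ ≤ a := by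
  rw [inv_le_comm₀ (H.h_pos x) H.pos]
  exact H.le x

theorem aesm (H : IsDepth M a b h) : AEStronglyMeasurable h := by
  simpa using H.memH.memLp.1.add_const 1

theorem aesm_inv (H : IsDepth M a b h) : AEStronglyMeasurable (fun x => (h x)⁻¹) :=
  H.aesm.aemeasurable.inv.aestronglyMeasurable

theorem abs_inv_le (H : IsDepth M a b h) (x : Space d) : |(h x)⁻¹| ≤ a := by
  rw [abs_of_pos (inv_pos.2 (H.h_pos x))]
  exact H.inv_le x

theorem abs_norm_le (H : IsDepth M a b h) : normH (M + 1) (fun x => h x - 1) ≤ |b| :=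
  H.norm_le.trans (le_abs_self b)

theorem ae_le (hd : d = 1 ∨ d = 2) (hM : d ≤ M + 1) (H : IsDepth M a b h) :
    ∀ᵐ x, |h x| ≤ 1 + 2 * |b| := by
  filter_upwards [H.memH.ae_abs_le hd hM] with x hx
  have h1 := H.abs_norm_le
  have h2 : |h x| ≤ |h x - 1| + 1 := by
    simpa using abs_add_le (h x - 1) 1
  linarith

theorem memLp_inv_mul (H : IsDepth M a b h) {v : Space d → ℝ} (hv : MemLp v 2) :
    MemLp (fun x => (h x)⁻¹ * v x) 2 :=
  MemLp.bdd_mul_two hv H.aesm_inv (Filter.Eventually.of_forall H.abs_inv_le)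

theorem memLp_mul (hd : d = 1 ∨ d = 2) (hM : d ≤ M + 1) (H : IsDepth M a b h) {v : Space d → ℝ}
    (hv : MemLp v 2) : MemLp (fun x => h x * v x) 2 :=
  MemLp.bdd_mul_two hv H.aesm (H.ae_le hd hM)

theorem memH_depthPartial (H : IsDepth M a b h) (i : Fin d) : MemH M (depthPartial h i) :=
  MemH.weakPartial H.memH i

theorem normH_depthPartial_le (H : IsDepth M a b h) (i : Fin d) :
    normH M (depthPartial h i) ≤ |b| := (normH_weakPartial_le _ _ _).trans H.abs_norm_le

end IsDepth

theorem tendsto_integral_mul_mul {u w : ℕ → Space d → ℝ} {v z : Space d → ℝ}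
    (hu : ∀ n, MemLp (u n) 2) (hv : MemLp v 2) (hw : ∀ n, MemLp (w n) 2) (hz : MemLp z 2)
    (h : Tendsto (fun n => normH 0 (fun x => u n x - v x)) atTop (𝓝 0))
    (h' : Tendsto (fun n => normH 0 (fun x => w n x - z x)) atTop (𝓝 0)) :
    Tendsto (fun n => ∫ x, w n x * u n x) atTop (𝓝 (∫ x, z x * v x)) := by
  have h1 := tendsto_integral_mul hu hv hz h
  have h2 : Tendsto (fun n => ∫ x, (w n x - z x) * u n x) atTop (𝓝 0) := by
    have hlim := h'.mul (tendsto_normH_of_sub (k := 0) hu hv h)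
    rw [zero_mul] at hlim
    exact squeeze_zero_norm (fun n => abs_integral_mul_le_normH ((hw n).sub hz) (hu n)) hlim
  have h3 := h2.add h1
  rw [zero_add] at h3
  refine h3.congr fun n => ?_
  have h4 : MemLp (fun x => w n x - z x) 2 := (hw n).sub hz
  rw [← integral_add (MemLp.integrable_mul_two h4 (hu n))
    (MemLp.integrable_mul_two hz (hu n))]
  congr 1
  funext x
  ring

theorem hasWeakPartial_const (i : Fin d) (c : ℝ) :
    HasWeakPartial i (fun _ : Space d => c) (fun _ => 0) := by
  have h := hasWeakPartial_of_contDiff i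
    (contDiff_const (c := c) : ContDiff ℝ 1 fun _ : Space d => c)
  have e : partialDeriv i (fun _ : Space d => c) = fun _ => 0 := by
    funext x
    simp [partialDeriv]
  rwa [e] at h

namespace IsDepth

variable {M : ℕ} {a b : ℝ} {h : Space d → ℝ}

theorem memLp_inv_sub_one (H : IsDepth M a b h) : MemLp (fun x => (h x)⁻¹ - 1) 2 := by
  have h1 := (H.memLp_inv_mul H.memH.memLp).const_mul (-1)
  refine (memLp_congr_ae (Eventually.of_forall fun x => ?_)).1 h1
  have := (H.h_pos x).ne'
  field_simp
  ring

/-- The chain rule for `1 / h`: approximate `h - 1` by test functions with the same lower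
bound. -/
theorem hasWeakPartial_inv (H : IsDepth M a b h) (i : Fin d) :
    HasWeakPartial i (fun x => (h x)⁻¹ - 1)
      (fun x => -((h x)⁻¹ * ((h x)⁻¹ * depthPartial h i x))) := by
  have hmem : MemLp (fun x => -((h x)⁻¹ * ((h x)⁻¹ * depthPartial h i x))) 2 :=
    (H.memLp_inv_mul (H.memLp_inv_mul (H.memH_depthPartial i).memLp)).neg
  refine ⟨MemLp.locallyIntegrable_two H.memLp_inv_sub_one, MemLp.locallyIntegrable_two hmem,
    fun ψ hψ => ?_⟩
  have H1 : MemH 1 (fun x => h x - 1) := H.memH.mono (by omega)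
  obtain ⟨η, hη, hlim, hae, hlow⟩ := H1.exists_test_seq
  -- `exists_test_seq` preserves only nonpositive bounds for `h - 1`, whence the minimum with `1`
  set c : ℝ := min a⁻¹ 1
  have hc : 0 < c := lt_min (inv_pos.2 H.pos) one_pos
  have hηc : ∀ n x, c ≤ 1 + η n x := fun n x => by
    have := hlow (c - 1) (by linarith [min_le_right a⁻¹ 1])
      (fun x => by linarith [H.le x, min_le_left a⁻¹ 1]) n x
    linarith
  have hpos : ∀ n x, 0 < 1 + η n x := fun n x => hc.trans_le (hηc n x)
  set G : ℕ → Space d → ℝ := fun n x => (1 + η n x)⁻¹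
  have hGle : ∀ n x, |G n x| ≤ c⁻¹ := fun n x => by
    rw [abs_of_pos (inv_pos.2 (hpos n x))]
    exact inv_anti₀ hc (hηc n x)
  have hhle : ∀ x, |(h x)⁻¹| ≤ c⁻¹ := fun x => by
    rw [abs_of_pos (inv_pos.2 (H.h_pos x))]
    exact inv_anti₀ hc ((min_le_left _ _).trans (H.le x))
  have hGs : ∀ n, ContDiff ℝ 1 (G n) := fun n =>
    (contDiff_const.add (hη n).contDiff_one).inv fun x => (hpos n x).ne'
  have hGd : ∀ n x, partialDeriv i (G n) x = -(G n x ^ 2 * partialDeriv i (η n) x) := by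
    intro n x
    have h1 : HasFDerivAt (fun x => 1 + η n x) (fderiv ℝ (η n) x) x :=
      ((hη n).differentiable x).hasFDerivAt.const_add 1
    have h2 := (hasDerivAt_inv (hpos n x).ne').comp_hasFDerivAt x h1
    unfold partialDeriv
    have e : fderiv ℝ (G n) x = _ := h2.fderiv
    rw [e]
    simp [G]
  have hGlim : ∀ᵐ x, Tendsto (fun n => G n x) atTop (𝓝 (h x)⁻¹) := by
    filter_upwards [hae] with x hx
    have h1 := hx.const_add 1
    simp only [add_sub_cancel] at h1
    exact h1.inv₀ (H.h_pos x).ne'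
  -- the classical identity for the approximations
  have key : ∀ n, ∫ x, (G n x - 1) * partialDeriv i ψ x
      = ∫ x, (G n x ^ 2 * ψ x) * partialDeriv i (η n) x := by
    intro n
    have h1 := ((hasWeakPartial_of_contDiff i (hGs n)).sub
      (hasWeakPartial_const i 1)).integral_eq ψ hψ
    rw [h1, ← integral_neg]
    congr 1
    funext x
    rw [hGd]
    ring
  have l1 : Tendsto (fun n => ∫ x, (G n x - 1) * partialDeriv i ψ x) atTop
      (𝓝 (∫ x, ((h x)⁻¹ - 1) * partialDeriv i ψ x)) := by
    refine tendsto_integral_of_dominated_convergence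
      (fun x => (c⁻¹ + 1) * |partialDeriv i ψ x|) (fun n => ?_) ?_ (fun n => ?_) ?_
    · exact (((hGs n).continuous.sub continuous_const).mul
        (hψ.partialDeriv i).continuous).aestronglyMeasurable
    · exact (((hψ.partialDeriv i).continuous.integrable_of_hasCompactSupport
        (hψ.partialDeriv i).compact).abs).const_mul _
    · refine Eventually.of_forall fun x => ?_
      rw [norm_mul, Real.norm_eq_abs, Real.norm_eq_abs]
      refine mul_le_mul_of_nonneg_right ?_ (abs_nonneg _)
      refine (abs_sub _ _).trans ?_
      rw [abs_one]
      linarith [hGle n x]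
    · filter_upwards [hGlim] with x hx using (hx.sub_const 1).mul_const _
  have hGψ : ∀ n, MemLp (fun x => G n x ^ 2 * ψ x) 2 := fun n =>
    MemLp.bdd_mul_two (hψ.memLp 2) ((hGs n).continuous.pow 2).aestronglyMeasurable
      (B := c⁻¹ ^ 2) (Eventually.of_forall fun x => by
        rw [abs_pow]; exact pow_le_pow_left₀ (abs_nonneg _) (hGle n x) 2)
  have hhψ : MemLp (fun x => (h x)⁻¹ ^ 2 * ψ x) 2 :=
    MemLp.bdd_mul_two (hψ.memLp 2) (H.aesm_inv.pow 2)
      (B := c⁻¹ ^ 2) (Eventually.of_forall fun x => by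
        rw [abs_pow]; exact pow_le_pow_left₀ (abs_nonneg _) (hhle x) 2)
  have l2 : Tendsto (fun n => normH 0 (fun x => G n x ^ 2 * ψ x - (h x)⁻¹ ^ 2 * ψ x)) atTop
      (𝓝 0) := by
    refine tendsto_normH_zero ?_
    have hl := tendsto_integral_of_dominated_convergence
      (F := fun (n : ℕ) x => (G n x ^ 2 * ψ x - (h x)⁻¹ ^ 2 * ψ x) ^ 2) (f := fun _ => (0 : ℝ))
      (μ := volume) (fun x => (2 * c⁻¹ ^ 2) ^ 2 * ψ x ^ 2)
      (fun n => (((hGψ n).1).sub hhψ.1).pow 2)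
      ((hψ.memLp 2).integrable_sq.const_mul _) (fun n => ?_) ?_
    · simpa using hl
    · refine Eventually.of_forall fun x => ?_
      rw [Real.norm_eq_abs, abs_of_nonneg (sq_nonneg _), ← sub_mul, mul_pow]
      refine mul_le_mul_of_nonneg_right ?_ (sq_nonneg _)
      have h1 := pow_le_pow_left₀ (abs_nonneg _) (hGle n x) 2
      have h2 := pow_le_pow_left₀ (abs_nonneg _) (hhle x) 2
      rw [sq_abs] at h1 h2
      refine sq_le_sq' ?_ ?_ <;> nlinarith [sq_nonneg (G n x), sq_nonneg (h x)⁻¹]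
    · filter_upwards [hGlim] with x hx
      have h1 := (((hx.pow 2).mul_const (ψ x)).sub_const ((h x)⁻¹ ^ 2 * ψ x)).pow 2
      simpa using h1
  have l3 := tendsto_integral_mul_mul (fun n => (((hη n).memH 1).weakPartial i).memLp)
    (H1.weakPartial i).memLp hGψ hhψ
    (tendsto_normH_weakPartial (fun n => (hη n).memH 1) H1 hlim i) l2
  have e : ∀ n, ∫ x, (G n x ^ 2 * ψ x) * weakPartial i (η n) x
      = ∫ x, (G n x - 1) * partialDeriv i ψ x := by
    intro n
    rw [key]
    refine integral_congr_ae ?_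
    filter_upwards [(hη n).weakPartial_ae i] with x hx
    rw [hx]
  simp_rw [e] at l3
  rw [tendsto_nhds_unique l1 l3, ← integral_neg]
  congr 1
  funext x
  unfold depthPartial
  ring

theorem memH_one_inv_sub_one (H : IsDepth M a b h) : MemH 1 (fun x => (h x)⁻¹ - 1) :=
  memH_succ H.memLp_inv_sub_one fun i => ⟨_, H.hasWeakPartial_inv i,
    (H.memLp_inv_mul (H.memLp_inv_mul (H.memH_depthPartial i).memLp)).neg⟩

theorem hasWeakPartial_mul (H : IsDepth M a b h) {i : Fin d} {v v' : Space d → ℝ}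
    (hw : HasWeakPartial i v v') (hv : MemLp v 2) (hv' : MemLp v' 2) :
    HasWeakPartial i (fun x => h x * v x) (fun x => h x * v' x + depthPartial h i x * v x) := by
  have h1 := (HasWeakPartial.mul (H.memH.mono (by omega) : MemH 1 _) hw hv hv').add hw
  refine h1.congr (Eventually.of_forall fun x => by ring)
    (Eventually.of_forall fun x => by simp only [depthPartial]; ring)

theorem hasWeakPartial_inv_mul (H : IsDepth M a b h) {i : Fin d} {v v' : Space d → ℝ}
    (hw : HasWeakPartial i v v') (hv : MemLp v 2) (hv' : MemLp v' 2) :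
    HasWeakPartial i (fun x => (h x)⁻¹ * v x)
      (fun x => (h x)⁻¹ * v' x - (h x)⁻¹ * ((h x)⁻¹ * (depthPartial h i x * v x))) := by
  have h1 := (HasWeakPartial.mul H.memH_one_inv_sub_one hw hv hv').add hw
  refine h1.congr (Eventually.of_forall fun x => by ring) ?_
  filter_upwards [(H.hasWeakPartial_inv i).weakPartial_ae] with x hx
  rw [hx]
  ring

end IsDepth

theorem exists_depth_mul_le {M : ℕ} (hd : d = 1 ∨ d = 2) (hM : d ≤ M + 1)
    (a b : ℝ) {j : ℕ} (hj : j ≤ M + 1) :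
    ∃ C, 0 ≤ C ∧ ∀ h v : Space d → ℝ, IsDepth M a b h → MemH j v →
      MemH j (fun x => h x * v x) ∧ normH j (fun x => h x * v x) ≤ C * normH j v := by
  obtain ⟨C, hC0, hC⟩ := exists_normH_mul_le hd hM hj
  refine ⟨C * |b| + 1, by positivity, fun h v H hv => ?_⟩
  have h1 := hC _ v H.memH hv
  have e : (fun x => h x * v x) = fun x => (h x - 1) * v x + v x := by funext x; ring
  rw [e]
  refine ⟨h1.1.add hv, (normH_add_le h1.1 hv).trans ?_⟩
  rw [add_mul, one_mul]
  refine add_le_add (h1.2.trans ?_) le_rfl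
  rw [mul_assoc]
  gcongr
  · exact normH_nonneg _ _
  · exact H.abs_norm_le

theorem exists_depthPartial_mul_le {M : ℕ} (hd : d = 1 ∨ d = 2) (hM : d ≤ M)
    (a b : ℝ) {j : ℕ} (hj : j ≤ M) :
    ∃ C, 0 ≤ C ∧ ∀ h v : Space d → ℝ, IsDepth M a b h → MemH j v → ∀ i,
      MemH j (fun x => depthPartial h i x * v x) ∧
        normH j (fun x => depthPartial h i x * v x) ≤ C * normH j v := by
  obtain ⟨C, hC0, hC⟩ := exists_normH_mul_le hd hM hj
  refine ⟨C * |b|, by positivity, fun h v H hv i => ?_⟩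
  have h1 := hC _ v (H.memH_depthPartial i) hv
  refine ⟨h1.1, h1.2.trans ?_⟩
  rw [mul_assoc]
  gcongr
  · exact normH_nonneg _ _
  · exact H.normH_depthPartial_le i

/-- Multiplication by `∂_i h` with the loss of one derivative of the other factor. This covers the
case `d = 1`, `M = 0`, where `∂_i h` is only in `L²`. -/
theorem exists_depthPartial_mul_le_succ {M : ℕ} (hd : d = 1 ∨ d = 2) (hM : d = 1 ∨ d ≤ M)
    (a b : ℝ) {j : ℕ} (hj : j ≤ M) :
    ∃ C, 0 ≤ C ∧ ∀ h v : Space d → ℝ, IsDepth M a b h → MemH (j + 1) v → ∀ i,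
      MemH j (fun x => depthPartial h i x * v x) ∧
        normH j (fun x => depthPartial h i x * v x) ≤ C * normH (j + 1) v := by
  by_cases hdM : d ≤ M
  · obtain ⟨C, hC0, hC⟩ := exists_depthPartial_mul_le hd hdM a b hj
    refine ⟨C, hC0, fun h v H hv i =>
      ⟨(hC h v H hv.of_succ i).1, (hC h v H hv.of_succ i).2.trans ?_⟩⟩
    gcongr
    exact normH_le_succ j v
  · obtain rfl : d = 1 := hM.resolve_right hdM
    obtain rfl : M = 0 := by omega
    obtain rfl : j = 0 := by omega
    obtain ⟨C, hC0, hC⟩ := exists_normH_mul_le hd le_rfl (Nat.zero_le 1)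
    refine ⟨C * |b|, by positivity, fun h v H hv i => ?_⟩
    have h1 := hC v _ hv (H.memH_depthPartial i)
    simp only [mul_comm (v _)] at h1
    refine ⟨h1.1, h1.2.trans ?_⟩
    rw [mul_assoc, mul_comm (normH (0 + 1) v)]
    gcongr
    · exact normH_nonneg _ _
    · exact H.normH_depthPartial_le i

/-- Division by the depth, from `∂(v / h) = ∂v / h - (∂h v) / h²`. -/
theorem exists_depth_inv_mul_le {M : ℕ} (hd : d = 1 ∨ d = 2) (hM : d = 1 ∨ d ≤ M)
    (a b : ℝ) {j : ℕ} (hj : j ≤ M + 1) :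
    ∃ C, 0 ≤ C ∧ ∀ h v : Space d → ℝ, IsDepth M a b h → MemH j v →
      MemH j (fun x => (h x)⁻¹ * v x) ∧ normH j (fun x => (h x)⁻¹ * v x) ≤ C * normH j v := by
  induction j with
  | zero =>
    refine ⟨|a|, abs_nonneg a, fun h v H hv => ⟨H.memLp_inv_mul hv, ?_⟩⟩
    refine Real.sqrt_le_iff.2 ⟨mul_nonneg (abs_nonneg a) (normH_nonneg _ _), ?_⟩
    rw [mul_pow, normH_zero_sq]
    exact integral_sq_bdd_mul_le hv H.aesm_inv
      (Eventually.of_forall fun x => (H.abs_inv_le x).trans (le_abs_self a))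
  | succ j ih =>
    obtain ⟨C, hC0, hC⟩ := ih (by omega)
    obtain ⟨C', hC0', hC'⟩ := exists_depthPartial_mul_le_succ hd hM a b (by omega : j ≤ M)
    refine ⟨C + ∑ _i : Fin d, (C + C * (C * C')), by positivity, fun h v H hv => ?_⟩
    have hw := fun i => H.hasWeakPartial_inv_mul (hv.hasWeakPartial i) hv.memLp
      (hv.weakPartial i).memLp
    have h0 := hC h v H hv.of_succ
    have h1 := fun i => hC h _ H (hv.weakPartial i)
    have h2 := fun i => hC' h v H hv i
    have h3 := fun i => hC h _ H (h2 i).1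
    have h4 := fun i => hC h _ H (h3 i).1
    refine ⟨⟨h0.1, fun i => ⟨_, hw i, (h1 i).1.sub (h4 i).1⟩⟩, (normH_succ_le _ _).trans ?_⟩
    rw [add_mul, Finset.sum_mul]
    refine add_le_add (h0.2.trans ?_) (Finset.sum_le_sum fun i _ => ?_)
    · gcongr
      exact normH_le_succ j v
    · rw [normH_congr (hw i).weakPartial_ae, add_mul]
      refine (normH_sub_le (h1 i).1 (h4 i).1).trans (add_le_add ((h1 i).2.trans ?_) ?_)
      · gcongr
        exact normH_weakPartial_le j v i
      · rw [mul_assoc, mul_assoc]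
        exact (h4 i).2.trans (mul_le_mul_of_nonneg_left ((h3 i).2.trans
          (mul_le_mul_of_nonneg_left (h2 i).2 hC0)) hC0)

/-! ### The scalar elliptic problem in `H^1` -/

/-- Weak derivatives pass to limits in `L²`. -/
theorem hasWeakPartial_of_tendsto {i : Fin d} {u v : ℕ → Space d → ℝ} {u₀ v₀ : Space d → ℝ}
    (h : ∀ n, HasWeakPartial i (u n) (v n)) (hu : ∀ n, MemLp (u n) 2) (hv : ∀ n, MemLp (v n) 2)
    (hu₀ : MemLp u₀ 2) (hv₀ : MemLp v₀ 2)
    (hlu : Tendsto (fun n => normH 0 (fun x => u n x - u₀ x)) atTop (𝓝 0))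
    (hlv : Tendsto (fun n => normH 0 (fun x => v n x - v₀ x)) atTop (𝓝 0)) :
    HasWeakPartial i u₀ v₀ := by
  refine ⟨MemLp.locallyIntegrable_two hu₀, MemLp.locallyIntegrable_two hv₀, fun φ hφ => ?_⟩
  have h1 := tendsto_integral_mul hu hu₀ ((hφ.partialDeriv i).memLp 2) hlu
  have h2 := (tendsto_integral_mul hv hv₀ (hφ.memLp 2) hlv).neg
  have e : ∀ n, ∫ x, partialDeriv i φ x * u n x = -∫ x, φ x * v n x := by
    intro n
    simp only [mul_comm (partialDeriv i φ _), mul_comm (φ _)]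
    exact (h n).integral_eq φ hφ
  simp_rw [e] at h1
  have := tendsto_nhds_unique h1 h2
  simpa only [mul_comm (partialDeriv i φ _), mul_comm (φ _)] using this

/-- The Riesz representation theorem for a functional which is bounded with respect to
`‖T ·‖`, where `T` has closed range. -/
theorem exists_inner_eq_of_isClosed_range {K E : Type*} [AddCommGroup K] [Module ℝ K]
    [NormedAddCommGroup E] [InnerProductSpace ℝ E] [CompleteSpace E] (T : K →ₗ[ℝ] E)
    (hT : IsClosed (LinearMap.range T : Set E)) (l : K →ₗ[ℝ] ℝ) {C : ℝ}
    (hl : ∀ k, |l k| ≤ C * ‖T k‖) : ∃ k, ∀ z, inner ℝ (T k) (T z) = l z := by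
  have hker : LinearMap.ker T ≤ LinearMap.ker l := by
    intro k hk
    have := hl k
    rw [LinearMap.mem_ker.1 hk, norm_zero, mul_zero] at this
    exact LinearMap.mem_ker.2 (abs_nonpos_iff.1 this)
  let m : LinearMap.range T →ₗ[ℝ] ℝ :=
    ((LinearMap.ker T).liftQ l hker).comp (T.quotKerEquivRange.symm : _ →ₗ[ℝ] _)
  have hm : ∀ k, m (T.rangeRestrict k) = l k := by
    intro k
    have : T.quotKerEquivRange.symm (T.rangeRestrict k) = (LinearMap.ker T).mkQ k := by
      rw [LinearEquiv.symm_apply_eq]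
      rfl
    change (LinearMap.ker T).liftQ l hker (T.quotKerEquivRange.symm (T.rangeRestrict k)) = _
    rw [this]
    rfl
  have hmb : ∀ y, ‖m y‖ ≤ C * ‖y‖ := by
    rintro ⟨_, k, rfl⟩
    have := hm k
    change ‖m (T.rangeRestrict k)‖ ≤ _
    rw [hm]
    exact hl k
  have : CompleteSpace (LinearMap.range T) := hT.completeSpace_coe
  obtain ⟨k, hk⟩ := ((InnerProductSpace.toDual ℝ (LinearMap.range T)).symm
    (m.mkContinuous C hmb)).2
  refine ⟨k, fun z => ?_⟩
  have h := InnerProductSpace.toDual_symm_apply (𝕜 := ℝ) (x := T.rangeRestrict z)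
    (y := m.mkContinuous C hmb)
  rw [LinearMap.mkContinuous_apply, hm] at h
  rw [← h, Submodule.coe_inner, ← hk]
  rfl

/-- The bilinear form `∫ w p z + μ ∑ i, γ_i² ∫ w ∂_i p ∂_i z`. -/
noncomputable def ellipticForm (w : Space d → ℝ) (μ γ : ℝ) (p z : Space d → ℝ) : ℝ :=
  (∫ x, w x * p x * z x) +
    μ * ∑ i, gammaCoeff γ i ^ 2 * ∫ x, w x * weakPartial i p x * weakPartial i z x

theorem gammaCoeff_pos {γ : ℝ} (hγ : 0 < γ) (i : Fin d) : 0 < gammaCoeff γ i := by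
  unfold gammaCoeff
  split_ifs <;> positivity

theorem gammaCoeff_le (γ : ℝ) (i : Fin d) : gammaCoeff γ i ≤ max 1 γ := by
  unfold gammaCoeff
  split_ifs
  · exact le_max_left _ _
  · exact le_max_right _ _

theorem le_gammaCoeff (γ : ℝ) (i : Fin d) : min 1 γ ≤ gammaCoeff γ i := by
  unfold gammaCoeff
  split_ifs
  · exact min_le_left _ _
  · exact min_le_right _ _

theorem inner_toLp {u v : Space d → ℝ} (hu : MemLp u 2) (hv : MemLp v 2) :
    inner ℝ hu.toLp hv.toLp = ∫ x, u x * v x := by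
  rw [L2.inner_def]
  refine integral_congr_ae ?_
  filter_upwards [hu.coeFn_toLp, hv.coeFn_toLp] with x h1 h2
  rw [h1, h2]
  simp [mul_comm]

theorem norm_toLp_sub {u : Space d → ℝ} (hu : MemLp u 2) (y : Lp ℝ 2 (volume : Measure (Space d))) :
    ‖(hu.toLp u : Lp ℝ 2 (volume : Measure (Space d))) - y‖ = normH 0 (fun x => u x - y x) := by
  have hy : MemLp y 2 volume := Lp.memLp y
  have h1 : MemLp (fun x => u x - y x) 2 := MeasureTheory.MemLp.sub hu hy
  have h2 : hu.toLp - y = h1.toLp := by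
    refine Lp.ext ?_
    filter_upwards [Lp.coeFn_sub hu.toLp y, hu.coeFn_toLp, h1.coeFn_toLp] with x e1 e2 e3
    rw [e1, e3, Pi.sub_apply, e2]
  rw [h2, Lp.norm_toLp, eLpNorm_two_eq h1, ENNReal.toReal_ofReal (normH_nonneg _ _)]

/-- The weights of the components `(z, ∂_i z)` whose squares appear in `ellipticForm`. -/
noncomputable def formWeight (w : Space d → ℝ) (μ γ : ℝ) (o : Option (Fin d)) (x : Space d) : ℝ :=
  √(w x) * o.elim 1 fun i => √μ * gammaCoeff γ i

/-- The components `(z, ∂_i z)`; `none` is the index of `z` itself. -/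
noncomputable def formComponent (z : Space d → ℝ) (o : Option (Fin d)) : Space d → ℝ :=
  o.elim z fun i => weakPartial i z

theorem memLp_formComponent {z : Space d → ℝ} (hz : MemH 1 z) (o : Option (Fin d)) :
    MemLp (formComponent z o) 2 := by
  cases o with
  | none => exact hz.memLp
  | some i => exact (hz.weakPartial i).memLp

theorem formComponent_add_ae {z z' : Space d → ℝ} (hz : MemH 1 z) (hz' : MemH 1 z')
    (o : Option (Fin d)) : formComponent (fun x => z x + z' x) o =ᵐ[volume]
      fun x => formComponent z o x + formComponent z' o x := by
  cases o with
  | none => exact ae_eq_refl _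
  | some i => exact weakPartial_add_ae hz hz' i

theorem formComponent_const_mul_ae {z : Space d → ℝ} (hz : MemH 1 z) (c : ℝ)
    (o : Option (Fin d)) : formComponent (fun x => c * z x) o =ᵐ[volume]
      fun x => c * formComponent z o x := by
  cases o with
  | none => exact ae_eq_refl _
  | some i => exact weakPartial_const_mul_ae hz c i

theorem normH_formComponent_sq (z : Space d → ℝ) :
    ∑ o, normH 0 (formComponent z o) ^ 2 = normH 1 z ^ 2 := by
  rw [Fintype.sum_option]
  simp only [normH_sq]
  rfl

/-- The space `H^1` as a space of functions, not of classes modulo null sets. -/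
def sobolevOne (d : ℕ) : Submodule ℝ (Space d → ℝ) where
  carrier := {z | MemH 1 z}
  add_mem' h h' := MemH.add h h'
  zero_mem' := MemH.zero
  smul_mem' c _ h := MemH.const_mul h c

section LaxMilgram

variable {w : Space d → ℝ} {w₀ w₁ μ γ : ℝ}

theorem abs_formWeight_le (h1 : ∀ᵐ x, w x ≤ w₁) (hγ : 0 < γ) (o : Option (Fin d)) :
    ∀ᵐ x, |formWeight w μ γ o x| ≤ √w₁ * (1 + √μ * max 1 γ) := by
  filter_upwards [h1] with x hx
  have hm : (0 : ℝ) ≤ max 1 γ := by positivity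
  unfold formWeight
  rw [abs_mul, abs_of_nonneg (Real.sqrt_nonneg _)]
  refine mul_le_mul (Real.sqrt_le_sqrt hx) ?_ (abs_nonneg _) (Real.sqrt_nonneg _)
  cases o with
  | none =>
    simp only [Option.elim_none, abs_one, le_add_iff_nonneg_right]
    positivity
  | some i =>
    simp only [Option.elim_some]
    rw [abs_of_nonneg (mul_nonneg (Real.sqrt_nonneg _) (gammaCoeff_pos hγ i).le)]
    have := mul_le_mul_of_nonneg_left (gammaCoeff_le γ i) (Real.sqrt_nonneg μ)
    linarith

theorem formWeight_pos (hw₀ : 0 < w₀) (h0 : ∀ᵐ x, w₀ ≤ w x) (hμ : 0 < μ) (hγ : 0 < γ) :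
    ∃ s, 0 < s ∧ ∀ o, ∀ᵐ x, s ≤ formWeight w μ γ (d := d) o x := by
  have hm : 0 < min 1 γ := lt_min one_pos hγ
  have hμ' := Real.sqrt_pos.2 hμ
  refine ⟨√w₀ * min 1 (√μ * min 1 γ), mul_pos (Real.sqrt_pos.2 hw₀)
    (lt_min one_pos (by positivity)), fun o => ?_⟩
  filter_upwards [h0] with x hx
  unfold formWeight
  refine mul_le_mul (Real.sqrt_le_sqrt hx) ?_ (le_min zero_le_one (mul_pos hμ' hm).le)
    (Real.sqrt_nonneg _)
  cases o with
  | none => exact min_le_left _ _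
  | some i =>
    exact (min_le_right _ _).trans
      (mul_le_mul_of_nonneg_left (le_gammaCoeff γ i) hμ'.le)

theorem aesm_formWeight (hw : AEStronglyMeasurable w) (o : Option (Fin d)) :
    AEStronglyMeasurable (formWeight w μ γ o) :=
  (hw.aemeasurable.sqrt.aestronglyMeasurable).mul_const _

theorem ellipticForm_eq_sum (hw₀ : 0 < w₀) (h0 : ∀ᵐ x, w₀ ≤ w x) (hμ : 0 < μ)
    (p z : Space d → ℝ) : ellipticForm w μ γ p z = ∑ o, ∫ x,
      (formWeight w μ γ o x * formComponent p o x) *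
        (formWeight w μ γ o x * formComponent z o x) := by
  unfold ellipticForm
  rw [Fintype.sum_option, Finset.mul_sum]
  congr 1
  · refine integral_congr_ae ?_
    filter_upwards [h0] with x hx
    have := Real.mul_self_sqrt (hw₀.le.trans hx)
    simp only [formWeight, formComponent, Option.elim_none]
    linear_combination (-(p x * z x)) * this
  · refine Finset.sum_congr rfl fun i _ => ?_
    rw [← integral_const_mul, ← integral_const_mul]
    refine integral_congr_ae ?_
    filter_upwards [h0] with x hx
    have h1 := Real.mul_self_sqrt (hw₀.le.trans hx)
    have h2 := Real.mul_self_sqrt hμ.le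
    simp only [formWeight, formComponent, Option.elim_some]
    linear_combination (-(μ * gammaCoeff γ i ^ 2 * weakPartial i p x * weakPartial i z x)) * h1
      - √(w x) * √(w x) * gammaCoeff γ i ^ 2 * weakPartial i p x * weakPartial i z x * h2

/-- The Lax–Milgram theorem for the elliptic form with a weight bounded above and below. The form
is the inner product of `L²(ℝ^d)^{1+d}` pulled back along `T z = (√w z, √(w μ) γ_i ∂_i z)`, and `T`
has closed range since weak derivatives pass to limits in `L²`. -/
theorem exists_ellipticForm_eq (hw : AEStronglyMeasurable w) (hw₀ : 0 < w₀)
    (h0 : ∀ᵐ x, w₀ ≤ w x) (h1 : ∀ᵐ x, w x ≤ w₁) (hμ : 0 < μ) (hγ : 0 < γ)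
    (l : (Space d → ℝ) → ℝ)
    (hadd : ∀ z z', MemH 1 z → MemH 1 z' → l (fun x => z x + z' x) = l z + l z')
    (hsmul : ∀ (c : ℝ) z, MemH 1 z → l (fun x => c * z x) = c * l z) {C : ℝ}
    (hl : ∀ z, MemH 1 z → |l z| ≤ C * normH 1 z) :
    ∃ p, MemH 1 p ∧ ∀ z, MemH 1 z → ellipticForm w μ γ p z = l z := by
  obtain ⟨s, hs, hsw⟩ := formWeight_pos (d := d) hw₀ h0 hμ hγ
  have hbd := fun o => abs_formWeight_le (d := d) (μ := μ) h1 hγ o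
  have hmem : ∀ z : sobolevOne d, ∀ o,
      MemLp (fun x => formWeight w μ γ o x * formComponent (z : Space d → ℝ) o x) 2 :=
    fun z o => MemLp.bdd_mul_two (memLp_formComponent z.2 o) (aesm_formWeight hw o) (hbd o)
  let T : sobolevOne d →ₗ[ℝ]
      PiLp 2 (fun _ : Option (Fin d) => Lp ℝ 2 (volume : Measure (Space d))) :=
    { toFun := fun z => WithLp.toLp 2 fun o => (hmem z o).toLp
      map_add' := by
        intro z z'
        ext1 o
        change (hmem (z + z') o).toLp = (hmem z o).toLp + (hmem z' o).toLp
        rw [← MemLp.toLp_add]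
        refine MemLp.toLp_congr _ _ ?_
        filter_upwards [formComponent_add_ae z.2 z'.2 o] with x hx
        change formWeight w μ γ o x * formComponent (fun x => (z : Space d → ℝ) x + z'.1 x) o x = _
        rw [hx]
        simp [mul_add]
      map_smul' := by
        intro c z
        ext1 o
        change (hmem (c • z) o).toLp = c • (hmem z o).toLp
        rw [← MemLp.toLp_const_smul]
        refine MemLp.toLp_congr _ _ ?_
        filter_upwards [formComponent_const_mul_ae z.2 c o] with x hx
        change formWeight w μ γ o x * formComponent (fun x => c * (z : Space d → ℝ) x) o x = _
        rw [hx]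
        simp
        ring }
  have hTo : ∀ z o, T z o = (hmem z o).toLp := fun z o => rfl
  -- division by the weight, which is at least `s`, is bounded
  have hcomp : ∀ (o : Option (Fin d)) (u v : Space d → ℝ) (hu : MemLp u 2)
      (hv : MemLp (fun x => formWeight w μ γ o x * u x - v x) 2),
      normH 0 (fun x => u x - (formWeight w μ γ o x)⁻¹ * v x)
        ≤ s⁻¹ * normH 0 (fun x => formWeight w μ γ o x * u x - v x) := by
    intro o u v hu hv
    have e : (fun x => u x - (formWeight w μ γ o x)⁻¹ * v x) =ᵐ[volume]
        fun x => (formWeight w μ γ o x)⁻¹ * (formWeight w μ γ o x * u x - v x) := by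
      filter_upwards [hsw o] with x hx
      have := (hs.trans_le hx).ne'
      field_simp
    rw [normH_congr e]
    refine Real.sqrt_le_iff.2 ⟨mul_nonneg (inv_pos.2 hs).le (normH_nonneg _ _), ?_⟩
    rw [mul_pow, normH_zero_sq]
    refine integral_sq_bdd_mul_le hv (aesm_formWeight hw o).aemeasurable.inv.aestronglyMeasurable ?_
    filter_upwards [hsw o] with x hx
    rw [Pi.inv_apply, abs_of_pos (inv_pos.2 (hs.trans_le hx))]
    exact inv_anti₀ hs hx
  have hclosed : IsClosed (LinearMap.range T :
      Set (PiLp 2 (fun _ : Option (Fin d) => Lp ℝ 2 (volume : Measure (Space d))))) := by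
    refine IsSeqClosed.isClosed fun y y₀ hy hlim => ?_
    choose z hz using hy
    have hlo : ∀ o, Tendsto (fun n => normH 0 (fun x =>
        formWeight w μ γ o x * formComponent (z n : Space d → ℝ) o x - y₀ o x)) atTop (𝓝 0) := by
      intro o
      have h2 : Tendsto (fun n => y n o) atTop (𝓝 (y₀ o)) :=
        ((PiLp.continuous_apply 2 _ o).tendsto y₀).comp hlim
      rw [tendsto_iff_norm_sub_tendsto_zero] at h2
      refine h2.congr fun n => ?_
      rw [← hz n, hTo, norm_toLp_sub]
    set u : Option (Fin d) → Space d → ℝ := fun o x => (formWeight w μ γ o x)⁻¹ * y₀ o x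
    have hu : ∀ o, MemLp (u o) 2 := fun o =>
      MemLp.bdd_mul_two (Lp.memLp (y₀ o))
        (aesm_formWeight hw o).aemeasurable.inv.aestronglyMeasurable (B := s⁻¹) (by
          filter_upwards [hsw o] with x hx
          rw [abs_of_pos (inv_pos.2 (hs.trans_le hx))]
          exact inv_anti₀ hs hx)
    have hlu : ∀ o, Tendsto (fun n => normH 0 (fun x =>
        formComponent (z n : Space d → ℝ) o x - u o x)) atTop (𝓝 0) := by
      intro o
      have h2 := (hlo o).const_mul s⁻¹
      rw [mul_zero] at h2
      refine squeeze_zero (fun n => normH_nonneg _ _) (fun n => ?_) h2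
      exact hcomp o _ (fun x => y₀ o x) (memLp_formComponent (z n).2 o)
        ((hmem (z n) o).sub (Lp.memLp (y₀ o)))
    have hw' : ∀ i, HasWeakPartial i (u none) (u (some i)) := fun i =>
      hasWeakPartial_of_tendsto (fun n => (z n).2.hasWeakPartial i) (fun n => (z n).2.memLp)
        (fun n => ((z n).2.weakPartial i).memLp) (hu none) (hu (some i)) (hlu none) (hlu (some i))
    have hu1 : MemH 1 (u none) := memH_succ (hu none) fun i => ⟨_, hw' i, hu (some i)⟩
    refine ⟨⟨u none, hu1⟩, ?_⟩
    ext1 o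
    rw [hTo]
    have e : y₀ o = (Lp.memLp (y₀ o)).toLp := (Lp.toLp_coeFn _ _).symm
    rw [e]
    refine MemLp.toLp_congr _ _ ?_
    have e2 : formComponent (u none) o =ᵐ[volume] u o := by
      cases o with
      | none => exact ae_eq_refl _
      | some i => exact (hw' i).weakPartial_ae
    filter_upwards [e2, hsw o] with x hx hx'
    have := (hs.trans_le hx').ne'
    simp only [hx, u]
    field_simp
  have hTnorm : ∀ z : sobolevOne d, normH 1 (z : Space d → ℝ) ≤ s⁻¹ * ‖T z‖ := by
    intro z
    refine abs_le_of_sq_le_sq ?_ (mul_nonneg (inv_pos.2 hs).le (norm_nonneg _)) |>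
      (le_abs_self _).trans
    rw [← normH_formComponent_sq, mul_pow, PiLp.norm_sq_eq_of_L2, Finset.mul_sum]
    refine Finset.sum_le_sum fun o _ => ?_
    have h2 := hcomp o (formComponent (z : Space d → ℝ) o) (fun _ => 0)
      (memLp_formComponent z.2 o) (by simpa using hmem z o)
    have h3 : ‖T z o‖ =
        normH 0 (fun x => formWeight w μ γ o x * formComponent (z : Space d → ℝ) o x) := by
      rw [hTo, Lp.norm_toLp, eLpNorm_two_eq (hmem z o), ENNReal.toReal_ofReal (normH_nonneg _ _)]
    simp only [mul_zero, sub_zero] at h2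
    rw [h3, ← mul_pow]
    exact pow_le_pow_left₀ (normH_nonneg _ _) h2 2
  let L : sobolevOne d →ₗ[ℝ] ℝ :=
    { toFun := fun z => l z
      map_add' := fun z z' => hadd z z' z.2 z'.2
      map_smul' := fun c z => hsmul c z z.2 }
  obtain ⟨p, hp⟩ := exists_inner_eq_of_isClosed_range T hclosed L (C := |C| * s⁻¹) (fun z => by
    refine (hl z z.2).trans ?_
    rw [mul_assoc]
    exact mul_le_mul (le_abs_self C) (hTnorm z) (normH_nonneg _ _) (abs_nonneg _))
  refine ⟨p, p.2, fun z hz => ?_⟩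
  have h2 := hp ⟨z, hz⟩
  rw [PiLp.inner_apply] at h2
  rw [ellipticForm_eq_sum hw₀ h0 hμ]
  refine Eq.trans (Finset.sum_congr rfl fun o _ => ?_) h2
  rw [hTo, hTo, inner_toLp]

end LaxMilgram

/-! ### The scalar elliptic equation -/

section EllipticEquation

variable {M : ℕ} {a b : ℝ} {h : Space d → ℝ} {μ γ : ℝ} {r p : Space d → ℝ} {F : Field d}

/-- `p ∈ H^1` is a weak solution of `h p - μ ∇^γ·(h ∇^γ p) = r + ∇^γ·F`. -/
structure IsEllipticSolution (h : Space d → ℝ) (μ γ : ℝ) (r : Space d → ℝ) (F : Field d)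
    (p : Space d → ℝ) : Prop where
  memH : MemH 1 p
  eq : ∀ φ : Space d → ℝ, IsTest φ → (∫ x, (h x * p x - r x) * φ x) +
    ∑ i, ∫ x, (μ * gammaCoeff γ i ^ 2 * (h x * weakPartial i p x) + gammaCoeff γ i * F i x)
      * partialDeriv i φ x = 0

theorem memLp_flux (hd : d = 1 ∨ d = 2) (hM : d ≤ M + 1) (H : IsDepth M a b h) (hp : MemH 1 p)
    (hF : ∀ i, MemLp (F i) 2) (c c' : ℝ) (i : Fin d) :
    MemLp (fun x => c * (h x * weakPartial i p x) + c' * F i x) 2 :=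
  ((H.memLp_mul hd hM (hp.weakPartial i).memLp).const_mul c).add ((hF i).const_mul c')

/-- The equation may be tested with functions in `H^1`. -/
theorem IsEllipticSolution.eq_of_memH (hd : d = 1 ∨ d = 2) (hM : d ≤ M + 1) (H : IsDepth M a b h)
    (hr : MemLp r 2) (hF : ∀ i, MemLp (F i) 2) (hs : IsEllipticSolution h μ γ r F p)
    {z : Space d → ℝ} (hz : MemH 1 z) : (∫ x, (h x * p x - r x) * z x) +
    ∑ i, ∫ x, (μ * gammaCoeff γ i ^ 2 * (h x * weakPartial i p x) + gammaCoeff γ i * F i x)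
      * weakPartial i z x = 0 :=
  integral_add_sum_eq_zero_of_test ((H.memLp_mul hd hM hs.memH.memLp).sub hr)
    (fun i => memLp_flux hd hM H hs.memH hF _ _ i) hs.eq hz

/-- The weak form of the equation, split into the elliptic form and the data. -/
theorem residual_eq (hd : d = 1 ∨ d = 2) (hM : d ≤ M + 1) (H : IsDepth M a b h)
    (hr : MemLp r 2) (hF : ∀ i, MemLp (F i) 2) (hp : MemH 1 p) {z : Space d → ℝ} (hz : MemH 1 z) :
    (∫ x, (h x * p x - r x) * z x) +
    ∑ i, ∫ x, (μ * gammaCoeff γ i ^ 2 * (h x * weakPartial i p x) + gammaCoeff γ i * F i x)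
      * weakPartial i z x
    = ellipticForm h μ γ p z -
      ((∫ x, r x * z x) - ∑ i, gammaCoeff γ i * ∫ x, F i x * weakPartial i z x) := by
  unfold ellipticForm
  have e1 : ∫ x, (h x * p x - r x) * z x = (∫ x, h x * p x * z x) - ∫ x, r x * z x := by
    simp only [sub_mul]
    exact integral_sub (MemLp.integrable_mul_two (H.memLp_mul hd hM hp.memLp) hz.memLp)
      (MemLp.integrable_mul_two hr hz.memLp)
  have e2 : ∀ i, ∫ x, (μ * gammaCoeff γ i ^ 2 * (h x * weakPartial i p x) + gammaCoeff γ i * F i x)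
      * weakPartial i z x = μ * (gammaCoeff γ i ^ 2 * ∫ x, h x * weakPartial i p x
        * weakPartial i z x) + gammaCoeff γ i * ∫ x, F i x * weakPartial i z x := by
    intro i
    rw [← integral_const_mul, ← integral_const_mul, ← integral_const_mul, ← integral_add]
    · congr 1
      funext x
      ring
    · exact ((MemLp.integrable_mul_two (H.memLp_mul hd hM (hp.weakPartial i).memLp)
        (hz.weakPartial i).memLp).const_mul _).const_mul _
    · exact (MemLp.integrable_mul_two (hF i) (hz.weakPartial i).memLp).const_mul _
  rw [e1, Finset.sum_congr rfl fun i _ => e2 i, Finset.sum_add_distrib, ← Finset.mul_sum]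
  ring

theorem exists_isEllipticSolution (hd : d = 1 ∨ d = 2) (hM : d ≤ M + 1) (H : IsDepth M a b h)
    (hμ : 0 < μ) (hγ : 0 < γ) (hr : MemLp r 2) (hF : ∀ i, MemLp (F i) 2) :
    ∃ p, IsEllipticSolution h μ γ r F p := by
  have key := exists_ellipticForm_eq (w₁ := 1 + 2 * |b|) H.aesm (inv_pos.2 H.pos)
    (Eventually.of_forall H.le) (by filter_upwards [H.ae_le hd hM] with x hx
                                    exact (le_abs_self _).trans hx) hμ hγ
    (fun z => (∫ x, r x * z x) - ∑ i, gammaCoeff γ i * ∫ x, F i x * weakPartial i z x)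
    (C := normH 0 r + ∑ i, gammaCoeff γ i * normH 0 (F i))
  refine Exists.elim (key (fun z z' hz hz' => ?_) (fun c z hz => ?_) (fun z hz => ?_)) ?_
  · have e1 : ∫ x, r x * (z x + z' x) = (∫ x, r x * z x) + ∫ x, r x * z' x := by
      simp only [mul_add]
      exact integral_add (MemLp.integrable_mul_two hr hz.memLp)
        (MemLp.integrable_mul_two hr hz'.memLp)
    have e2 : ∀ i, ∫ x, F i x * weakPartial i (fun x => z x + z' x) x
        = (∫ x, F i x * weakPartial i z x) + ∫ x, F i x * weakPartial i z' x := by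
      intro i
      rw [← integral_add (MemLp.integrable_mul_two (hF i) (hz.weakPartial i).memLp)
        (MemLp.integrable_mul_two (hF i) (hz'.weakPartial i).memLp)]
      refine integral_congr_ae ?_
      filter_upwards [weakPartial_add_ae hz hz' i] with x hx
      rw [hx, mul_add]
    simp only [e2]
    rw [e1]
    simp only [mul_add, Finset.sum_add_distrib]
    ring
  · have e1 : ∫ x, r x * (c * z x) = c * ∫ x, r x * z x := by
      rw [← integral_const_mul]
      congr 1; funext x; ring
    have e2 : ∀ i, ∫ x, F i x * weakPartial i (fun x => c * z x) x
        = c * ∫ x, F i x * weakPartial i z x := by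
      intro i
      rw [← integral_const_mul]
      refine integral_congr_ae ?_
      filter_upwards [weakPartial_const_mul_ae hz c i] with x hx
      rw [hx]; ring
    simp only [e1, e2, mul_sub, Finset.mul_sum]
    congr 1
    exact Finset.sum_congr rfl fun i _ => by ring
  · refine (abs_sub _ _).trans ?_
    rw [add_mul, Finset.sum_mul]
    refine add_le_add ?_ ((Finset.abs_sum_le_sum_abs _ _).trans (Finset.sum_le_sum fun i _ => ?_))
    · exact (abs_integral_mul_le_normH hr hz.memLp).trans
        (mul_le_mul_of_nonneg_left (normH_le_succ 0 z) (normH_nonneg _ _))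
    · rw [abs_mul, abs_of_pos (gammaCoeff_pos hγ i), mul_assoc]
      exact mul_le_mul_of_nonneg_left ((abs_integral_mul_le_normH (hF i)
        (hz.weakPartial i).memLp).trans (mul_le_mul_of_nonneg_left (normH_weakPartial_le 0 z i)
          (normH_nonneg _ _))) (gammaCoeff_pos hγ i).le
  · rintro p ⟨hp, hpz⟩
    refine ⟨p, hp, fun φ hφ => ?_⟩
    have h1 := residual_eq (μ := μ) (γ := γ) hd hM H hr hF hp (hφ.memH 1)
    rw [hpz φ (hφ.memH 1), sub_self] at h1
    rw [← h1]
    congr 1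
    refine Finset.sum_congr rfl fun i _ => integral_congr_ae ?_
    filter_upwards [hφ.weakPartial_ae i] with x hx
    rw [hx]

/-- The size `|p|_{H^n} + √μ |∇^γ p|_{H^n}` of a solution. With these weights the estimates are
uniform in `μ` and `γ`. -/
noncomputable def solSize (μ γ : ℝ) (n : ℕ) (p : Space d → ℝ) : ℝ :=
  normH n p + ∑ i, √μ * gammaCoeff γ i * normH n (weakPartial i p)

/-- The size `|r|_{H^n} + |F|_{H^n} / √μ` of the data. -/
noncomputable def dataSize (μ : ℝ) (n : ℕ) (r : Space d → ℝ) (F : Field d) : ℝ :=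
  normH n r + ∑ i, (√μ)⁻¹ * normH n (F i)

theorem normH_le_solSize (hγ : 0 < γ) (n : ℕ) (p : Space d → ℝ) : normH n p ≤ solSize μ γ n p :=
  le_add_of_nonneg_right (Finset.sum_nonneg fun i _ => by
    have := gammaCoeff_pos hγ i
    have := normH_nonneg n (weakPartial i p)
    positivity)

theorem normH_weakPartial_le_solSize (hγ : 0 < γ) (n : ℕ) (p : Space d → ℝ) (i : Fin d) :
    √μ * gammaCoeff γ i * normH n (weakPartial i p) ≤ solSize μ γ n p := by
  refine (Finset.single_le_sum (f := fun i => √μ * gammaCoeff γ i * normH n (weakPartial i p))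
    (fun i _ => ?_) (Finset.mem_univ i)).trans (le_add_of_nonneg_left (normH_nonneg _ _))
  have := gammaCoeff_pos hγ i
  have := normH_nonneg n (weakPartial i p)
  positivity

/-- The energy estimate: test the equation with the solution. -/
theorem IsEllipticSolution.energy (hd : d = 1 ∨ d = 2) (hM : d ≤ M + 1) (H : IsDepth M a b h)
    (hμ : 0 < μ) (hγ : 0 < γ) (hr : MemLp r 2) (hF : ∀ i, MemLp (F i) 2)
    (hs : IsEllipticSolution h μ γ r F p) :
    solSize μ γ 0 p ≤ (d + 1) * a * dataSize μ 0 r F := by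
  have h0 := hs.eq_of_memH hd hM H hr hF hs.memH
  rw [residual_eq hd hM H hr hF hs.memH hs.memH] at h0
  have hlow : ∀ u : Space d → ℝ, MemLp u 2 → a⁻¹ * normH 0 u ^ 2 ≤ ∫ x, h x * u x * u x := by
    intro u hu
    rw [normH_zero_sq, ← integral_const_mul]
    refine integral_mono (hu.integrable_sq.const_mul _)
      (MemLp.integrable_mul_two (H.memLp_mul hd hM hu) hu) fun x => ?_
    have := mul_le_mul_of_nonneg_right (H.le x) (sq_nonneg (u x))
    simp only
    linarith [this, sq (u x)]
  set P := normH 0 p with hP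
  set D : Fin d → ℝ := fun i => √μ * gammaCoeff γ i * normH 0 (weakPartial i p) with hD
  set R := normH 0 r with hR
  set G : Fin d → ℝ := fun i => (√μ)⁻¹ * normH 0 (F i) with hG
  have hP0 : 0 ≤ P := normH_nonneg _ _
  have hR0 : 0 ≤ R := normH_nonneg _ _
  have hsμ := Real.sqrt_pos.2 hμ
  have hD0 : ∀ i, 0 ≤ D i := fun i => by
    have := gammaCoeff_pos hγ i
    have := normH_nonneg 0 (weakPartial i p)
    positivity
  have hG0 : ∀ i, 0 ≤ G i := fun i => by
    have := normH_nonneg 0 (F i)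
    positivity
  have hform : a⁻¹ * (P ^ 2 + ∑ i, D i ^ 2) ≤ ellipticForm h μ γ p p := by
    unfold ellipticForm
    rw [mul_add, Finset.mul_sum, Finset.mul_sum]
    refine add_le_add (hlow p hs.memH.memLp) (Finset.sum_le_sum fun i _ => ?_)
    have h1 := hlow _ (hs.memH.weakPartial i).memLp
    have h2 : D i ^ 2 = μ * gammaCoeff γ i ^ 2 * normH 0 (weakPartial i p) ^ 2 := by
      simp only [hD, mul_pow, Real.sq_sqrt hμ.le]
    rw [h2, ← mul_assoc μ]
    calc _ = μ * gammaCoeff γ i ^ 2 * (a⁻¹ * normH 0 (weakPartial i p) ^ 2) := by ring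
      _ ≤ _ := by gcongr
  have hrhs : (∫ x, r x * p x) - ∑ i, gammaCoeff γ i * ∫ x, F i x * weakPartial i p x
      ≤ R * P + ∑ i, G i * D i := by
    have h1 := (abs_le.1 (abs_integral_mul_le_normH hr hs.memH.memLp)).2
    rw [sub_eq_add_neg, ← Finset.sum_neg_distrib]
    refine add_le_add h1 (Finset.sum_le_sum fun i _ => ?_)
    have h2 := (abs_le.1 (abs_integral_mul_le_normH (hF i) (hs.memH.weakPartial i).memLp)).1
    have h3 : G i * D i = gammaCoeff γ i * (normH 0 (F i) * normH 0 (weakPartial i p)) := by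
      simp only [hG, hD]
      field_simp
    rw [h3, ← mul_neg]
    exact mul_le_mul_of_nonneg_left (by linarith) (gammaCoeff_pos hγ i).le
  set SD := ∑ i, D i
  set SG := ∑ i, G i
  have hSD : 0 ≤ SD := Finset.sum_nonneg fun i _ => hD0 i
  have hSG : 0 ≤ SG := Finset.sum_nonneg fun i _ => hG0 i
  have hcs : SD ^ 2 ≤ d * ∑ i, D i ^ 2 := by
    simpa using sq_sum_le_card_mul_sum_sq (s := (Finset.univ : Finset (Fin d))) (f := D)
  have hGD : ∑ i, G i * D i ≤ SG * SD := by
    rw [Finset.sum_mul]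
    refine Finset.sum_le_sum fun i _ => mul_le_mul_of_nonneg_left ?_ (hG0 i)
    exact Finset.single_le_sum (fun i _ => hD0 i) (Finset.mem_univ i)
  have hS2 : 0 ≤ ∑ i, D i ^ 2 := Finset.sum_nonneg fun i _ => sq_nonneg _
  have hd0 : (0 : ℝ) ≤ d := Nat.cast_nonneg d
  -- `(P + SD)² ≤ (d + 1) (P² + ∑ D²)`
  have hsq : (P + SD) ^ 2 ≤ (d + 1) * (P ^ 2 + ∑ i, D i ^ 2) := by
    rcases hd0.eq_or_lt with hz | hpos
    · rw [← hz] at hcs ⊢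
      have : SD = 0 := by nlinarith
      rw [this]; nlinarith
    · have h2 : 2 * P * SD ≤ d * P ^ 2 + SD ^ 2 / d := by
        have : 0 ≤ (d * P - SD) ^ 2 / d := by positivity
        have e : (d * P - SD) ^ 2 / d = d * P ^ 2 - 2 * P * SD + SD ^ 2 / d := by
          field_simp
          ring
        linarith
      have h3 : SD ^ 2 / d ≤ ∑ i, D i ^ 2 := by
        rw [div_le_iff₀ hpos]; linarith
      nlinarith
  have hmain : a⁻¹ * (P ^ 2 + ∑ i, D i ^ 2) ≤ (R + SG) * (P + SD) := by
    have : R * P + SG * SD ≤ (R + SG) * (P + SD) := by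
      nlinarith [mul_nonneg hR0 hSD, mul_nonneg hSG hP0]
    linarith
  have hfin : (P + SD) ^ 2 ≤ ((d + 1) * a * (R + SG)) * (P + SD) := by
    have h1 := mul_le_mul_of_nonneg_left hmain H.pos.le
    rw [← mul_assoc, mul_inv_cancel₀ H.pos.ne', one_mul] at h1
    have h2 := mul_le_mul_of_nonneg_left h1 (by positivity : (0 : ℝ) ≤ d + 1)
    linarith
  change P + SD ≤ (d + 1) * a * (R + SG)
  rcases (add_nonneg hP0 hSD).eq_or_lt with hz | hpos
  · rw [← hz]
    have := H.pos
    positivity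
  · rw [sq] at hfin
    exact le_of_mul_le_mul_right hfin hpos

/-- The constant depth; it makes the results for variable depth available for constant
coefficients. -/
theorem isDepth_one : IsDepth (d := d) M 1 0 (fun _ => 1) where
  pos := one_pos
  memH := by simpa using MemH.zero
  norm_le := by simp [normH_zero]
  le := by simp

/-- Uniqueness of very weak solutions of the constant coefficient equation: convolution with a
mollifier gives a solution in `H^1`, which vanishes by the energy estimate. -/
theorem ae_eq_zero_of_very_weak (hd : d = 1 ∨ d = 2) (hμ : 0 < μ) (hγ : 0 < γ)
    {w : Space d → ℝ} (hw : MemLp w 2)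
    (h : ∀ φ, IsTest φ → (∫ x, w x * φ x) -
      ∑ i, μ * gammaCoeff γ i ^ 2 * ∫ x, w x * partialDeriv i (partialDeriv i φ) x = 0) :
    w =ᵐ[volume] 0 := by
  have hli := MemLp.locallyIntegrable_two hw
  refine ae_eq_zero_of_integral_sq_nonpos hw (le_of_forall_pos_le_add fun ε hε => ?_)
  obtain ⟨δ, hδ, hmol⟩ := exists_integral_sq_mollify_sub_le hw hε
  obtain ⟨ρ, hρ⟩ := exists_isMollifier (d := d) hδ
  have hm : MemLp (mollify ρ w) 2 := hρ.test.memLp_mollify hw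
  have hmd : ∀ i, HasWeakPartial i (mollify ρ w) (mollify (partialDeriv i ρ) w) := fun i =>
    hasWeakPartial_mollify_left i hρ.test hli
  have hm1 : MemH 1 (mollify ρ w) := memH_succ hm fun i =>
    ⟨_, hmd i, (hρ.test.partialDeriv i).memLp_mollify hw⟩
  have hsol : IsEllipticSolution (fun _ => 1) μ γ (fun _ => 0) (fun _ _ => 0) (mollify ρ w) := by
    refine ⟨hm1, fun φ hφ => ?_⟩
    have h1 := h _ (hρ.test.comp_neg.mollify_of_compact hφ.locallyIntegrable hφ.compact)
    rw [← integral_mollify_mul hρ.test hli hφ] at h1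
    have h2 : ∀ i, ∫ x, (μ * gammaCoeff γ i ^ 2 * (1 * weakPartial i (mollify ρ w) x)
        + gammaCoeff γ i * 0) * partialDeriv i φ x = -(μ * gammaCoeff γ i ^ 2 *
          ∫ x, w x * partialDeriv i (partialDeriv i (mollify (fun t => ρ (-t)) φ)) x) := by
      intro i
      have h3 := (hm1.hasWeakPartial i).integral_eq _ (hφ.partialDeriv i)
      rw [integral_mollify_mul hρ.test hli ((hφ.partialDeriv i).partialDeriv i),
        ← partialDeriv_mollify_right hρ.test.comp_neg (hφ.partialDeriv i),
        ← partialDeriv_mollify_right hρ.test.comp_neg hφ] at h3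
      rw [h3, mul_neg, neg_neg, ← integral_const_mul]
      congr 1; funext x; ring
    refine Eq.trans ?_ h1
    rw [Finset.sum_congr rfl fun i _ => h2 i, Finset.sum_neg_distrib, ← sub_eq_add_neg]
    simp only [one_mul, sub_zero]
  have h0 : MemLp (fun _ : Space d => (0 : ℝ)) 2 := MemH.zero.memLp (k := 0)
  have hen := hsol.energy (M := d) hd (Nat.le_succ d) isDepth_one hμ hγ h0 fun _ => h0
  have hz : normH 0 (mollify ρ w) ≤ 0 := by
    refine (normH_le_solSize hγ 0 _).trans (hen.trans (le_of_eq ?_))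
    simp [dataSize, normH_zero]
  have hz2 : ∫ x, (mollify ρ w x) ^ 2 ≤ 0 := by
    rw [← normH_zero_sq, le_antisymm hz (normH_nonneg _ _)]
    simp
  have hae := ae_eq_zero_of_integral_sq_nonpos hm hz2
  have := hmol ρ hρ
  rw [zero_add]
  refine le_trans (le_of_eq (integral_congr_ae ?_)) this
  filter_upwards [hae] with x hx
  rw [hx]
  simp

theorem IsEllipticSolution.congr {r' p' : Space d → ℝ} {F' : Field d}
    (hs : IsEllipticSolution h μ γ r F p) (hp : p =ᵐ[volume] p') (hr : r =ᵐ[volume] r')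
    (hF : ∀ i, F i =ᵐ[volume] F' i) : IsEllipticSolution h μ γ r' F' p' := by
  refine ⟨hs.memH.congr hp, fun φ hφ => ?_⟩
  rw [← hs.eq φ hφ]
  congr 1
  · refine integral_congr_ae ?_
    filter_upwards [hp, hr] with x h1 h2
    rw [h1, h2]
  · refine Finset.sum_congr rfl fun i _ => integral_congr_ae ?_
    filter_upwards [weakPartial_congr (i := i) hp, hF i] with x h1 h2
    rw [h1, h2]

/-- The derivative `∂_j p` of a solution of the constant coefficient equation solves the
differentiated equation; `∂_j r` is absorbed into the divergence. -/
theorem IsEllipticSolution.partial_const (hd : d = 1 ∨ d = 2) (hμ : 0 < μ) (hγ : 0 < γ)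
    (hr : MemLp r 2) (hF : ∀ i, MemH 1 (F i))
    (hs : IsEllipticSolution (fun _ => 1) μ γ r F p) (j : Fin d) :
    IsEllipticSolution (fun _ => 1) μ γ (fun _ => 0)
      (fun i x => weakPartial j (F i) x + (if i = j then (gammaCoeff γ j)⁻¹ else 0) * r x)
      (weakPartial j p) := by
  have hF' : ∀ i, MemLp (fun x => weakPartial j (F i) x +
      (if i = j then (gammaCoeff γ j)⁻¹ else 0) * r x) 2 := fun i =>
    ((hF i).weakPartial j).memLp.add (hr.const_mul _)
  have h0 : MemLp (fun _ : Space d => (0 : ℝ)) 2 := MemH.zero.memLp (k := 0)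
  -- the solution `q` of the differentiated equation differs from `∂_j p` by a very weak solution
  -- of the homogeneous equation
  obtain ⟨q, hq⟩ := exists_isEllipticSolution (M := d) hd (Nat.le_succ d) isDepth_one hμ hγ h0 hF'
  refine hq.congr ?_ (ae_eq_refl _) fun i => ae_eq_refl _
  have hqp : MemLp (fun x => q x - weakPartial j p x) 2 :=
    hq.memH.memLp.sub (hs.memH.weakPartial j).memLp
  have hz := ae_eq_zero_of_very_weak hd hμ hγ hqp fun φ hφ => ?_
  · filter_upwards [hz] with x hx
    simpa [sub_eq_zero] using hx
  have hφj := hφ.partialDeriv j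
  have h1 := hs.eq _ hφj
  have h2 := hq.eq φ hφ
  simp only [one_mul, sub_zero] at h1 h2
  have i2 : ∀ {u ψ : Space d → ℝ}, MemLp u 2 → IsTest ψ → Integrable (fun x => u x * ψ x) :=
    fun hu hψ => MemLp.integrable_mul_two hu (hψ.memLp 2)
  have hpL := hs.memH.memLp
  have hqL := hq.memH.memLp
  -- the equation for `p`, tested with `∂_j φ`
  have a1 : ∫ x, (p x - r x) * partialDeriv j φ x
      = -(∫ x, weakPartial j p x * φ x) - ∫ x, r x * partialDeriv j φ x := by
    simp only [sub_mul]
    rw [integral_sub (i2 hpL hφj) (i2 hr hφj), (hs.memH.hasWeakPartial j).integral_eq φ hφ]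
  have a2 : ∀ i, ∫ x, (μ * gammaCoeff γ i ^ 2 * weakPartial i p x + gammaCoeff γ i * F i x)
      * partialDeriv i (partialDeriv j φ) x
      = μ * gammaCoeff γ i ^ 2 * (∫ x, weakPartial j p x * partialDeriv i (partialDeriv i φ) x)
        - gammaCoeff γ i * ∫ x, weakPartial j (F i) x * partialDeriv i φ x := by
    intro i
    have hij := hφj.partialDeriv i
    simp only [add_mul, mul_assoc]
    rw [integral_add, integral_const_mul, integral_const_mul, integral_const_mul]
    · have b1 := (hs.memH.hasWeakPartial i).integral_eq _ hij
      have b2 := (hs.memH.hasWeakPartial j).integral_eq _ ((hφ.partialDeriv i).partialDeriv i)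
      have b3 := ((hF i).hasWeakPartial j).integral_eq _ (hφ.partialDeriv i)
      have c1 : partialDeriv i (partialDeriv i (partialDeriv j φ))
          = partialDeriv j (partialDeriv i (partialDeriv i φ)) := by
        rw [partialDeriv_comm hφ i j, partialDeriv_comm (hφ.partialDeriv i) i j]
      rw [c1] at b1
      have b4 : ∫ x, weakPartial i p x * partialDeriv i (partialDeriv j φ) x
          = ∫ x, weakPartial j p x * partialDeriv i (partialDeriv i φ) x := by linarith
      rw [b4, partialDeriv_comm hφ i j, b3]
      ring
    · exact ((i2 (hs.memH.weakPartial i).memLp hij).const_mul _).const_mul _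
    · exact (i2 (hF i).memLp hij).const_mul _
  -- the equation for `q`
  have a3 : ∀ i, ∫ x, (μ * gammaCoeff γ i ^ 2 * weakPartial i q x + gammaCoeff γ i *
      (weakPartial j (F i) x + (if i = j then (gammaCoeff γ j)⁻¹ else 0) * r x))
      * partialDeriv i φ x
      = -(μ * gammaCoeff γ i ^ 2 * ∫ x, q x * partialDeriv i (partialDeriv i φ) x)
        + gammaCoeff γ i * (∫ x, weakPartial j (F i) x * partialDeriv i φ x)
        + if i = j then ∫ x, r x * partialDeriv j φ x else 0 := by
    intro i
    have hi := hφ.partialDeriv i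
    have b1 := (hq.memH.hasWeakPartial i).integral_eq _ hi
    have e : ∀ x, (μ * gammaCoeff γ i ^ 2 * weakPartial i q x + gammaCoeff γ i *
      (weakPartial j (F i) x + (if i = j then (gammaCoeff γ j)⁻¹ else 0) * r x))
      * partialDeriv i φ x = μ * gammaCoeff γ i ^ 2 * (weakPartial i q x * partialDeriv i φ x)
        + gammaCoeff γ i * (weakPartial j (F i) x * partialDeriv i φ x)
        + (gammaCoeff γ i * if i = j then (gammaCoeff γ j)⁻¹ else 0)
          * (r x * partialDeriv i φ x) := fun x => by ring
    simp_rw [e]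
    have j1 := (i2 (hq.memH.weakPartial i).memLp hi).const_mul (μ * gammaCoeff γ i ^ 2)
    have j2 := (i2 ((hF i).weakPartial j).memLp hi).const_mul (gammaCoeff γ i)
    have j3 := (i2 hr hi).const_mul (gammaCoeff γ i * if i = j then (gammaCoeff γ j)⁻¹ else 0)
    have j12 : Integrable (fun x =>
        μ * gammaCoeff γ i ^ 2 * (weakPartial i q x * partialDeriv i φ x)
          + gammaCoeff γ i * (weakPartial j (F i) x * partialDeriv i φ x)) := j1.add j2
    rw [integral_add j12 j3, integral_add j1 j2, integral_const_mul, integral_const_mul,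
      integral_const_mul, b1]
    split_ifs with hij
    · subst hij
      rw [mul_inv_cancel₀ (gammaCoeff_pos hγ i).ne']
      ring
    · ring
  rw [a1, Finset.sum_congr rfl fun i _ => a2 i, Finset.sum_sub_distrib] at h1
  rw [Finset.sum_congr rfl fun i _ => a3 i, Finset.sum_add_distrib, Finset.sum_add_distrib,
    Finset.sum_neg_distrib] at h2
  simp only [Finset.sum_ite_eq', Finset.mem_univ, if_true] at h2
  have a4 : ∫ x, (q x - weakPartial j p x) * φ x
      = (∫ x, q x * φ x) - ∫ x, weakPartial j p x * φ x := by
    simp only [sub_mul]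
    exact integral_sub (i2 hqL hφ) (i2 (hs.memH.weakPartial j).memLp hφ)
  have a5 : ∀ i, μ * gammaCoeff γ i ^ 2 * ∫ x, (q x - weakPartial j p x)
      * partialDeriv i (partialDeriv i φ) x
      = μ * gammaCoeff γ i ^ 2 * (∫ x, q x * partialDeriv i (partialDeriv i φ) x)
      - μ * gammaCoeff γ i ^ 2 * ∫ x, weakPartial j p x * partialDeriv i (partialDeriv i φ) x := by
    intro i
    have hii := (hφ.partialDeriv i).partialDeriv i
    simp only [sub_mul]
    rw [integral_sub (i2 hqL hii) (i2 (hs.memH.weakPartial j).memLp hii)]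
    ring
  rw [a4, Finset.sum_congr rfl fun i _ => a5 i, Finset.sum_sub_distrib]
  linarith

/-- Regularity for constant coefficients: all first derivatives solve equations of the same
type. -/
theorem IsEllipticSolution.memH_const (hd : d = 1 ∨ d = 2) (hμ : 0 < μ) (hγ : 0 < γ) {n : ℕ}
    (hr : MemH n r) (hF : ∀ i, MemH (n + 1) (F i))
    (hs : IsEllipticSolution (fun _ => 1) μ γ r F p) : MemH (n + 2) p := by
  induction n generalizing r F p with
  | zero => exact ⟨hs.memH, fun j => ⟨_, hs.memH.hasWeakPartial j,
      (hs.partial_const hd hμ hγ hr.memLp hF j).memH⟩⟩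
  | succ n ih =>
    have h1 : ∀ i, MemH 1 (F i) := fun i => (hF i).mono (by omega)
    refine memH_succ hs.memH.memLp fun j => ⟨_, hs.memH.hasWeakPartial j, ?_⟩
    exact ih MemH.zero (fun i => ((hF i).weakPartial j).add (hr.const_mul _))
      (hs.partial_const hd hμ hγ hr.memLp h1 j)

/-- Division of the equation by `h`, that is, testing with `h⁻¹ φ`: a solution of the equation with
variable depth solves an equation with constant coefficients, whose right hand side contains only
first derivatives of `p`. -/
theorem IsEllipticSolution.to_const (hd : d = 1 ∨ d = 2) (hM : d ≤ M + 1) (H : IsDepth M a b h)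
    (hr : MemLp r 2) (hF : ∀ i, MemLp (F i) 2)
    (hdp : ∀ i, MemLp (fun x => depthPartial h i x * weakPartial i p x) 2)
    (hdF : ∀ i, MemLp (fun x => depthPartial h i x * ((h x)⁻¹ * F i x)) 2)
    (hs : IsEllipticSolution h μ γ r F p) :
    IsEllipticSolution (fun _ => 1) μ γ
      (fun x => (h x)⁻¹ * r x + ∑ i, (μ * gammaCoeff γ i ^ 2 *
        ((h x)⁻¹ * (depthPartial h i x * weakPartial i p x)) + gammaCoeff γ i *
          ((h x)⁻¹ * (depthPartial h i x * ((h x)⁻¹ * F i x)))))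
      (fun i x => (h x)⁻¹ * F i x) p := by
  refine ⟨hs.memH, fun φ hφ => ?_⟩
  have hw := fun i => H.hasWeakPartial_inv_mul (hφ.hasWeakPartial i) (hφ.memLp 2)
    ((hφ.partialDeriv i).memLp 2)
  have hdφ : ∀ i, MemLp (fun x => depthPartial h i x * φ x) 2 := fun i =>
    MemLp.mul_test (H.memH_depthPartial i).memLp hφ
  have hz : MemH 1 (fun x => (h x)⁻¹ * φ x) := memH_succ (H.memLp_inv_mul (hφ.memLp 2)) fun i =>
    ⟨_, hw i, (H.memLp_inv_mul ((hφ.partialDeriv i).memLp 2)).sub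
      (H.memLp_inv_mul (H.memLp_inv_mul (hdφ i)))⟩
  have key := hs.eq_of_memH hd hM H hr hF hz
  have hh : ∀ x, h x * (h x)⁻¹ = 1 := fun x => mul_inv_cancel₀ (H.h_pos x).ne'
  have i2 : ∀ {u ψ : Space d → ℝ}, MemLp u 2 → IsTest ψ → Integrable (fun x => u x * ψ x) :=
    fun hu hψ => MemLp.integrable_mul_two hu (hψ.memLp 2)
  have g1 := fun i => H.memLp_inv_mul (hdp i)
  have g2 := fun i => H.memLp_inv_mul (hdF i)
  have g3 : ∀ i, MemLp (fun x => μ * gammaCoeff γ i ^ 2 *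
      ((h x)⁻¹ * (depthPartial h i x * weakPartial i p x))
        + gammaCoeff γ i * ((h x)⁻¹ * (depthPartial h i x * ((h x)⁻¹ * F i x)))) 2 := fun i =>
    ((g1 i).const_mul (μ * gammaCoeff γ i ^ 2)).add
    ((g2 i).const_mul (gammaCoeff γ i))
  have e1 : ∫ x, (h x * p x - r x) * ((h x)⁻¹ * φ x)
      = ∫ x, (p x - (h x)⁻¹ * r x) * φ x := by
    congr 1; funext x
    linear_combination (p x * φ x) * hh x
  have e2 : ∀ i, ∫ x, (μ * gammaCoeff γ i ^ 2 * (h x * weakPartial i p x) + gammaCoeff γ i * F i x)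
      * weakPartial i (fun x => (h x)⁻¹ * φ x) x
      = (∫ x, (μ * gammaCoeff γ i ^ 2 * (1 * weakPartial i p x)
          + gammaCoeff γ i * ((h x)⁻¹ * F i x)) * partialDeriv i φ x)
        - ∫ x, (μ * gammaCoeff γ i ^ 2 * ((h x)⁻¹ * (depthPartial h i x * weakPartial i p x))
          + gammaCoeff γ i * ((h x)⁻¹ * (depthPartial h i x * ((h x)⁻¹ * F i x)))) * φ x := by
    intro i
    rw [← integral_sub]
    · refine integral_congr_ae ?_
      filter_upwards [(hw i).weakPartial_ae] with x hx
      rw [hx]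
      linear_combination (μ * gammaCoeff γ i ^ 2 * weakPartial i p x * partialDeriv i φ x
        - μ * gammaCoeff γ i ^ 2 * weakPartial i p x * ((h x)⁻¹ * (depthPartial h i x * φ x)))
        * hh x
    · simp only [one_mul]
      exact i2 (((hs.memH.weakPartial i).memLp.const_mul _).add
        ((H.memLp_inv_mul (hF i)).const_mul _)) (hφ.partialDeriv i)
    · exact i2 (g3 i) hφ
  have e3 : ∫ x, (1 * p x - ((h x)⁻¹ * r x + ∑ i, (μ * gammaCoeff γ i ^ 2 *
        ((h x)⁻¹ * (depthPartial h i x * weakPartial i p x)) + gammaCoeff γ i *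
          ((h x)⁻¹ * (depthPartial h i x * ((h x)⁻¹ * F i x)))))) * φ x
      = (∫ x, (p x - (h x)⁻¹ * r x) * φ x) - ∑ i, ∫ x, (μ * gammaCoeff γ i ^ 2 *
        ((h x)⁻¹ * (depthPartial h i x * weakPartial i p x))
          + gammaCoeff γ i * ((h x)⁻¹ * (depthPartial h i x * ((h x)⁻¹ * F i x)))) * φ x := by
    have j0 : MemLp (fun x => p x - (h x)⁻¹ * r x) 2 := hs.memH.memLp.sub (H.memLp_inv_mul hr)
    rw [← integral_finsetSum _ fun i _ => i2 (g3 i) hφ,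
      ← integral_sub (i2 j0 hφ) (integrable_finsetSum _ fun i _ => i2 (g3 i) hφ)]
    congr 1; funext x
    rw [← Finset.sum_mul]
    ring
  rw [e1, Finset.sum_congr rfl fun i _ => e2 i, Finset.sum_sub_distrib] at key
  rw [e3]
  linarith

/-! ### Elliptic regularity -/

theorem le_succ_of_dim {M : ℕ} (hM : d = 1 ∨ d ≤ M) : d ≤ M + 1 := by omega

/-- The differentiated equation, for solutions in `H^2`. -/
theorem IsEllipticSolution.partial (H : IsDepth M a b h)
    (hr : MemH 1 r) (hF : ∀ i, MemH 1 (F i)) (hp : MemH 2 p)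
    (hs : IsEllipticSolution h μ γ r F p) (j : Fin d) :
    IsEllipticSolution h μ γ (fun x => weakPartial j r x - depthPartial h j x * p x)
      (fun i x => weakPartial j (F i) x +
        μ * gammaCoeff γ i * (depthPartial h j x * weakPartial i p x)) (weakPartial j p) := by
  refine ⟨MemH.weakPartial hp j, fun φ hφ => ?_⟩
  have hp1 : MemH 1 p := hp.of_succ
  have key := hs.eq _ (hφ.partialDeriv j)
  have hA := ((H.hasWeakPartial_mul (hp1.hasWeakPartial j) hp1.memLp (hp1.weakPartial j).memLp).sub
    (hr.hasWeakPartial j)).integral_eq φ hφ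
  have hB : ∀ i, ∫ x, (μ * gammaCoeff γ i ^ 2 * (h x * weakPartial i p x) + gammaCoeff γ i * F i x)
      * partialDeriv i (partialDeriv j φ) x
      = -∫ x, (μ * gammaCoeff γ i ^ 2 * (h x * weakPartial i (weakPartial j p) x)
        + gammaCoeff γ i * (weakPartial j (F i) x +
          μ * gammaCoeff γ i * (depthPartial h j x * weakPartial i p x))) * partialDeriv i φ x := by
    intro i
    have hpi := MemH.weakPartial hp i
    have h1 := ((((H.hasWeakPartial_mul (hpi.hasWeakPartial j) hpi.memLp
      (hpi.weakPartial j).memLp).const_mul (μ * gammaCoeff γ i ^ 2)).add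
        (((hF i).hasWeakPartial j).const_mul (gammaCoeff γ i)))).integral_eq _ (hφ.partialDeriv i)
    rw [partialDeriv_comm hφ i j, h1]
    congr 1
    refine integral_congr_ae ?_
    filter_upwards [weakPartial_comm_ae hp i j] with x hx
    rw [hx]
    ring
  rw [hA, Finset.sum_congr rfl fun i _ => hB i, Finset.sum_neg_distrib] at key
  rw [show (∫ x, (h x * weakPartial j p x - (weakPartial j r x - depthPartial h j x * p x)) * φ x)
    = ∫ x, (h x * weakPartial j p x + depthPartial h j x * p x - weakPartial j r x) * φ x from by
      congr 1; funext x; ring]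
  linarith

/-- Elliptic regularity: the solution gains one derivative. After division by `h` the data
contain only first derivatives of `p`, so that the constant coefficient case can be iterated. -/
theorem IsEllipticSolution.memH_succ (hd : d = 1 ∨ d = 2) (hM : d = 1 ∨ d ≤ M)
    (H : IsDepth M a b h) (hμ : 0 < μ) (hγ : 0 < γ) {n : ℕ} (hn : n ≤ M) (hr : MemH n r)
    (hF : ∀ i, MemH n (F i)) (hs : IsEllipticSolution h μ γ r F p) : MemH (n + 1) p := by
  induction n with
  | zero => exact hs.memH
  | succ n ih =>
    have hp : MemH (n + 1) p := ih (by omega) hr.of_succ fun i => (hF i).of_succ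
    have hdM : d ≤ M := by omega
    obtain ⟨_, -, h1⟩ := exists_depthPartial_mul_le hd hdM a b (j := n) (by omega)
    obtain ⟨_, -, h2⟩ := exists_depth_inv_mul_le hd hM a b (j := n) (by omega)
    obtain ⟨_, -, h3⟩ := exists_depth_inv_mul_le hd hM a b (j := n + 1) (by omega)
    have g1 : ∀ i, MemH n (fun x => depthPartial h i x * weakPartial i p x) := fun i =>
      (h1 h _ H (hp.weakPartial i) i).1
    have g2 : ∀ i, MemH n (fun x => depthPartial h i x * ((h x)⁻¹ * F i x)) := fun i =>
      (h1 h _ H (h2 h _ H (hF i).of_succ).1 i).1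
    refine IsEllipticSolution.memH_const hd hμ hγ ?_ (fun i => (h3 h _ H (hF i)).1)
      (hs.to_const hd (by omega) H hr.memLp (fun i => (hF i).memLp) (fun i => (g1 i).memLp)
        fun i => (g2 i).memLp)
    exact (h2 h _ H hr.of_succ).1.add (MemH.sum _ fun i _ =>
      ((h2 h _ H (g1 i)).1.const_mul _).add ((h2 h _ H (g2 i)).1.const_mul _))

theorem solSize_succ_le (hγ : 0 < γ) {n : ℕ} (hp : MemH (n + 2) p) :
    solSize μ γ (n + 1) p ≤ solSize μ γ n p + ∑ j, solSize μ γ n (weakPartial j p) := by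
  have h1 := normH_succ_le n p
  have h2 : ∀ i, normH (n + 1) (weakPartial i p) ≤ normH n (weakPartial i p)
      + ∑ j, normH n (weakPartial i (weakPartial j p)) := fun i => by
    refine (normH_succ_le n _).trans (le_of_eq ?_)
    congr 1
    exact Finset.sum_congr rfl fun j _ =>
      normH_congr (weakPartial_comm_ae (hp.mono (by omega) : MemH (0 + 2) p) j i)
  have h3 : ∑ i, √μ * gammaCoeff γ i * normH (n + 1) (weakPartial i p) ≤
      ∑ i, (√μ * gammaCoeff γ i * normH n (weakPartial i p) +
        ∑ j, √μ * gammaCoeff γ i * normH n (weakPartial i (weakPartial j p))) := by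
    refine Finset.sum_le_sum fun i _ => ?_
    rw [← Finset.mul_sum, ← mul_add]
    have := gammaCoeff_pos hγ i
    exact mul_le_mul_of_nonneg_left (h2 i) (by positivity)
  rw [Finset.sum_add_distrib, Finset.sum_comm] at h3
  unfold solSize
  rw [Finset.sum_add_distrib]
  linarith

theorem dataSize_le_succ (n : ℕ) : dataSize μ n r F ≤ dataSize μ (n + 1) r F :=
  add_le_add (normH_le_succ n r) (Finset.sum_le_sum fun i _ =>
    mul_le_mul_of_nonneg_left (normH_le_succ n (F i)) (by positivity))

/-- The quantitative version of elliptic regularity, uniform in `μ` and `γ`: the derivatives of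
the solution satisfy equations of the same form, to which the energy estimate applies. -/
theorem exists_solSize_le {M : ℕ} (hd : d = 1 ∨ d = 2) (hM : d = 1 ∨ d ≤ M) (a b : ℝ) {n : ℕ}
    (hn : n ≤ M) : ∃ C, 0 ≤ C ∧ ∀ (h : Space d → ℝ) (μ γ : ℝ) (r : Space d → ℝ) (F : Field d)
      (p : Space d → ℝ), IsDepth M a b h → 0 < μ → 0 < γ → MemH n r → (∀ i, MemH n (F i)) →
      IsEllipticSolution h μ γ r F p → solSize μ γ n p ≤ C * dataSize μ n r F := by
  induction n with
  | zero =>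
    refine ⟨(d + 1) * |a|, by positivity, fun h μ γ r F p H hμ hγ hr hF hs => ?_⟩
    rw [abs_of_pos H.pos]
    exact hs.energy hd (le_succ_of_dim hM) H hμ hγ hr hF
  | succ n ih =>
    obtain ⟨C, hC0, hC⟩ := ih (by omega)
    have hdM : d ≤ M := by omega
    obtain ⟨D, hD0, hD⟩ := exists_depthPartial_mul_le hd hdM a b (j := n) (by omega)
    refine ⟨C + d * (C * (1 + D * C)), by positivity, fun h μ γ r F p H hμ hγ hr hF hs => ?_⟩
    have hp : MemH (n + 2) p := hs.memH_succ hd hM H hμ hγ hn hr hF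
    have hp1 : MemH (n + 1) p := hp.of_succ
    have hsμ := Real.sqrt_pos.2 hμ
    have h0 := hC h μ γ r F p H hμ hγ hr.of_succ (fun i => (hF i).of_succ) hs
    have h0' : solSize μ γ n p ≤ C * dataSize μ (n + 1) r F :=
      h0.trans (mul_le_mul_of_nonneg_left (dataSize_le_succ n) hC0)
    have hj : ∀ j, solSize μ γ n (weakPartial j p)
        ≤ C * ((1 + D * C) * dataSize μ (n + 1) r F) := by
      intro j
      have m1 := hD h p H hp1.of_succ j
      have m2 := fun i => hD h _ H (MemH.weakPartial hp1 i) j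
      have h1 := hC h μ γ _ _ _ H hμ hγ ((MemH.weakPartial hr j).sub m1.1)
        (fun i => ((hF i).weakPartial j).add ((m2 i).1.const_mul _))
        (hs.partial H (hr.mono (by omega)) (fun i => (hF i).mono (by omega))
          (hp.mono (by omega)) j)
      refine h1.trans (mul_le_mul_of_nonneg_left ?_ hC0)
      have h2 : dataSize μ n (fun x => weakPartial j r x - depthPartial h j x * p x)
          (fun i x => weakPartial j (F i) x +
            μ * gammaCoeff γ i * (depthPartial h j x * weakPartial i p x))
          ≤ dataSize μ (n + 1) r F + D * solSize μ γ n p := by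
        have e1 : normH n (fun x => weakPartial j r x - depthPartial h j x * p x)
            ≤ normH (n + 1) r + D * normH n p :=
          (normH_sub_le (MemH.weakPartial hr j) m1.1).trans
            (add_le_add (normH_weakPartial_le n r j) m1.2)
        have e2 : ∀ i, (√μ)⁻¹ * normH n (fun x => weakPartial j (F i) x +
            μ * gammaCoeff γ i * (depthPartial h j x * weakPartial i p x))
            ≤ (√μ)⁻¹ * normH (n + 1) (F i) +
              D * (√μ * gammaCoeff γ i * normH n (weakPartial i p)) := by
          intro i
          have hg := gammaCoeff_pos hγ i
          have e3 := normH_add_le ((hF i).weakPartial j)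
            ((m2 i).1.const_mul (μ * gammaCoeff γ i))
          rw [normH_const_mul (m2 i).1, abs_of_pos (mul_pos hμ hg)] at e3
          have e4 := mul_le_mul_of_nonneg_left (m2 i).2 (mul_pos hμ hg).le
          have e5 := normH_weakPartial_le n (F i) j
          have e6 := mul_le_mul_of_nonneg_left (e3.trans (add_le_add e5 e4))
            (inv_nonneg.2 hsμ.le)
          refine e6.trans (le_of_eq ?_)
          have e7 : (√μ)⁻¹ * μ = √μ := by
            rw [inv_mul_eq_div, Real.div_sqrt]
          linear_combination (gammaCoeff γ i * (D * normH n (weakPartial i p))) * e7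
        have e8 := Finset.sum_le_sum fun i (_ : i ∈ Finset.univ) => e2 i
        rw [Finset.sum_add_distrib] at e8
        unfold dataSize solSize
        rw [mul_add, Finset.mul_sum]
        linarith
      have h3 := mul_le_mul_of_nonneg_left h0' hD0
      linarith
    have hsum := Finset.sum_le_sum fun j (_ : j ∈ Finset.univ) => hj j
    rw [Finset.sum_const, Finset.card_univ, Fintype.card_fin, nsmul_eq_mul] at hsum
    have := solSize_succ_le (μ := μ) hγ hp
    linarith

end EllipticEquation

/-! ### The weak divergence -/

section Inversion

variable {M : ℕ} {a b : ℝ} {h : Space d → ℝ} {μ γ : ℝ} {V W : Field d} {p q : Space d → ℝ}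

theorem HasWeakDiv.unique {p' : Space d → ℝ} (hp : HasWeakDiv γ V p) (hp' : HasWeakDiv γ V p') :
    p =ᵐ[volume] p' := by
  refine ae_eq_of_integral_contDiff_smul_eq hp.locInt_div hp'.locInt_div fun g hg hc => ?_
  have h1 := hp.integral_eq g ⟨hg, hc⟩
  rw [hp'.integral_eq g ⟨hg, hc⟩] at h1
  simp only [smul_eq_mul, mul_comm (g _)]
  linarith

theorem HasWeakDiv.congr {V' : Field d} {p' : Space d → ℝ} (hp : HasWeakDiv γ V p)
    (hV : ∀ i, V i =ᵐ[volume] V' i) (hpp : p =ᵐ[volume] p') : HasWeakDiv γ V' p' where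
  locInt i := LocallyIntegrable.congr_ae (hp.locInt i) (hV i)
  locInt_div := LocallyIntegrable.congr_ae hp.locInt_div hpp
  integral_eq φ hφ := by
    have e1 : ∫ x, p' x * φ x = ∫ x, p x * φ x := by
      refine integral_congr_ae ?_
      filter_upwards [hpp] with x hx
      rw [hx]
    rw [e1, ← hp.integral_eq φ hφ]
    refine Finset.sum_congr rfl fun i _ => ?_
    congr 1
    refine integral_congr_ae ?_
    filter_upwards [hV i] with x hx
    rw [hx]

protected theorem HasWeakDiv.weakDiv (hp : HasWeakDiv γ V p) : HasWeakDiv γ V (weakDiv γ V) := by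
  have he : ∃ p, HasWeakDiv γ V p := ⟨p, hp⟩
  unfold Boussinesq.weakDiv
  rw [dif_pos he]
  exact he.choose_spec

theorem HasWeakDiv.weakDiv_ae (hp : HasWeakDiv γ V p) : weakDiv γ V =ᵐ[volume] p :=
  hp.weakDiv.unique hp

theorem HasWeakDiv.sub {p' : Space d → ℝ} (hp : HasWeakDiv γ V p) (hp' : HasWeakDiv γ W p') :
    HasWeakDiv γ (fun i x => V i x - W i x) (fun x => p x - p' x) where
  locInt i := (hp.locInt i).sub (hp'.locInt i)
  locInt_div := hp.locInt_div.sub hp'.locInt_div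
  integral_eq φ hφ := by
    have e1 : ∀ i, gammaCoeff γ i * ∫ x, (V i x - W i x) * partialDeriv i φ x
        = gammaCoeff γ i * (∫ x, V i x * partialDeriv i φ x)
          - gammaCoeff γ i * ∫ x, W i x * partialDeriv i φ x := by
      intro i
      simp only [sub_mul]
      rw [integral_sub (LocallyIntegrable.integrable_mul_test (hp.locInt i) (hφ.partialDeriv i))
        (LocallyIntegrable.integrable_mul_test (hp'.locInt i) (hφ.partialDeriv i)), mul_sub]
    rw [Finset.sum_congr rfl fun i _ => e1 i, Finset.sum_sub_distrib, hp.integral_eq φ hφ,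
      hp'.integral_eq φ hφ]
    simp only [sub_mul]
    rw [integral_sub (LocallyIntegrable.integrable_mul_test hp.locInt_div hφ)
      (LocallyIntegrable.integrable_mul_test hp'.locInt_div hφ)]
    ring

theorem hasWeakDiv_of_hasWeakPartial {w : Field d} (hw : ∀ i, HasWeakPartial i (V i) (w i)) :
    HasWeakDiv γ V (fun x => ∑ i, gammaCoeff γ i * w i x) where
  locInt i := (hw i).locInt
  locInt_div := locallyIntegrable_finsetSum _ fun i _ => (hw i).locInt_deriv.smul (gammaCoeff γ i)
  integral_eq φ hφ := by
    simp only [Finset.sum_mul]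
    rw [integral_finsetSum _ fun i _ => ?_, ← Finset.sum_neg_distrib]
    · refine Finset.sum_congr rfl fun i _ => ?_
      rw [(hw i).integral_eq φ hφ, mul_neg, ← integral_const_mul]
      congr 2; funext x; ring
    · exact LocallyIntegrable.integrable_mul_test ((hw i).locInt_deriv.smul (gammaCoeff γ i)) hφ

theorem HasWeakDiv.integral_mul_weakPartial (hp : HasWeakDiv γ V p) (hV : ∀ i, MemLp (V i) 2)
    (hpL : MemLp p 2) {z : Space d → ℝ} (hz : MemH 1 z) :
    ∑ i, gammaCoeff γ i * ∫ x, V i x * weakPartial i z x = -∫ x, p x * z x := by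
  have key := integral_add_sum_eq_zero_of_test (B := fun i x => gammaCoeff γ i * V i x) hpL
    (fun i => (hV i).const_mul _) (fun φ hφ => ?_) hz
  · simp only [mul_assoc, integral_const_mul] at key
    linarith
  · simp only [mul_assoc, integral_const_mul]
    rw [hp.integral_eq φ hφ]
    ring

theorem HasWeakDiv.hasWeakPartial (hd : d = 1) (hp : HasWeakDiv γ V p) (i : Fin d) :
    HasWeakPartial i (V i) p := by
  subst hd
  refine ⟨hp.locInt i, hp.locInt_div, fun φ hφ => ?_⟩
  have h1 := hp.integral_eq φ hφ
  rw [Fin.sum_univ_one] at h1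
  rw [Subsingleton.elim i 0, ← h1]
  simp [gammaCoeff]

/-- The product rule for the divergence of `m V`, where multiplication by `m` acts on test
functions; it follows by testing the divergence of `V` with `m φ`. -/
theorem HasWeakDiv.mul {m : Space d → ℝ} {m' : Field d} (hp : HasWeakDiv γ V p)
    (hV : ∀ i, MemLp (V i) 2) (hpL : MemLp p 2)
    (hm : ∀ φ, IsTest φ → MemH 1 (fun x => m x * φ x) ∧
      ∀ i, HasWeakPartial i (fun x => m x * φ x) fun x => m x * partialDeriv i φ x + m' i x * φ x)
    (hmV : ∀ i, MemLp (fun x => m x * V i x) 2) (hmp : MemLp (fun x => m x * p x) 2)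
    (hm'V : ∀ i, MemLp (fun x => m' i x * V i x) 2) :
    HasWeakDiv γ (mulField m V)
      (fun x => m x * p x + ∑ i, gammaCoeff γ i * (m' i x * V i x)) := by
  have hsum : MemLp (fun x => ∑ i, gammaCoeff γ i * (m' i x * V i x)) 2 :=
    MemH.sum (k := 0) _ fun i _ => MemH.const_mul (k := 0) (hm'V i) _
  refine ⟨fun i => MemLp.locallyIntegrable_two (hmV i),
    MemLp.locallyIntegrable_two (hmp.add hsum), fun φ hφ => ?_⟩
  have i2 : ∀ {u ψ : Space d → ℝ}, MemLp u 2 → IsTest ψ → Integrable (fun x => u x * ψ x) :=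
    fun hu hψ => MemLp.integrable_mul_two hu (hψ.memLp 2)
  have key := hp.integral_mul_weakPartial hV hpL (hm φ hφ).1
  have e1 : ∀ i, ∫ x, V i x * weakPartial i (fun x => m x * φ x) x
      = (∫ x, mulField m V i x * partialDeriv i φ x) + ∫ x, m' i x * V i x * φ x := by
    intro i
    have hmi : MemLp (mulField m V i) 2 := hmV i
    rw [← integral_add (i2 hmi (hφ.partialDeriv i)) (i2 (hm'V i) hφ)]
    refine integral_congr_ae ?_
    filter_upwards [((hm φ hφ).2 i).weakPartial_ae] with x hx
    rw [hx]
    simp only [mulField]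
    ring
  have e2 : ∫ x, (m x * p x + ∑ i, gammaCoeff γ i * (m' i x * V i x)) * φ x
      = (∫ x, p x * (m x * φ x)) + ∑ i, gammaCoeff γ i * ∫ x, m' i x * V i x * φ x := by
    simp only [add_mul, Finset.sum_mul]
    have i3 : ∀ i, Integrable (fun x => gammaCoeff γ i * (m' i x * V i x) * φ x) := fun i =>
      i2 ((hm'V i).const_mul _) hφ
    rw [integral_add (i2 hmp hφ) (integrable_finsetSum _ fun i _ => i3 i),
      integral_finsetSum _ fun i _ => i3 i]
    congr 1
    · congr 1; funext x; ring
    · refine Finset.sum_congr rfl fun i _ => ?_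
      rw [← integral_const_mul]
      congr 1; funext x; ring
  rw [Finset.sum_congr rfl fun i _ => by rw [e1 i, mul_add], Finset.sum_add_distrib] at key
  rw [e2]
  linarith

namespace IsDepth

theorem mul_test (hd : d = 1 ∨ d = 2) (hM : d ≤ M + 1) (H : IsDepth M a b h) {φ : Space d → ℝ}
    (hφ : IsTest φ) : MemH 1 (fun x => h x * φ x) ∧ ∀ i, HasWeakPartial i (fun x => h x * φ x)
      fun x => h x * partialDeriv i φ x + depthPartial h i x * φ x := by
  have hw := fun i => H.hasWeakPartial_mul (hφ.hasWeakPartial i) (hφ.memLp 2)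
    ((hφ.partialDeriv i).memLp 2)
  exact ⟨Boussinesq.memH_succ (H.memLp_mul hd hM (hφ.memLp 2)) fun i => ⟨_, hw i,
    (H.memLp_mul hd hM ((hφ.partialDeriv i).memLp 2)).add
      (MemLp.mul_test (H.memH_depthPartial i).memLp hφ)⟩, hw⟩

theorem inv_mul_test (H : IsDepth M a b h) {φ : Space d → ℝ}
    (hφ : IsTest φ) : MemH 1 (fun x => (h x)⁻¹ * φ x) ∧
      ∀ i, HasWeakPartial i (fun x => (h x)⁻¹ * φ x)
        fun x => (h x)⁻¹ * partialDeriv i φ x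
          + (-((h x)⁻¹ * ((h x)⁻¹ * depthPartial h i x))) * φ x := by
  have hw := fun i => H.hasWeakPartial_inv_mul (hφ.hasWeakPartial i) (hφ.memLp 2)
    ((hφ.partialDeriv i).memLp 2)
  refine ⟨Boussinesq.memH_succ (H.memLp_inv_mul (hφ.memLp 2)) fun i => ⟨_, hw i,
    (H.memLp_inv_mul ((hφ.partialDeriv i).memLp 2)).sub (H.memLp_inv_mul (H.memLp_inv_mul
      (MemLp.mul_test (H.memH_depthPartial i).memLp hφ)))⟩, fun i => (hw i).congr (ae_eq_refl _)
        (Eventually.of_forall fun x => by ring)⟩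

end IsDepth

/-- For `V ∈ X^0` the products `∂_i h V_i` are in `L²`: either `∂_i h` is bounded or `d = 1`, in
which case `V ∈ H^1`. -/
theorem MemX.memLp_depthPartial_mul (hd : d = 1 ∨ d = 2) (hM : d = 1 ∨ d ≤ M)
    (H : IsDepth M a b h) (hW : MemX γ 0 W) (i : Fin d) :
    MemLp (fun x => depthPartial h i x * W i x) 2 := by
  rcases hM with h1 | h1
  · obtain ⟨p, hp, hpL⟩ := hW.2
    obtain ⟨_, -, h2⟩ := exists_depthPartial_mul_le_succ hd (Or.inl h1) a b (Nat.zero_le M)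
    have hi : MemH 1 (W i) := memH_succ (hW.1 i) fun j => by
      have : j = i := by subst h1; exact Subsingleton.elim _ _
      exact ⟨p, this ▸ hp.hasWeakPartial h1 i, hpL⟩
    exact (h2 h _ H hi i).1
  · obtain ⟨_, -, h2⟩ := exists_depthPartial_mul_le hd h1 a b (Nat.zero_le M)
    exact (h2 h _ H (hW.1 i) i).1

theorem MemX.mulField (hd : d = 1 ∨ d = 2) (hM : d = 1 ∨ d ≤ M) (H : IsDepth M a b h)
    (hW : MemX γ 0 W) : MemX γ 0 (mulField h W) := by
  have hM' := le_succ_of_dim hM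
  obtain ⟨p, hp, hpL⟩ := hW.2
  have hdW := hW.memLp_depthPartial_mul hd hM H
  have hmp : MemLp (fun x => h x * p x) 2 := H.memLp_mul hd hM' hpL
  refine ⟨fun i => H.memLp_mul hd hM' (hW.1 i), _, hp.mul hW.1 hpL (fun φ hφ =>
    H.mul_test hd hM' hφ) (fun i => H.memLp_mul hd hM' (hW.1 i)) hmp hdW, ?_⟩
  exact MemH.add (k := 0) hmp (MemH.sum _ fun i _ => MemH.const_mul (k := 0) (hdW i) _)

/-- The distribution `h 𝒜 V` written with `q = h⁻¹ ∇^γ·(h V)`. -/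
theorem hA_eq (hd : d = 1 ∨ d = 2) (hM : d ≤ M + 1) (H : IsDepth M a b h)
    (hV : ∀ i, MemLp (V i) 2) (hp : HasWeakDiv γ (mulField h V) p) (hpL : MemLp p 2) {φ : Field d}
    (hφ : IsTestField φ) : hA γ μ h V φ = ∑ i, ((∫ x, h x * V i x * φ i x) +
      μ * gammaCoeff γ i * ∫ x, (h x)⁻¹ * p x * weakPartial i (fun x => h x * φ i x) x) := by
  have hm := fun i => H.mul_test hd hM (hφ i)
  have hdiv := (hasWeakDiv_of_hasWeakPartial (γ := γ) (V := mulField h φ)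
    fun i => (hm i).1.hasWeakPartial i).weakDiv_ae
  have hq := H.memLp_inv_mul hpL
  have hhV : ∀ i, MemLp (mulField h V i) 2 := fun i => H.memLp_mul hd hM (hV i)
  unfold hA ofField mulGradGamma
  have e1 : ∫ x, (h x)⁻¹ * weakDiv γ (mulField h V) x * weakDiv γ (mulField h φ) x
      = ∑ i, gammaCoeff γ i *
        ∫ x, (h x)⁻¹ * p x * weakPartial i (fun x => h x * φ i x) x := by
    simp only [← integral_const_mul]
    rw [← integral_finsetSum _ fun i _ => (MemLp.integrable_mul_two hq
      ((hm i).1.weakPartial i).memLp).const_mul _]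
    refine integral_congr_ae ?_
    filter_upwards [hdiv, hp.weakDiv_ae] with x h1 h2
    rw [h1, h2, Finset.mul_sum]
    exact Finset.sum_congr rfl fun i _ => by ring
  rw [e1, integral_finsetSum _ fun i _ => MemLp.integrable_mul_two (hhV i)
    ((hφ i).memLp 2), Finset.sum_add_distrib, mul_neg, sub_neg_eq_add, Finset.mul_sum]
  simp only [mul_assoc, mulField]

/-! ### Injectivity of `h 𝒜` -/

/-- `h 𝒜` is injective on `X^0`: if `h 𝒜 U = 0`, then `q = h⁻¹ ∇^γ·(h U)` satisfies
`μ ∇^γ q = U`, and testing `∇^γ·(h U) = h q` with `q` gives `∫ h |U|² = - μ ∫ h q² ≤ 0`. -/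
theorem ae_eq_zero_of_hA {U : Field d} (hd : d = 1 ∨ d = 2) (hM : d = 1 ∨ d ≤ M)
    (H : IsDepth M a b h) (hμ : 0 < μ) (hγ : 0 < γ) (hU : ∀ i, MemLp (U i) 2)
    (hp : HasWeakDiv γ (mulField h U) p) (hpL : MemLp p 2)
    (h0 : ∀ φ, IsTestField φ → hA γ μ h U φ = 0) (i : Fin d) : U i =ᵐ[volume] 0 := by
  have hM' := le_succ_of_dim hM
  set q : Space d → ℝ := fun x => (h x)⁻¹ * p x with hqdef
  have hq : MemLp q 2 := H.memLp_inv_mul hpL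
  have hhU : ∀ i, MemLp (fun x => h x * U i x) 2 := fun i => H.memLp_mul hd hM' (hU i)
  have htest : ∀ i φ, IsTest φ → (∫ x, h x * U i x * φ x) +
      μ * gammaCoeff γ i * ∫ x, q x * weakPartial i (fun x => h x * φ x) x = 0 := by
    intro i φ hφ
    have hφi : IsTestField fun j => if j = i then φ else fun _ => 0 := fun j => by
      by_cases hj : j = i
      · simpa [hj] using hφ
      · simpa [hj] using IsTest.zero
    have h1 := h0 _ hφi
    rw [hA_eq hd hM' H hU hp hpL hφi,
      Finset.sum_eq_single i (fun j _ hj => ?_) (by simp)] at h1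
    · simpa using h1
    · have : weakPartial j (fun _ : Space d => (0 : ℝ)) =ᵐ[volume] fun _ => 0 :=
        (hasWeakPartial_const j 0).weakPartial_ae
      have h2 : ∫ x, (h x)⁻¹ * p x * weakPartial j (fun _ : Space d => (0 : ℝ)) x = 0 := by
        refine integral_eq_zero_of_ae ?_
        filter_upwards [this] with x hx
        rw [hx]
        simp
      simp [hj, h2]
  -- multiplication by `h` is bounded on `H^1`, so test functions may be replaced by `z ∈ H^1`
  have hext : ∀ i z, MemH 1 z → (∫ x, h x * U i x * z x) +
      μ * gammaCoeff γ i * ∫ x, q x * weakPartial i (fun x => h x * z x) x = 0 := by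
    intro i z hz
    obtain ⟨φ, hφ, hlim, _, _⟩ := hz.exists_test_seq
    obtain ⟨C, hC0, hC⟩ := exists_depth_mul_le hd hM' a b (j := 1) (by omega)
    have hlim' : Tendsto (fun n => normH 1 (fun x => h x * φ n x - h x * z x)) atTop (𝓝 0) := by
      have h1 := hlim.const_mul C
      rw [mul_zero] at h1
      refine squeeze_zero (fun n => normH_nonneg _ _) (fun n => ?_) h1
      simp only [← mul_sub]
      exact (hC h _ H (((hφ n).memH 1).sub hz)).2
    have h1 := tendsto_integral_mul (fun n => (hφ n).memLp 2) hz.memLp (hhU i)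
      (tendsto_normH_of_le (Nat.zero_le 1) hlim)
    have hφ' := fun n => (hC h _ H ((hφ n).memH 1)).1
    have hz' := (hC h _ H hz).1
    have h2 := tendsto_integral_mul (fun n => ((hφ' n).weakPartial i).memLp)
      (hz'.weakPartial i).memLp hq (tendsto_normH_weakPartial hφ' hz' hlim' i)
    have h3 := h1.add (h2.const_mul (μ * gammaCoeff γ i))
    refine tendsto_nhds_unique h3 ?_
    simp only [htest i _ (hφ _)]
    exact tendsto_const_nhds
  have hqw : ∀ i, HasWeakPartial i q (fun x => (μ * gammaCoeff γ i)⁻¹ * U i x) := by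
    intro i
    refine ⟨MemLp.locallyIntegrable_two hq, MemLp.locallyIntegrable_two ((hU i).const_mul _),
      fun ψ hψ => ?_⟩
    -- test with `h⁻¹ ψ`
    have h1 := hext i _ (H.inv_mul_test hψ).1
    have e1 : (fun x => h x * ((h x)⁻¹ * ψ x)) = ψ := by
      funext x
      rw [← mul_assoc, mul_inv_cancel₀ (H.h_pos x).ne', one_mul]
    have e2 : ∫ x, h x * U i x * ((h x)⁻¹ * ψ x) = ∫ x, U i x * ψ x := by
      congr 1; funext x
      linear_combination (U i x * ψ x) * mul_inv_cancel₀ (H.h_pos x).ne'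
    have e3 : ∫ x, q x * weakPartial i ψ x = ∫ x, q x * partialDeriv i ψ x := by
      refine integral_congr_ae ?_
      filter_upwards [hψ.weakPartial_ae i] with x hx
      rw [hx]
    rw [e1, e2, e3] at h1
    have e4 : ∫ x, (μ * gammaCoeff γ i)⁻¹ * U i x * ψ x
        = (μ * gammaCoeff γ i)⁻¹ * ∫ x, U i x * ψ x := by
      simp only [mul_assoc, integral_const_mul]
    have e5 := inv_mul_cancel₀ (mul_pos hμ (gammaCoeff_pos hγ i)).ne'
    rw [e4]
    linear_combination (μ * gammaCoeff γ i)⁻¹ * h1 - (∫ x, q x * partialDeriv i ψ x) * e5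
  have hq1 : MemH 1 q := memH_succ hq fun i => ⟨_, hqw i, (hU i).const_mul _⟩
  have key := hp.integral_mul_weakPartial hhU hpL hq1
  have hlow : ∀ i, a⁻¹ * (μ⁻¹ * ∫ x, U i x ^ 2)
      ≤ gammaCoeff γ i * ∫ x, mulField h U i x * weakPartial i q x := by
    intro i
    rw [← integral_const_mul, ← integral_const_mul, ← integral_const_mul]
    have hint : Integrable (fun x => gammaCoeff γ i * (mulField h U i x * weakPartial i q x)) :=
      (MemLp.integrable_mul_two (hhU i) (hq1.weakPartial i).memLp).const_mul _
    refine integral_mono_ae (((hU i).integrable_sq.const_mul _).const_mul _) hint ?_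
    filter_upwards [(hqw i).weakPartial_ae] with x hx
    rw [hx]
    have e : gammaCoeff γ i * (mulField h U i x * ((μ * gammaCoeff γ i)⁻¹ * U i x))
        = h x * (μ⁻¹ * U i x ^ 2) := by
      have := (gammaCoeff_pos hγ i).ne'
      simp only [mulField]
      field_simp
    rw [e]
    exact mul_le_mul_of_nonneg_right (H.le x) (by positivity)
  have hpq : 0 ≤ ∫ x, p x * q x := integral_nonneg fun x => by
    have : p x * q x = (h x)⁻¹ * p x ^ 2 := by simp only [hqdef]; ring
    rw [Pi.zero_apply, this]
    exact mul_nonneg (inv_nonneg.2 (H.h_pos x).le) (sq_nonneg _)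
  have hsq : ∀ i, 0 ≤ ∫ x, U i x ^ 2 := fun i => integral_nonneg fun x => sq_nonneg _
  have hc : 0 < a⁻¹ * μ⁻¹ := mul_pos (inv_pos.2 H.pos) (inv_pos.2 hμ)
  have hsum := Finset.sum_le_sum fun i (_ : i ∈ Finset.univ) => hlow i
  have hone := Finset.single_le_sum (f := fun i => a⁻¹ * (μ⁻¹ * ∫ x, U i x ^ 2))
    (fun i _ => by rw [← mul_assoc]; exact mul_nonneg hc.le (hsq i)) (Finset.mem_univ i)
  simp only [← mul_assoc] at hone hsum key
  refine ae_eq_zero_of_integral_sq_nonpos (hU i) ?_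
  by_contra hcon
  have := mul_pos hc (not_le.1 hcon)
  linarith

theorem isInverse_of_hA_eq {S : Functional d} (hd : d = 1 ∨ d = 2) (hM : d = 1 ∨ d ≤ M)
    (H : IsDepth M a b h) (hμ : 0 < μ) (hγ : 0 < γ) (hV : MemX γ 0 V)
    (hS : DistribEq (hA γ μ h V) S) : IsInverse γ μ h S V where
  memX := hV
  memX_mul := hV.mulField hd hM H
  eq := hS
  unique W hW hWS i := by
    have hM' := le_succ_of_dim hM
    obtain ⟨-, p, hp, hpL⟩ := hV.mulField hd hM H
    obtain ⟨-, p', hp', hpL'⟩ := hW.mulField hd hM H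
    have hL : ∀ i, MemLp (fun x => W i x - V i x) 2 := fun i => (hW.1 i).sub (hV.1 i)
    have hdiv : HasWeakDiv γ (mulField h fun i x => W i x - V i x) (fun x => p' x - p x) :=
      (hp'.sub hp).congr (fun i => Eventually.of_forall fun x => by simp only [mulField]; ring)
        (ae_eq_refl _)
    have hz := ae_eq_zero_of_hA hd hM H hμ hγ hL hdiv (MemLp.sub hpL' hpL) (fun φ hφ => ?_) i
    · filter_upwards [hz] with x hx
      simpa [sub_eq_zero] using hx
    have h1 := (hWS φ hφ).trans (hS φ hφ).symm
    rw [hA_eq hd hM' H hW.1 hp' hpL' hφ, hA_eq hd hM' H hV.1 hp hpL hφ, ← sub_eq_zero,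
      ← Finset.sum_sub_distrib] at h1
    rw [hA_eq hd hM' H hL hdiv (MemLp.sub hpL' hpL) hφ, ← h1]
    refine Finset.sum_congr rfl fun i _ => ?_
    have hm := (H.mul_test hd hM' (hφ i)).1
    have e1 : ∫ x, h x * (W i x - V i x) * φ i x
        = (∫ x, h x * W i x * φ i x) - ∫ x, h x * V i x * φ i x := by
      rw [← integral_sub (MemLp.integrable_mul_two (H.memLp_mul hd hM' (hW.1 i)) ((hφ i).memLp 2))
        (MemLp.integrable_mul_two (H.memLp_mul hd hM' (hV.1 i)) ((hφ i).memLp 2))]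
      congr 1; funext x; ring
    have e2 : ∫ x, (h x)⁻¹ * (p' x - p x) * weakPartial i (fun x => h x * φ i x) x
        = (∫ x, (h x)⁻¹ * p' x * weakPartial i (fun x => h x * φ i x) x)
          - ∫ x, (h x)⁻¹ * p x * weakPartial i (fun x => h x * φ i x) x := by
      rw [← integral_sub (MemLp.integrable_mul_two (H.memLp_inv_mul hpL') (hm.weakPartial i).memLp)
        (MemLp.integrable_mul_two (H.memLp_inv_mul hpL) (hm.weakPartial i).memLp)]
      congr 1; funext x; ring
    rw [e1, e2]
    ring

/-! ### Inversion on vector fields -/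

theorem normHVec_le_sum (N : ℕ) (V : Field d) : normHVec N V ≤ ∑ i, normH N (V i) := by
  refine Real.sqrt_le_iff.2 ⟨Finset.sum_nonneg fun i _ => normH_nonneg _ _, ?_⟩
  simp only [← normH_sq]
  exact Finset.sum_sq_le_sq_sum_of_nonneg fun i _ => normH_nonneg _ _

theorem normH_le_normHVec (N : ℕ) (V : Field d) (i : Fin d) : normH N (V i) ≤ normHVec N V :=
  Real.sqrt_le_sqrt (Finset.single_le_sum (f := fun i => normHSq N (V i))
    (fun _ _ => normHSq_nonneg _ _) (Finset.mem_univ i))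

theorem normX_le (hμ : 0 ≤ μ) (N : ℕ) (V : Field d) :
    normX γ μ N V ≤ (∑ i, normH N (V i)) + √μ * normH N (weakDiv γ V) := by
  have h1 := normHVec_le_sum N V
  have h0 : 0 ≤ normHVec N V := Real.sqrt_nonneg _
  have h2 : 0 ≤ √μ * normH N (weakDiv γ V) := mul_nonneg (Real.sqrt_nonneg _) (normH_nonneg _ _)
  refine Real.sqrt_le_iff.2 ⟨by linarith, ?_⟩
  have h3 : μ * normH N (weakDiv γ V) ^ 2 = (√μ * normH N (weakDiv γ V)) ^ 2 := by
    rw [mul_pow, Real.sq_sqrt hμ]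
  rw [h3]
  nlinarith

theorem gammaCoeff_le_of_le {γ Γ : ℝ} (hΓ : γ ≤ Γ) (i : Fin d) : gammaCoeff γ i ≤ max 1 Γ :=
  (gammaCoeff_le γ i).trans (max_le_max le_rfl hΓ)

/-- Regularity of the divergence: `∇^γ·V` is controlled by `V` and by
`q = h⁻¹ ∇^γ·(h V)`. In dimension one and for `M = 0` the product `h' V` is only under control
because `h V ∈ H^{N+1}`. -/
theorem exists_normH_weakDiv_le {M : ℕ} (hd : d = 1 ∨ d = 2) (hM : d = 1 ∨ d ≤ M) (a b Γ : ℝ)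
    {N : ℕ} (hN : N ≤ M) : ∃ C, 0 ≤ C ∧ ∀ (h : Space d → ℝ) (γ : ℝ) (V : Field d)
      (q : Space d → ℝ), IsDepth M a b h → 0 < γ → γ ≤ Γ → MemHVec N V → MemH N q →
      HasWeakDiv γ (mulField h V) (fun x => h x * q x) →
      MemX γ N V ∧ normH N (weakDiv γ V) ≤ C * (normH N q + ∑ i, normH N (V i)) := by
  have hM' := le_succ_of_dim hM
  by_cases hdM : d ≤ M
  · obtain ⟨C₁, hC₁, h1⟩ := exists_depthPartial_mul_le hd hdM a b hN
    obtain ⟨C₂, hC₂, h2⟩ := exists_depth_inv_mul_le hd hM a b (j := N) (by omega)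
    have hΓ0 : (0 : ℝ) ≤ max 1 Γ := zero_le_one.trans (le_max_left _ _)
    refine ⟨1 + max 1 Γ * (C₂ * C₁), by positivity, fun h γ V q H hγ hγΓ hV hq hdiv => ?_⟩
    have hh : ∀ x, h x ≠ 0 := fun x => (H.h_pos x).ne'
    have hG : ∀ i, MemH N (fun x => (h x)⁻¹ * (depthPartial h i x * V i x)) ∧
        normH N (fun x => (h x)⁻¹ * (depthPartial h i x * V i x))
          ≤ C₂ * C₁ * normH N (V i) := by
      intro i
      have e1 := h1 h _ H (hV i) i
      have e2 := h2 h _ H e1.1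
      refine ⟨e2.1, e2.2.trans ?_⟩
      rw [mul_assoc]
      exact mul_le_mul_of_nonneg_left e1.2 hC₂
    have hprod := hdiv.mul (m := fun x => (h x)⁻¹)
      (m' := fun i x => -((h x)⁻¹ * ((h x)⁻¹ * depthPartial h i x)))
      (fun i => H.memLp_mul hd hM' (hV i).memLp) (H.memLp_mul hd hM' hq.memLp)
      (fun φ hφ => H.inv_mul_test hφ)
      (fun i => H.memLp_inv_mul (H.memLp_mul hd hM' (hV i).memLp))
      (H.memLp_inv_mul (H.memLp_mul hd hM' hq.memLp)) (fun i => by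
        refine (memLp_congr_ae (Eventually.of_forall fun x => ?_)).1 ((hG i).1.memLp.const_mul (-1))
        have := hh x
        simp only [mulField]
        field_simp)
    have hdivV : HasWeakDiv γ V
        (fun x => q x - ∑ i, gammaCoeff γ i * ((h x)⁻¹ * (depthPartial h i x * V i x))) := by
      refine hprod.congr (fun i => Eventually.of_forall fun x => ?_)
        (Eventually.of_forall fun x => ?_)
      · simp only [mulField]
        rw [← mul_assoc, inv_mul_cancel₀ (hh x), one_mul]
      · simp only
        rw [← mul_assoc, inv_mul_cancel₀ (hh x), one_mul, sub_eq_add_neg, ← Finset.sum_neg_distrib]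
        congr 1
        refine Finset.sum_congr rfl fun i _ => ?_
        have := hh x
        simp only [mulField]
        field_simp
    have hs : ∀ i ∈ Finset.univ, MemH N
        (fun x => gammaCoeff γ i * ((h x)⁻¹ * (depthPartial h i x * V i x))) := fun i _ =>
      (hG i).1.const_mul _
    have hmem := hq.sub (MemH.sum _ hs)
    refine ⟨⟨hV, _, hdivV, hmem⟩, ?_⟩
    rw [normH_congr hdivV.weakDiv_ae]
    refine (normH_sub_le hq (MemH.sum _ hs)).trans ?_
    have e3 : normH N (fun x => ∑ i, gammaCoeff γ i * ((h x)⁻¹ * (depthPartial h i x * V i x)))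
        ≤ max 1 Γ * (C₂ * C₁) * ∑ i, normH N (V i) := by
      refine (normH_sum_le _ hs).trans ?_
      rw [Finset.mul_sum]
      refine Finset.sum_le_sum fun i _ => ?_
      rw [normH_const_mul (hG i).1, abs_of_pos (gammaCoeff_pos hγ i), mul_assoc]
      exact mul_le_mul (gammaCoeff_le_of_le hγΓ i) (hG i).2 (normH_nonneg _ _) hΓ0
    have e4 : 0 ≤ ∑ i, normH N (V i) := Finset.sum_nonneg fun i _ => normH_nonneg _ _
    have e5 : 0 ≤ max 1 Γ * (C₂ * C₁) * normH N q := by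
      have := normH_nonneg N q
      positivity
    linarith
  · have hd1 : d = 1 := by omega
    obtain ⟨C₁, hC₁, h1⟩ := exists_depth_mul_le hd hM' a b (j := N) (by omega)
    obtain ⟨C₂, hC₂, h2⟩ := exists_depth_inv_mul_le hd hM a b (j := N + 1) (by omega)
    refine ⟨C₂ * C₁, by positivity, fun h γ V q H hγ hγΓ hV hq hdiv => ?_⟩
    have hh : ∀ x, h x ≠ 0 := fun x => (H.h_pos x).ne'
    subst hd1
    have hw := hdiv.hasWeakPartial rfl 0
    have hVN := h1 h _ H (hV 0)
    have hqN := h1 h _ H hq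
    have hU : MemH (N + 1) (mulField h V 0) := ⟨hVN.1, fun j => by
      rw [Subsingleton.elim j 0]
      exact ⟨_, hw, hqN.1⟩⟩
    have hUn : normH (N + 1) (mulField h V 0) ≤ C₁ * (normH N q + normH N (V 0)) := by
      refine (normH_succ_le N _).trans ?_
      rw [Fin.sum_univ_one, normH_congr hw.weakPartial_ae]
      have e1 := hVN.2
      have e2 := hqN.2
      change normH N (fun x => h x * V 0 x) + _ ≤ _
      linarith
    have hV1 := h2 h _ H hU
    have eV : (fun x => (h x)⁻¹ * mulField h V 0 x) = V 0 := by
      funext x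
      simp only [mulField]
      rw [← mul_assoc, inv_mul_cancel₀ (hh x), one_mul]
    rw [eV] at hV1
    have hVd : HasWeakDiv γ V (fun x => ∑ i, gammaCoeff γ i * weakPartial i (V i) x) :=
      hasWeakDiv_of_hasWeakPartial fun i => by
        rw [Subsingleton.elim i 0]
        exact hV1.1.hasWeakPartial 0
    have hVd' : HasWeakDiv γ V (weakPartial 0 (V 0)) :=
      hVd.congr (fun i => ae_eq_refl _) (Eventually.of_forall fun x => by simp [gammaCoeff])
    refine ⟨⟨hV, _, hVd', hV1.1.weakPartial 0⟩, ?_⟩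
    rw [normH_congr hVd'.weakDiv_ae, Fin.sum_univ_one, mul_assoc]
    exact (normH_weakPartial_le _ _ _).trans (hV1.2.trans (mul_le_mul_of_nonneg_left hUn hC₂))

/-- The flux of a solution of the elliptic equation, rescaled by `κ`, has the divergence
`κ (h p - r)`. -/
theorem IsEllipticSolution.hasWeakDiv {r s : Space d → ℝ} {F U : Field d}
    (hs : IsEllipticSolution h μ γ r F p) (κ : ℝ) (hU : ∀ i, MemLp (U i) 2) (hsL : MemLp s 2)
    (hUF : ∀ i x, gammaCoeff γ i * U i x =
      κ * (μ * gammaCoeff γ i ^ 2 * (h x * weakPartial i p x) + gammaCoeff γ i * F i x))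
    (hsr : ∀ x, s x = κ * (h x * p x - r x)) : HasWeakDiv γ U s where
  locInt i := MemLp.locallyIntegrable_two (hU i)
  locInt_div := MemLp.locallyIntegrable_two hsL
  integral_eq φ hφ := by
    have h1 := hs.eq φ hφ
    have e1 : ∀ i, gammaCoeff γ i * ∫ x, U i x * partialDeriv i φ x =
        κ * ∫ x, (μ * gammaCoeff γ i ^ 2 * (h x * weakPartial i p x) + gammaCoeff γ i * F i x)
          * partialDeriv i φ x := by
      intro i
      rw [← integral_const_mul, ← integral_const_mul]
      congr 1; funext x
      linear_combination partialDeriv i φ x * hUF i x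
    have e2 : ∫ x, s x * φ x = κ * ∫ x, (h x * p x - r x) * φ x := by
      rw [← integral_const_mul]
      congr 1; funext x
      linear_combination φ x * hsr x
    rw [Finset.sum_congr rfl fun i _ => e1 i, ← Finset.mul_sum, e2]
    linear_combination κ * h1

/-- The inverse of `h 𝒜` on vector fields: with `q` the solution of
`h q - μ ∇^γ·(h ∇^γ q) = ∇^γ·f`, the solution of `h 𝒜 V = f` is `V = μ ∇^γ q + h⁻¹ f`. -/
theorem exists_isInverse_ofField {M : ℕ} (hd : d = 1 ∨ d = 2) (hM : d = 1 ∨ d ≤ M)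
    (a b m Γ : ℝ) {N : ℕ} (hN : N ≤ M) : ∃ C, 0 ≤ C ∧ ∀ (h : Space d → ℝ) (μ γ : ℝ) (f : Field d),
      IsDepth M a b h → 0 < μ → μ ≤ m → 0 < γ → γ ≤ Γ → MemHVec N f →
      ∃ V, IsInverse γ μ h (ofField f) V ∧ MemX γ N V ∧
        normX γ μ N V ≤ C * ∑ i, normH N (f i) := by
  have hM' := le_succ_of_dim hM
  obtain ⟨C₀, hC₀, hsol⟩ := exists_solSize_le hd hM a b hN
  obtain ⟨C₂, hC₂, hinv⟩ := exists_depth_inv_mul_le hd hM a b (j := N) (by omega)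
  obtain ⟨C₃, hC₃, hdivle⟩ := exists_normH_weakDiv_le hd hM a b Γ hN
  refine ⟨(1 + √m * C₃) * (d * C₀ + C₂) + C₃ * C₀, by positivity,
    fun h μ γ f H hμ hμm hγ hγΓ hf => ?_⟩
  have hsμ := Real.sqrt_pos.2 hμ
  have hf0 : ∀ i, MemLp (f i) 2 := fun i => (hf i).memLp
  obtain ⟨q, hq⟩ := exists_isEllipticSolution hd hM' H hμ hγ (MemH.zero.memLp (k := 0)) hf0
  have hqN := hq.memH_succ hd hM H hμ hγ hN MemH.zero hf
  have hqs := hsol h μ γ _ f q H hμ hγ MemH.zero hf hq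
  set S := ∑ i, normH N (f i) with hS
  have hS0 : 0 ≤ S := Finset.sum_nonneg fun i _ => normH_nonneg _ _
  have hqs' : √μ * solSize μ γ N q ≤ C₀ * S := by
    have h1 := mul_le_mul_of_nonneg_left hqs hsμ.le
    rw [dataSize, normH_zero, zero_add, ← Finset.mul_sum] at h1
    refine h1.trans (le_of_eq ?_)
    linear_combination (C₀ * S) * mul_inv_cancel₀ hsμ.ne'
  have hq1 : MemH 1 q := hq.memH
  set V : Field d := fun i x => μ * gammaCoeff γ i * weakPartial i q x + (h x)⁻¹ * f i x with hV
  have hfi := fun i => hinv h _ H (hf i)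
  have hVm : MemHVec N V := fun i => ((MemH.weakPartial hqN i).const_mul _).add (hfi i).1
  have hVn : ∑ i, normH N (V i) ≤ (d * C₀ + C₂) * S := by
    have e1 : ∀ i, normH N (V i) ≤ C₀ * S + C₂ * normH N (f i) := by
      intro i
      refine (normH_add_le ((MemH.weakPartial hqN i).const_mul _) (hfi i).1).trans
        (add_le_add ?_ (hfi i).2)
      rw [normH_const_mul (MemH.weakPartial hqN i),
        abs_of_pos (mul_pos hμ (gammaCoeff_pos hγ i))]
      refine le_trans (le_of_eq ?_) ((mul_le_mul_of_nonneg_left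
        (normH_weakPartial_le_solSize hγ N q i) hsμ.le).trans hqs')
      linear_combination (-(gammaCoeff γ i * normH N (weakPartial i q))) * Real.mul_self_sqrt hμ.le
    refine (Finset.sum_le_sum fun i _ => e1 i).trans (le_of_eq ?_)
    rw [Finset.sum_add_distrib, Finset.sum_const, Finset.card_univ, Fintype.card_fin,
      nsmul_eq_mul, ← Finset.mul_sum]
    ring
  have hh : ∀ x, h x ≠ 0 := fun x => (H.h_pos x).ne'
  have hVL : ∀ i, MemLp (V i) 2 := fun i => (hVm i).memLp
  have hhq : MemLp (fun x => h x * q x) 2 := H.memLp_mul hd hM' hq1.memLp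
  have hdiv : HasWeakDiv γ (mulField h V) (fun x => h x * q x) :=
    hq.hasWeakDiv 1 (fun i => H.memLp_mul hd hM' (hVL i)) hhq (fun i x => by
      have := hh x
      simp only [mulField, hV]
      field_simp) (fun x => by ring)
  obtain ⟨hX, hXn⟩ := hdivle h γ V q H hγ hγΓ hVm hqN.of_succ hdiv
  have hX0 : MemX γ 0 V := ⟨hVL, _, hX.2.choose_spec.1, hX.2.choose_spec.2.memLp⟩
  refine ⟨V, isInverse_of_hA_eq hd hM H hμ hγ hX0 fun φ hφ => ?_, hX, ?_⟩
  · rw [hA_eq hd hM' H hVL hdiv hhq hφ, ofField, integral_finsetSum _ fun i _ =>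
      MemLp.integrable_mul_two (hf0 i) ((hφ i).memLp 2)]
    refine Finset.sum_congr rfl fun i _ => ?_
    have hz := (H.mul_test hd hM' (hφ i)).1
    have h1 := (hq1.hasWeakPartial i).integral_mul_weakPartial hq1.memLp
      (hq1.weakPartial i).memLp hz
    have e1 : ∫ x, (h x)⁻¹ * (h x * q x) * weakPartial i (fun x => h x * φ i x) x
        = ∫ x, q x * weakPartial i (fun x => h x * φ i x) x := by
      congr 1; funext x
      rw [← mul_assoc (h x)⁻¹, inv_mul_cancel₀ (hh x), one_mul]
    have e2 : ∫ x, h x * V i x * φ i x = μ * gammaCoeff γ i *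
        (∫ x, weakPartial i q x * (h x * φ i x)) + ∫ x, f i x * φ i x := by
      rw [← integral_const_mul, ← integral_add ((MemLp.integrable_mul_two (hq1.weakPartial i).memLp
        hz.memLp).const_mul _) (MemLp.integrable_mul_two (hf0 i) ((hφ i).memLp 2))]
      congr 1; funext x
      have := hh x
      simp only [hV]
      field_simp
    rw [e1, h1, e2]
    ring
  · have e1 : √μ * normH N q ≤ C₀ * S :=
      (mul_le_mul_of_nonneg_left (normH_le_solSize hγ N q) hsμ.le).trans hqs'
    have e2 := mul_le_mul_of_nonneg_left hXn hsμ.le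
    have e3 : √μ * ∑ i, normH N (V i) ≤ √m * ((d * C₀ + C₂) * S) :=
      mul_le_mul (Real.sqrt_le_sqrt hμm) hVn (Finset.sum_nonneg fun i _ => normH_nonneg _ _)
        (Real.sqrt_nonneg _)
    have e4 := mul_le_mul_of_nonneg_left (add_le_add e1 e3) hC₃
    have e5 := normX_le (γ := γ) hμ.le N V
    linarith

end Inversion

/-! ### Inversion on gradients -/

/-- The solution of `h 𝒜 V = ∇^γ g` for `d ≤ M`: with `p` the solution of
`h p - μ ∇^γ·(h ∇^γ p) = g + μ ∇^γ·(h⁻¹ g ∇^γ h)`, it is `V = ∇^γ p + h⁻² g ∇^γ h`, and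
`q = h⁻¹ ∇^γ·(h V) = (p - h⁻¹ g) / μ`. -/
theorem exists_hA_eq_gradGamma {M : ℕ} (hd : d = 1 ∨ d = 2) (hM : d ≤ M) (a b m Γ : ℝ) {N : ℕ}
    (hN : N ≤ M) : ∃ C, 0 ≤ C ∧ ∀ (h : Space d → ℝ) (μ γ : ℝ) (g : Space d → ℝ),
      IsDepth M a b h → 0 < μ → μ ≤ m → 0 < γ → γ ≤ Γ → MemH N g →
      ∃ (V : Field d) (q : Space d → ℝ), MemHVec N V ∧ MemH N q ∧
        HasWeakDiv γ (mulField h V) (fun x => h x * q x) ∧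
        DistribEq (hA γ μ h V) (gradGamma γ g) ∧
        √μ * ∑ i, normH N (V i) ≤ C * normH N g ∧ μ * normH N q ≤ C * normH N g := by
  have hM' : d ≤ M + 1 := by omega
  obtain ⟨C₀, hC₀, hsol⟩ := exists_solSize_le hd (Or.inr hM) a b hN
  obtain ⟨C₁, hC₁, hpart⟩ := exists_depthPartial_mul_le hd hM a b hN
  obtain ⟨C₂, hC₂, hinv⟩ := exists_depth_inv_mul_le hd (Or.inr hM) a b (j := N) (by omega)
  have hΓ0 : (0 : ℝ) ≤ max 1 Γ := zero_le_one.trans (le_max_left _ _)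
  set K := √m * max 1 Γ with hK
  have hK0 : 0 ≤ K := mul_nonneg (Real.sqrt_nonneg _) hΓ0
  refine ⟨C₀ * (1 + d * (K * (C₂ * C₁))) + d * (K * (C₂ * (C₂ * C₁))) + C₂, by positivity,
    fun h μ γ g H hμ hμm hγ hγΓ hg => ?_⟩
  have hsμ := Real.sqrt_pos.2 hμ
  have hss := Real.mul_self_sqrt hμ.le
  have hh : ∀ x, h x ≠ 0 := fun x => (H.h_pos x).ne'
  have hKγ : ∀ i : Fin d, √μ * gammaCoeff γ i ≤ K := fun i =>
    mul_le_mul (Real.sqrt_le_sqrt hμm) (gammaCoeff_le_of_le hγΓ i) (gammaCoeff_pos hγ i).le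
      (Real.sqrt_nonneg _)
  set G : Field d := fun i x => (h x)⁻¹ * (depthPartial h i x * g x) with hGdef
  have hg0 := normH_nonneg N g
  have hG : ∀ i, MemH N (G i) ∧ normH N (G i) ≤ C₂ * C₁ * normH N g := by
    intro i
    have e1 := hpart h _ H hg i
    have e2 := hinv h _ H e1.1
    refine ⟨e2.1, e2.2.trans ?_⟩
    rw [mul_assoc]
    exact mul_le_mul_of_nonneg_left e1.2 hC₂
  have hG' : ∀ i, MemH N (fun x => (h x)⁻¹ * G i x) ∧
      normH N (fun x => (h x)⁻¹ * G i x) ≤ C₂ * (C₂ * C₁) * normH N g := by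
    intro i
    have e2 := hinv h _ H (hG i).1
    refine ⟨e2.1, e2.2.trans ?_⟩
    rw [mul_assoc]
    exact mul_le_mul_of_nonneg_left (hG i).2 hC₂
  have hhg := hinv h _ H hg
  have hFm : ∀ i, MemH N (fun x => μ * gammaCoeff γ i * G i x) := fun i => (hG i).1.const_mul _
  obtain ⟨p, hp⟩ := exists_isEllipticSolution hd hM' H hμ hγ hg.memLp fun i => (hFm i).memLp
  have hpN := hp.memH_succ hd (Or.inr hM) H hμ hγ hN hg hFm
  have hps := hsol h μ γ g _ p H hμ hγ hg hFm hp
  have hdata : dataSize μ N g (fun i x => μ * gammaCoeff γ i * G i x)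
      ≤ (1 + d * (K * (C₂ * C₁))) * normH N g := by
    have e1 : ∀ i, (√μ)⁻¹ * normH N (fun x => μ * gammaCoeff γ i * G i x)
        ≤ K * (C₂ * C₁ * normH N g) := by
      intro i
      rw [normH_const_mul (hG i).1, abs_of_pos (mul_pos hμ (gammaCoeff_pos hγ i))]
      have e2 : (√μ)⁻¹ * μ = √μ := by rw [inv_mul_eq_div, Real.div_sqrt]
      rw [show (√μ)⁻¹ * (μ * gammaCoeff γ i * normH N (G i))
        = √μ * gammaCoeff γ i * normH N (G i) from by
          linear_combination (gammaCoeff γ i * normH N (G i)) * e2]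
      exact mul_le_mul (hKγ i) (hG i).2 (normH_nonneg _ _) hK0
    have e2 := Finset.sum_le_sum fun i (_ : i ∈ Finset.univ) => e1 i
    rw [Finset.sum_const, Finset.card_univ, Fintype.card_fin, nsmul_eq_mul] at e2
    unfold dataSize
    linarith
  have hps' : solSize μ γ N p ≤ C₀ * (1 + d * (K * (C₂ * C₁))) * normH N g := by
    rw [mul_assoc]
    exact hps.trans (mul_le_mul_of_nonneg_left hdata hC₀)
  have hp1 : MemH 1 p := hp.memH
  have hpi := fun i => MemH.weakPartial hpN i
  set V : Field d := fun i x => gammaCoeff γ i * weakPartial i p x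
    + gammaCoeff γ i * ((h x)⁻¹ * G i x) with hV
  set q : Space d → ℝ := fun x => μ⁻¹ * (p x - (h x)⁻¹ * g x) with hq
  have hVm : MemHVec N V := fun i => ((hpi i).const_mul _).add ((hG' i).1.const_mul _)
  have hpg : MemH N (fun x => p x - (h x)⁻¹ * g x) := hpN.of_succ.sub hhg.1
  have hqm : MemH N q := hpg.const_mul _
  have hVL : ∀ i, MemLp (V i) 2 := fun i => (hVm i).memLp
  have hhq : MemLp (fun x => h x * q x) 2 := H.memLp_mul hd hM' hqm.memLp
  have hdiv : HasWeakDiv γ (mulField h V) (fun x => h x * q x) :=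
    hp.hasWeakDiv μ⁻¹ (fun i => H.memLp_mul hd hM' (hVL i)) hhq (fun i x => by
      have := hh x
      have := hμ.ne'
      simp only [mulField, hV]
      field_simp) (fun x => by
      have := hh x
      simp only [hq]
      field_simp)
  refine ⟨V, q, hVm, hqm, hdiv, fun φ hφ => ?_, ?_, ?_⟩
  · have hgi : ∀ i, Integrable (fun x => gammaCoeff γ i * (g x * partialDeriv i (φ i) x)) :=
      fun i => (MemLp.integrable_mul_two hg.memLp (((hφ i).partialDeriv i).memLp 2)).const_mul _
    have e0 : ∫ x, g x * divGamma γ φ x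
        = ∑ i, gammaCoeff γ i * ∫ x, g x * partialDeriv i (φ i) x := by
      simp only [← integral_const_mul]
      rw [← integral_finsetSum _ fun i _ => hgi i]
      congr 1; funext x
      rw [divGamma, Finset.mul_sum]
      exact Finset.sum_congr rfl fun i _ => by ring
    rw [hA_eq hd hM' H hVL hdiv hhq hφ, gradGamma, e0, ← Finset.sum_neg_distrib]
    refine Finset.sum_congr rfl fun i _ => ?_
    obtain ⟨hz, hzi⟩ := H.mul_test hd hM' (hφ i)
    have h1 := (hp1.hasWeakPartial i).integral_mul_weakPartial hp1.memLp
      (hp1.weakPartial i).memLp hz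
    have hzL := (hz.weakPartial i).memLp
    have hφL := (hφ i).memLp 2
    have e1 : ∫ x, (h x)⁻¹ * (h x * q x) * weakPartial i (fun x => h x * φ i x) x
        = μ⁻¹ * ((∫ x, p x * weakPartial i (fun x => h x * φ i x) x)
          - ∫ x, (h x)⁻¹ * g x * weakPartial i (fun x => h x * φ i x) x) := by
      rw [← integral_sub (MemLp.integrable_mul_two hp1.memLp hzL)
        (MemLp.integrable_mul_two hhg.1.memLp hzL), ← integral_const_mul]
      congr 1; funext x
      have := hh x
      simp only [hq]
      field_simp
    have e2 : ∫ x, (h x)⁻¹ * g x * weakPartial i (fun x => h x * φ i x) x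
        = (∫ x, g x * partialDeriv i (φ i) x) + ∫ x, G i x * φ i x := by
      rw [← integral_add (MemLp.integrable_mul_two hg.memLp (((hφ i).partialDeriv i).memLp 2))
        (MemLp.integrable_mul_two (hG i).1.memLp hφL)]
      refine integral_congr_ae ?_
      filter_upwards [(hzi i).weakPartial_ae] with x hx
      have := hh x
      rw [hx]
      simp only [hGdef]
      field_simp
    have e3 : ∫ x, h x * V i x * φ i x = gammaCoeff γ i *
        (∫ x, weakPartial i p x * (h x * φ i x)) + gammaCoeff γ i * ∫ x, G i x * φ i x := by
      rw [← integral_const_mul, ← integral_const_mul,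
        ← integral_add ((MemLp.integrable_mul_two (hp1.weakPartial i).memLp hz.memLp).const_mul _)
          ((MemLp.integrable_mul_two (hG i).1.memLp hφL).const_mul _)]
      congr 1; funext x
      have := hh x
      simp only [hV]
      field_simp
    rw [e1, e2, e3, h1]
    have := hμ.ne'
    field_simp
    ring
  · have e1 : ∀ i, √μ * normH N (V i) ≤ √μ * gammaCoeff γ i * normH N (weakPartial i p)
        + K * (C₂ * (C₂ * C₁) * normH N g) := by
      intro i
      have e2 := normH_add_le ((hpi i).const_mul (gammaCoeff γ i))
        ((hG' i).1.const_mul (gammaCoeff γ i))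
      rw [normH_const_mul (hpi i), normH_const_mul (hG' i).1,
        abs_of_pos (gammaCoeff_pos hγ i)] at e2
      have e3 := mul_le_mul_of_nonneg_left e2 hsμ.le
      have e4 := mul_le_mul (hKγ i) (hG' i).2 (normH_nonneg _ _) hK0
      change √μ * normH N (V i) ≤ _ at e3
      linarith
    have e2 := Finset.sum_le_sum fun i (_ : i ∈ Finset.univ) => e1 i
    rw [Finset.sum_add_distrib, Finset.sum_const, Finset.card_univ, Fintype.card_fin,
      nsmul_eq_mul] at e2
    have e3 : ∑ i, √μ * gammaCoeff γ i * normH N (weakPartial i p) ≤ solSize μ γ N p :=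
      le_add_of_nonneg_left (normH_nonneg _ _)
    have e4 : 0 ≤ C₂ * normH N g := mul_nonneg hC₂ hg0
    rw [Finset.mul_sum]
    linarith
  · have e1 : μ * normH N q = normH N (fun x => p x - (h x)⁻¹ * g x) := by
      rw [normH_const_mul hpg, abs_of_pos (inv_pos.2 hμ), ← mul_assoc, mul_inv_cancel₀ hμ.ne',
        one_mul]
    rw [e1]
    have e2 := normH_sub_le hpN.of_succ hhg.1
    have e3 := normH_le_solSize (μ := μ) hγ N p
    have e4 := hhg.2
    have e5 : 0 ≤ d * (K * (C₂ * (C₂ * C₁))) * normH N g := by positivity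
    linarith

/-- The solution of `h 𝒜 V = ∂_x g` in dimension one, for `g ∈ L²`. Here `h' g` need not be in
`L²`; instead `U = h V` is obtained from the weak formulation
`∫ h⁻¹ U z + μ ∫ h⁻¹ U' z' = - ∫ g (h⁻¹ z)'`. -/
theorem exists_hA_eq_gradGamma_one (M : ℕ) (a b m : ℝ) :
    ∃ C, 0 ≤ C ∧ ∀ (h : Space 1 → ℝ) (μ γ : ℝ) (g : Space 1 → ℝ),
      IsDepth M a b h → 0 < μ → μ ≤ m → 0 < γ → MemH 0 g →
      ∃ (V : Field 1) (q : Space 1 → ℝ), MemHVec 0 V ∧ MemH 0 q ∧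
        HasWeakDiv γ (mulField h V) (fun x => h x * q x) ∧
        DistribEq (hA γ μ h V) (gradGamma γ g) ∧
        √μ * ∑ i, normH 0 (V i) ≤ C * normH 0 g ∧ μ * normH 0 q ≤ C * normH 0 g := by
  have hd : (1 : ℕ) = 1 ∨ (1 : ℕ) = 2 := Or.inl rfl
  have hM' : 1 ≤ M + 1 := by omega
  obtain ⟨C₁, hC₁, hinv⟩ := exists_depth_inv_mul_le hd (Or.inl rfl : 1 = 1 ∨ 1 ≤ M) a b (j := 1) hM'
  obtain ⟨C₂, hC₂, hinv0⟩ := exists_depth_inv_mul_le hd (Or.inl rfl : 1 = 1 ∨ 1 ≤ M) a b (j := 0)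
    (by omega)
  set B := 1 + 2 * |b| with hB
  have hB0 : 0 < B := by positivity
  refine ⟨C₂ * (2 * B * (C₁ * (√m + 1))), by positivity, fun h μ γ g H hμ hμm hγ hg => ?_⟩
  have hh : ∀ x, h x ≠ 0 := fun x => (H.h_pos x).ne'
  have hγ0 : gammaCoeff γ (0 : Fin 1) = 1 := by simp [gammaCoeff]
  have hgL : MemLp g 2 := hg
  have hlow : ∀ᵐ x, B⁻¹ ≤ (h x)⁻¹ := by
    filter_upwards [H.ae_le hd hM'] with x hx
    exact inv_anti₀ (H.h_pos x) ((le_abs_self _).trans hx)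
  have key := exists_ellipticForm_eq (d := 1) H.aesm_inv (inv_pos.2 hB0) hlow
    (Eventually.of_forall H.inv_le) hμ hγ
    (fun z => -∫ x, g x * weakPartial 0 (fun x => (h x)⁻¹ * z x) x) (C := normH 0 g * C₁)
  have hkey : ∃ U, MemH 1 U ∧ ∀ z, MemH 1 z → ellipticForm (fun x => (h x)⁻¹) μ γ U z
      = -∫ x, g x * weakPartial 0 (fun x => (h x)⁻¹ * z x) x := by
    refine key (fun z z' hz hz' => ?_) (fun c z hz => ?_) (fun z hz => ?_)
    · have m1 := (hinv h z H hz).1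
      have m2 := (hinv h z' H hz').1
      have e : (fun x => (h x)⁻¹ * (z x + z' x)) = fun x => (h x)⁻¹ * z x + (h x)⁻¹ * z' x := by
        funext x; ring
      rw [e, ← neg_add, ← integral_add (MemLp.integrable_mul_two hgL (m1.weakPartial 0).memLp)
        (MemLp.integrable_mul_two hgL (m2.weakPartial 0).memLp)]
      congr 1
      refine integral_congr_ae ?_
      filter_upwards [weakPartial_add_ae m1 m2 0] with x hx
      rw [hx, mul_add]
    · have m1 := (hinv h z H hz).1
      have e : (fun x => (h x)⁻¹ * (c * z x)) = fun x => c * ((h x)⁻¹ * z x) := by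
        funext x; ring
      rw [e, mul_neg, ← integral_const_mul]
      congr 1
      refine integral_congr_ae ?_
      filter_upwards [weakPartial_const_mul_ae m1 c 0] with x hx
      rw [hx]
      ring
    · have m1 := hinv h z H hz
      rw [abs_neg, mul_assoc]
      exact (abs_integral_mul_le_normH hgL (m1.1.weakPartial 0).memLp).trans
        (mul_le_mul_of_nonneg_left ((normH_weakPartial_le 0 _ 0).trans m1.2) (normH_nonneg _ _))
  obtain ⟨U, hU, hUz⟩ := hkey
  have hU' : MemLp (weakPartial 0 U) 2 := (hU.weakPartial 0).memLp
  set V : Field 1 := fun _ x => (h x)⁻¹ * U x with hV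
  set q : Space 1 → ℝ := fun x => (h x)⁻¹ * weakPartial 0 U x with hq
  have hVn := hinv0 h U H hU.memLp
  have hqn := hinv0 h _ H hU'
  have hVL : ∀ i, MemLp (V i) 2 := fun i => hVn.1
  have hhq : MemLp (fun x => h x * q x) 2 := H.memLp_mul hd hM' hqn.1
  have hdiv : HasWeakDiv γ (mulField h V) (fun x => h x * q x) := by
    refine (hasWeakDiv_of_hasWeakPartial (γ := γ) (V := fun _ => U) (w := fun i => weakPartial i U)
      fun i => hU.hasWeakPartial i).congr (fun i => Eventually.of_forall fun x => ?_)
        (Eventually.of_forall fun x => ?_)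
    · have := hh x
      simp only [mulField, hV]
      field_simp
    · have := hh x
      simp only [hq, Fin.sum_univ_one, hγ0]
      field_simp
  -- the energy estimate multiplied by `μ`: it bounds `X² + Y²` by `|g| (X + Y)`
  set X := √μ * normH 0 U with hX
  set Y := μ * normH 0 (weakPartial 0 U) with hY
  have hX0 : 0 ≤ X := mul_nonneg (Real.sqrt_nonneg _) (normH_nonneg _ _)
  have hY0 : 0 ≤ Y := mul_nonneg hμ.le (normH_nonneg _ _)
  have hXY : X + Y ≤ 2 * B * (C₁ * (√m + 1)) * normH 0 g := by
    have h1 := hUz U hU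
    have hlb : ∀ u : Space 1 → ℝ, MemLp u 2 → B⁻¹ * normH 0 u ^ 2 ≤ ∫ x, (h x)⁻¹ * u x * u x := by
      intro u hu
      rw [normH_zero_sq, ← integral_const_mul]
      refine integral_mono_ae (hu.integrable_sq.const_mul _)
        (MemLp.integrable_mul_two (H.memLp_inv_mul hu) hu) ?_
      filter_upwards [hlow] with x hx
      have := mul_le_mul_of_nonneg_right hx (sq_nonneg (u x))
      linarith [this, sq (u x)]
    have h2 : B⁻¹ * (normH 0 U ^ 2 + μ * normH 0 (weakPartial 0 U) ^ 2)
        ≤ normH 0 g * (C₁ * (normH 0 U + normH 0 (weakPartial 0 U))) := by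
      have e1 := hlb U hU.memLp
      have e2 := mul_le_mul_of_nonneg_left (hlb _ hU') hμ.le
      unfold ellipticForm at h1
      rw [Fin.sum_univ_one, hγ0, one_pow, one_mul] at h1
      have e3 := hinv h U H hU
      have e4 := (neg_le_abs _).trans (abs_integral_mul_le_normH hgL (e3.1.weakPartial 0).memLp)
      have e5 := normH_succ_le 0 U
      rw [Fin.sum_univ_one] at e5
      have e6 := mul_le_mul_of_nonneg_left ((normH_weakPartial_le 0 _ 0).trans
        (e3.2.trans (mul_le_mul_of_nonneg_left e5 hC₁))) (normH_nonneg 0 g)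
      linarith
    have h3 : X ^ 2 + Y ^ 2 ≤ B * (normH 0 g * (C₁ * ((√m + 1) * (X + Y)))) := by
      have e1 := mul_le_mul_of_nonneg_left h2 (mul_pos hB0 hμ).le
      have e2 : B * μ * (B⁻¹ * (normH 0 U ^ 2 + μ * normH 0 (weakPartial 0 U) ^ 2))
          = X ^ 2 + Y ^ 2 := by
        rw [hX, mul_pow, Real.sq_sqrt hμ.le]
        field_simp
        ring
      rw [e2] at e1
      refine e1.trans ?_
      have e3 : μ * normH 0 U ≤ √m * X := by
        rw [hX, ← mul_assoc]
        refine mul_le_mul_of_nonneg_right ?_ (normH_nonneg _ _)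
        nth_rewrite 1 [← Real.mul_self_sqrt hμ.le]
        exact mul_le_mul_of_nonneg_right (Real.sqrt_le_sqrt hμm) (Real.sqrt_nonneg _)
      have e4 : μ * (normH 0 U + normH 0 (weakPartial 0 U)) ≤ (√m + 1) * (X + Y) := by
        have := mul_nonneg (Real.sqrt_nonneg m) hY0
        linarith
      have e5 := mul_le_mul_of_nonneg_left e4
        (mul_nonneg hB0.le (mul_nonneg (normH_nonneg 0 g) hC₁))
      linarith
    rcases (add_nonneg hX0 hY0).eq_or_lt with hz | hpos
    · rw [← hz]
      have := normH_nonneg 0 g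
      positivity
    · refine le_of_mul_le_mul_right ?_ hpos
      nlinarith [sq_nonneg (X - Y)]
  refine ⟨V, q, hVL, hqn.1, hdiv, fun φ hφ => ?_, ?_, ?_⟩
  · have hz := (H.mul_test hd hM' (hφ 0)).1
    rw [hA_eq hd hM' H hVL hdiv hhq hφ, Fin.sum_univ_one, hγ0, mul_one, gradGamma]
    have h1 := hUz _ hz
    have e0 : (fun x => (h x)⁻¹ * (h x * φ 0 x)) = φ 0 := by
      funext x
      rw [← mul_assoc, inv_mul_cancel₀ (hh x), one_mul]
    have e1 : ∫ x, g x * weakPartial 0 (φ 0) x = ∫ x, g x * divGamma γ φ x := by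
      refine integral_congr_ae ?_
      filter_upwards [(hφ 0).weakPartial_ae 0] with x hx
      rw [hx, divGamma, Fin.sum_univ_one, hγ0, one_mul]
    rw [e0, e1] at h1
    rw [← h1, ellipticForm, Fin.sum_univ_one, hγ0, one_pow, one_mul]
    congr 1
    · congr 1; funext x
      simp only [hV]
      ring
    · congr 2; funext x
      have := hh x
      simp only [hq]
      field_simp
  · rw [Fin.sum_univ_one]
    have e1 := mul_le_mul_of_nonneg_left hVn.2 (Real.sqrt_nonneg μ)
    have e2 : C₂ * X ≤ C₂ * (X + Y) := mul_le_mul_of_nonneg_left (by linarith) hC₂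
    have e3 := mul_le_mul_of_nonneg_left hXY hC₂
    change √μ * normH 0 (V 0) ≤ _ at e1
    linarith
  · have e1 := mul_le_mul_of_nonneg_left hqn.2 hμ.le
    have e2 : C₂ * Y ≤ C₂ * (X + Y) := mul_le_mul_of_nonneg_left (by linarith) hC₂
    have e3 := mul_le_mul_of_nonneg_left hXY hC₂
    change μ * normH 0 q ≤ _ at e1
    linarith

/-- The inverse of `h 𝒜` on gradients: for `d ≤ M` the gradient of `h` is bounded, and otherwise
`d = 1` and `M = N = 0`. -/
theorem exists_isInverse_gradGamma {M : ℕ} (hd : d = 1 ∨ d = 2) (hM : d = 1 ∨ d ≤ M)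
    (a b m Γ : ℝ) {N : ℕ} (hN : N ≤ M) : ∃ C, 0 ≤ C ∧ ∀ (h : Space d → ℝ) (μ γ : ℝ)
      (g : Space d → ℝ), IsDepth M a b h → 0 < μ → μ ≤ m → 0 < γ → γ ≤ Γ → MemH N g →
      ∃ V, IsInverse γ μ h (gradGamma γ g) V ∧ MemX γ N V ∧
        √μ * normX γ μ N V ≤ C * normH N g := by
  have hkey : ∃ C, 0 ≤ C ∧ ∀ (h : Space d → ℝ) (μ γ : ℝ) (g : Space d → ℝ),
      IsDepth M a b h → 0 < μ → μ ≤ m → 0 < γ → γ ≤ Γ → MemH N g →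
      ∃ (V : Field d) (q : Space d → ℝ), MemHVec N V ∧ MemH N q ∧
        HasWeakDiv γ (mulField h V) (fun x => h x * q x) ∧
        DistribEq (hA γ μ h V) (gradGamma γ g) ∧
        √μ * ∑ i, normH N (V i) ≤ C * normH N g ∧ μ * normH N q ≤ C * normH N g := by
    by_cases hdM : d ≤ M
    · exact exists_hA_eq_gradGamma hd hdM a b m Γ hN
    · have hd1 : d = 1 := by omega
      have hN0 : N = 0 := by omega
      subst hd1 hN0
      obtain ⟨C, hC0, hC⟩ := exists_hA_eq_gradGamma_one M a b m
      exact ⟨C, hC0, fun h μ γ g H hμ hμm hγ _ hg => hC h μ γ g H hμ hμm hγ hg⟩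
  obtain ⟨C₀, hC₀, hsol⟩ := hkey
  obtain ⟨C₃, hC₃, hdivle⟩ := exists_normH_weakDiv_le hd hM a b Γ hN
  refine ⟨C₀ + C₃ * (C₀ + √m * C₀), by positivity, fun h μ γ g H hμ hμm hγ hγΓ hg => ?_⟩
  obtain ⟨V, q, hV, hq, hdiv, heq, hVn, hqn⟩ := hsol h μ γ g H hμ hμm hγ hγΓ hg
  obtain ⟨hX, hXn⟩ := hdivle h γ V q H hγ hγΓ hV hq hdiv
  have hX0 : MemX γ 0 V := ⟨fun i => (hV i).memLp, _, hX.2.choose_spec.1,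
    hX.2.choose_spec.2.memLp⟩
  refine ⟨V, isInverse_of_hA_eq hd hM H hμ hγ hX0 heq, hX, ?_⟩
  have hss := Real.mul_self_sqrt hμ.le
  have hg0 := mul_nonneg hC₀ (normH_nonneg N g)
  have e1 := mul_le_mul_of_nonneg_left (normX_le (γ := γ) hμ.le N V) (Real.sqrt_nonneg μ)
  have e2 : μ * ∑ i, normH N (V i) ≤ √m * (C₀ * normH N g) := by
    rw [← hss, mul_assoc]
    exact mul_le_mul (Real.sqrt_le_sqrt hμm) hVn (mul_nonneg (Real.sqrt_nonneg _)
      (Finset.sum_nonneg fun i _ => normH_nonneg _ _)) (Real.sqrt_nonneg _)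
  have e3 := mul_le_mul_of_nonneg_left hXn hμ.le
  have e4 := mul_le_mul_of_nonneg_left (add_le_add hqn e2) hC₃
  have e5 : √μ * (√μ * normH N (weakDiv γ V)) = μ * normH N (weakDiv γ V) := by
    rw [← mul_assoc, hss]
  rw [mul_add, e5] at e1
  linarith

/-! ### Monotone constants -/

theorem IsDepth.mono {M : ℕ} {a b a' b' : ℝ} {h : Space d → ℝ} (H : IsDepth M a b h)
    (ha : a ≤ a') (hb : b ≤ b') : IsDepth M a' b' h where
  pos := H.pos.trans_le ha
  memH := H.memH
  norm_le := H.norm_le.trans hb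
  le x := (inv_anti₀ H.pos ha).trans (H.le x)

/-- A bound depending on natural numbers `i`, `j` gives a bound which is nondecreasing in real
parameters. -/
theorem exists_monotone_bound (K : ℕ → ℕ → ℝ) : ∃ C : ℝ → ℝ → ℝ,
    (∀ a a' b b' : ℝ, a ≤ a' → b ≤ b' → C a b ≤ C a' b') ∧ ∀ a b, K ⌈a⌉₊ ⌈b⌉₊ ≤ C a b := by
  refine ⟨fun a b => ∑ i ∈ Finset.range (⌈a⌉₊ + 1), ∑ j ∈ Finset.range (⌈b⌉₊ + 1), |K i j|,
    fun a a' b b' ha hb => ?_, fun a b => ?_⟩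
  · refine (Finset.sum_le_sum fun i _ => Finset.sum_le_sum_of_subset_of_nonneg
      (Finset.range_mono (Nat.succ_le_succ (Nat.ceil_mono hb))) fun _ _ _ => abs_nonneg _).trans
      (Finset.sum_le_sum_of_subset_of_nonneg
        (Finset.range_mono (Nat.succ_le_succ (Nat.ceil_mono ha))) fun _ _ _ =>
          Finset.sum_nonneg fun _ _ => abs_nonneg _)
  · refine (le_abs_self _).trans ((Finset.single_le_sum (f := fun j => |K ⌈a⌉₊ j|)
      (fun _ _ => abs_nonneg _) (Finset.self_mem_range_succ _)).trans
      (Finset.single_le_sum (f := fun i => ∑ j ∈ Finset.range (⌈b⌉₊ + 1), |K i j|)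
        (fun _ _ => Finset.sum_nonneg fun _ _ => abs_nonneg _) (Finset.self_mem_range_succ _)))

end Boussinesq

open Boussinesq in
theorem propositionc3 (d : ℕ) (hd : d = 1 ∨ d = 2) (N M : ℕ) (hNM : N ≤ M)
    (hM : d = 1 ∨ (d : ℝ) / 2 < M) (μmax γmax : ℝ) :
    ∃ C : ℝ → ℝ → ℝ,
      (∀ a a' b b' : ℝ, a ≤ a' → b ≤ b' → C a b ≤ C a' b') ∧
      ∀ (μ γ hmin : ℝ) (hb : Boussinesq.Space d → ℝ),
        0 < μ → μ ≤ μmax → 0 < γ → γ ≤ γmax → 0 < hmin →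
        Boussinesq.MemH (M + 1) (fun x => hb x - 1) → (∀ x, hmin ≤ hb x) →
        (∀ f : Boussinesq.Field d, Boussinesq.MemHVec N f →
          ∃ V : Boussinesq.Field d,
            Boussinesq.IsInverse γ μ hb (Boussinesq.ofField f) V ∧
            Boussinesq.MemX γ N V ∧
            Boussinesq.normX γ μ N V ≤
              C (1 / hmin) (Boussinesq.normH (M + 1) (fun x => hb x - 1)) *
                Boussinesq.normHVec N f) ∧
        (∀ g : Boussinesq.Space d → ℝ, Boussinesq.MemH N g →
          ∃ V : Boussinesq.Field d,
            Boussinesq.IsInverse γ μ hb (Boussinesq.gradGamma γ g) V ∧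
            Boussinesq.MemX γ N V ∧
            Real.sqrt μ * Boussinesq.normX γ μ N V ≤
              C (1 / hmin) (Boussinesq.normH (M + 1) (fun x => hb x - 1)) *
                Boussinesq.normH N g) := by
  have hM' : d = 1 ∨ d ≤ M := by
    refine hM.imp_right fun h => ?_
    -- for `d = 2` the condition `1 < M` on integers is `2 ≤ M`
    rcases hd with rfl | rfl
    · exact Nat.one_le_iff_ne_zero.2 fun h0 => by norm_num [h0] at h
    · norm_num at h
      exact h
  -- the constants are chosen at integer bounds `i ≥ 1 / hmin` and `j ≥ |hb - 1|` only
  choose K hK0 hK using fun i j : ℕ => exists_isInverse_ofField hd hM' i j μmax γmax hNM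
  choose L hL0 hL using fun i j : ℕ => exists_isInverse_gradGamma hd hM' i j μmax γmax hNM
  obtain ⟨C, hC, hKL⟩ := exists_monotone_bound fun i j => d * K i j + L i j
  refine ⟨C, hC, fun μ γ hmin hb hμ hμm hγ hγm hmin0 hbH hble => ?_⟩
  have H : IsDepth M (⌈1 / hmin⌉₊ : ℝ) (⌈normH (M + 1) (fun x => hb x - 1)⌉₊ : ℝ) hb :=
    IsDepth.mono (a := 1 / hmin) ⟨by positivity, hbH, le_rfl, by simpa using hble⟩
      (Nat.le_ceil _) (Nat.le_ceil _)
  have hbd := hKL (1 / hmin) (normH (M + 1) (fun x => hb x - 1))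
  have hK1 := mul_nonneg (Nat.cast_nonneg (α := ℝ) d)
    (hK0 ⌈1 / hmin⌉₊ ⌈normH (M + 1) (fun x => hb x - 1)⌉₊)
  have hL1 := hL0 ⌈1 / hmin⌉₊ ⌈normH (M + 1) (fun x => hb x - 1)⌉₊
  refine ⟨fun f hf => ?_, fun g hg => ?_⟩
  · obtain ⟨V, hV, hX, hn⟩ := hK _ _ hb μ γ f H hμ hμm hγ hγm hf
    refine ⟨V, hV, hX, hn.trans ?_⟩
    have e1 : ∑ i, normH N (f i) ≤ d * normHVec N f := by
      refine (Finset.sum_le_sum fun i _ => normH_le_normHVec N f i).trans (le_of_eq ?_)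
      rw [Finset.sum_const, Finset.card_univ, Fintype.card_fin, nsmul_eq_mul]
    refine (mul_le_mul_of_nonneg_left e1 (hK0 _ _)).trans ?_
    rw [← mul_assoc]
    exact mul_le_mul_of_nonneg_right (by linarith) (Real.sqrt_nonneg _)
  · obtain ⟨V, hV, hX, hn⟩ := hL _ _ hb μ γ g H hμ hμm hγ hγm hg
    exact ⟨V, hV, hX, hn.trans (mul_le_mul_of_nonneg_right (by linarith) (normH_nonneg _ _))⟩
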